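/- Let $\mathfrak H$ be a real separable Hilbert space and let $W=\{W(\phi):\phi\in\mathfrak H\}$ be an isonormal Gaussian process over $\mathfrak H$ (a centered Gaussian family with $\mathbb E(W(\phi)W(\psi))=\langle\phi,\psi\rangle_{\mathfrak H}$) defined on a probability space $(\Omega,\mathcal F,P)$ whose $\sigma$-algebra $\mathcal F$ is generated by $W$ (possibly up to $P$-null sets). For a smooth cylindrical random variable $G=f(W(\varphi_1),\dots,W(\varphi_n))$, where $f\in C^\infty(\mathbb R^n)$ is bounded together with all its partial derivatives, put $$DG=\sum_i \partial_i f(W(\varphi_1),\dots,W(\varphi_n))\,\varphi_i,\qquad D^2G=\sum_{i,j}\partial_i\partial_j f(W(\varphi_1),\dots,W(\varphi_n))\,\varphi_i\otimes\varphi_j .$$ Let $\mathbb D^{2,2}$ be the closure of the space of smooth cylindrical random variables with respect to the norm $\|G\|_{2,2}=\big(\mathbb E(G^2)+\mathbb E(\|DG\|^2_{\mathfrak H})+\mathbb E(\|D^2G\|^2_{\mathfrak H^{\otimes2}})\big)^{1/2}$, with $D$ and $D^2$ extended to $\mathbb D^{2,2}$ by continuity. An element $v\in L^2(\Omega;\mathfrak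 H^{\otimes 2})$ belongs to $\mathrm{Dom}\,\delta^2$ if there is a constant $c>0$ with $|\mathbb E\langle D^2G,v\rangle_{\mathfrak H^{\otimes2}}|\le c\,\|G\|_{L^2(\Omega)}$ for all $G\in\mathbb D^{2,2}$; then $\delta^2(v)\in L^2(\Omega)$ is determined by $\mathbb E(G\,\delta^2(v))=\mathbb E\langle D^2G,v\rangle_{\mathfrak H^{\otimes 2}}$ for all $G\in\mathbb D^{2,2}$. Assume that $v\in \mathrm{Dom}\,\delta^2$, $F=\delta^2(v)\in\mathbb D^{2,2}$ and $\mathbb E(F^2)=1$, and let $Z$ be an $N(0,1)$ random variable. Then $$d_{W}(F,Z)\le\sqrt{2/\pi}\,\sqrt{\mathrm{Var}\big(\langle D^2F,v\rangle_{\mathfrak H^{\otimes2}}\big)}+2\,\mathbb E\big(\big|\langle DF\otimes DF,v\rangle_{\mathfrak H^{\otimes2}}\big|\big),$$ where $d_W(F,Z)=\sup\{|\mathbb E(f(F))-\mathbb E(f(Z))| : f:\mathbb R\to\mathbb R \text{ Lipschitz with constant at most } 1\}$, and the two terms on the right-hand side take values in $[0,\infty]$. -/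

import Mathlib

open MeasureTheory ProbabilityTheory Filter Topology
open scoped ENNReal NNReal TensorProduct

/-- The Hilbert tensor product `H ⊗ H`: the completion of the algebraic tensor product with respect
to the inner product determined by `⟪a ⊗ b, c ⊗ d⟫ = ⟪a, c⟫ ⟪b, d⟫`. -/
abbrev HilbertTensorSq (H : Type*) [NormedAddCommGroup H] [InnerProductSpace ℝ H] : Type _ :=
  UniformSpace.Completion (H ⊗[ℝ] H)

/-- The elementary tensor `a ⊗ b` as an element of the Hilbert tensor product. -/
noncomputable def hilbertTmul {H : Type*} [NormedAddCommGroup H] [InnerProductSpace ℝ H]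
    (a b : H) : HilbertTensorSq H :=
  ((a ⊗ₜ[ℝ] b : H ⊗[ℝ] H) : UniformSpace.Completion (H ⊗[ℝ] H))

/-- `W` is an isonormal Gaussian process over `H` on the probability space `(Ω, P)`, and the
σ-algebra of `Ω` is the one generated by `W` (up to `P`-null sets, so that the completion of the
generated σ-algebra is allowed as well). -/
structure IsIsonormal {H Ω : Type*} [NormedAddCommGroup H] [InnerProductSpace ℝ H]
    [mΩ : MeasurableSpace Ω] (P : Measure Ω) (W : H → Ω → ℝ) : Prop where
  measurable : ∀ h, Measurable (W h)
  gaussian : IsGaussianProcess W P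
  centered : ∀ h, ∫ ω, W h ω ∂P = 0
  covariance : ∀ h g, ∫ ω, W h ω * W g ω ∂P = inner ℝ h g
  generated : ∀ s : Set Ω, MeasurableSet[mΩ] s →
    ∃ t : Set Ω, MeasurableSet[⨆ h, MeasurableSpace.comap (W h) inferInstance] t ∧ s =ᵐ[P] t

/-- The partial derivative `∂f/∂xᵢ`. -/
noncomputable def partialDeriv {n : ℕ} (i : Fin n) (f : (Fin n → ℝ) → ℝ) (x : Fin n → ℝ) : ℝ :=
  fderiv ℝ f x (Pi.single i 1)

/-- The data `(φ₁, …, φₙ; f)` of a smooth cylindrical random variable `f (W φ₁, …, W φₙ)`, where `f`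
is smooth and bounded together with all its derivatives. -/
structure SmoothCylindrical (H : Type*) where
  n : ℕ
  φ : Fin n → H
  f : (Fin n → ℝ) → ℝ
  smooth : ContDiff ℝ (⊤ : ℕ∞) f
  bounded : ∀ k : ℕ, ∃ C : ℝ, ∀ x, ‖iteratedFDeriv ℝ k f x‖ ≤ C

namespace SmoothCylindrical

variable {H Ω : Type*} [NormedAddCommGroup H] [InnerProductSpace ℝ H]

/-- The random variable `f (W φ₁, …, W φₙ)`. -/
def eval (S : SmoothCylindrical H) (W : H → Ω → ℝ) (ω : Ω) : ℝ :=
  S.f (fun i => W (S.φ i) ω)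

/-- The Malliavin derivative `∑ᵢ ∂ᵢf (W φ₁, …, W φₙ) φᵢ`. -/
noncomputable def deriv (S : SmoothCylindrical H) (W : H → Ω → ℝ) (ω : Ω) : H :=
  ∑ i, partialDeriv i S.f (fun l => W (S.φ l) ω) • S.φ i

/-- The second Malliavin derivative `∑ᵢⱼ ∂ᵢ∂ⱼf (W φ₁, …, W φₙ) φᵢ ⊗ φⱼ`. -/
noncomputable def deriv2 (S : SmoothCylindrical H) (W : H → Ω → ℝ) (ω : Ω) : HilbertTensorSq H :=
  ∑ i, ∑ j, partialDeriv i (partialDeriv j S.f) (fun l => W (S.φ l) ω) •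
    hilbertTmul (S.φ i) (S.φ j)

end SmoothCylindrical

/-- `F` belongs to the Sobolev space `𝔻^{2,2}`, with first and second Malliavin derivatives `DF` and
`D2F`: the triple `(F, DF, D2F)` is a limit of the triples of smooth cylindrical random variables,
in `L²(Ω) × L²(Ω; H) × L²(Ω; H ⊗ H)`; that is, `F` is in the closure of the smooth cylindrical
random variables under the norm `(E|F|² + E‖DF‖² + E‖D²F‖²)^{1/2}`. -/
structure HasMalliavinDeriv2 {H Ω : Type*} [NormedAddCommGroup H] [InnerProductSpace ℝ H]
    [MeasurableSpace Ω] (P : Measure Ω) (W : H → Ω → ℝ)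
    (F : Ω → ℝ) (DF : Ω → H) (D2F : Ω → HilbertTensorSq H) : Prop where
  memLp : MemLp F 2 P
  memLp_deriv : MemLp DF 2 P
  memLp_deriv2 : MemLp D2F 2 P
  exists_approx : ∃ S : ℕ → SmoothCylindrical H,
    Tendsto (fun m => eLpNorm (fun ω => (S m).eval W ω - F ω) 2 P) atTop (𝓝 0) ∧
    Tendsto (fun m => eLpNorm (fun ω => (S m).deriv W ω - DF ω) 2 P) atTop (𝓝 0) ∧
    Tendsto (fun m => eLpNorm (fun ω => (S m).deriv2 W ω - D2F ω) 2 P) atTop (𝓝 0)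

/-- `v ∈ Dom δ²`: `v ∈ L²(Ω; H ⊗ H)` and `|E⟨D²G, v⟩| ≤ c ‖G‖_{L²}` for all `G ∈ 𝔻^{2,2}`. -/
def MemDomDivergence2 {H Ω : Type*} [NormedAddCommGroup H] [InnerProductSpace ℝ H]
    [MeasurableSpace Ω] (P : Measure Ω) (W : H → Ω → ℝ) (v : Ω → HilbertTensorSq H) : Prop :=
  MemLp v 2 P ∧ ∃ c : ℝ, 0 < c ∧
    ∀ (G : Ω → ℝ) (DG : Ω → H) (D2G : Ω → HilbertTensorSq H),
      HasMalliavinDeriv2 P W G DG D2G →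
        |∫ ω, inner ℝ (D2G ω) (v ω) ∂P| ≤ c * (eLpNorm G 2 P).toReal

/-- `F = δ²(v)`: `F ∈ L²(Ω)` and `E(G F) = E⟨D²G, v⟩` for all `G ∈ 𝔻^{2,2}`. -/
def IsDivergence2 {H Ω : Type*} [NormedAddCommGroup H] [InnerProductSpace ℝ H]
    [MeasurableSpace Ω] (P : Measure Ω) (W : H → Ω → ℝ)
    (v : Ω → HilbertTensorSq H) (F : Ω → ℝ) : Prop :=
  MemLp F 2 P ∧ ∀ (G : Ω → ℝ) (DG : Ω → H) (D2G : Ω → HilbertTensorSq H),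
    HasMalliavinDeriv2 P W G DG D2G →
      ∫ ω, G ω * F ω ∂P = ∫ ω, inner ℝ (D2G ω) (v ω) ∂P

/-- The Wasserstein distance `sup_{f ∈ Lip(1)} |∫ f dμ - ∫ f dν|` between two probability measures on
`ℝ` with finite first moments. -/
noncomputable def wassersteinDist (μ ν : Measure ℝ) : ℝ≥0∞ :=
  ⨆ (f : ℝ → ℝ) (_ : LipschitzWith 1 f), ENNReal.ofReal |∫ x, f x ∂μ - ∫ x, f x ∂ν|

/-- A smooth function which is bounded together with all its derivatives. -/
structure BoundedSmooth {E F : Type*} [NormedAddCommGroup E] [NormedSpace ℝ E]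
    [NormedAddCommGroup F] [NormedSpace ℝ F] (f : E → F) : Prop where
  smooth : ContDiff ℝ (⊤ : ℕ∞) f
  bounded : ∀ k : ℕ, ∃ C : ℝ, ∀ x, ‖iteratedFDeriv ℝ k f x‖ ≤ C

namespace BoundedSmooth

section General

variable {E F G : Type*} [NormedAddCommGroup E] [NormedSpace ℝ E]
  [NormedAddCommGroup F] [NormedSpace ℝ F] [NormedAddCommGroup G] [NormedSpace ℝ G]

lemma continuous {f : E → F} (hf : BoundedSmooth f) : Continuous f := hf.smooth.continuous

lemma differentiable {f : E → F} (hf : BoundedSmooth f) : Differentiable ℝ f :=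
  hf.smooth.differentiable (by simp)

lemma exists_bound {f : E → F} (hf : BoundedSmooth f) : ∃ C : ℝ, ∀ x, ‖f x‖ ≤ C := by
  obtain ⟨C, hC⟩ := hf.bounded 0
  exact ⟨C, fun x => by simpa using hC x⟩

lemma exists_uniform {f : E → F} (hf : BoundedSmooth f) (n : ℕ) :
    ∃ C : ℝ, 1 ≤ C ∧ ∀ k ≤ n, ∀ x, ‖iteratedFDeriv ℝ k f x‖ ≤ C := by
  choose C hC using hf.bounded
  refine ⟨1 + ∑ k ∈ Finset.range (n + 1), |C k|, ?_, fun k hk x => (hC k x).trans ?_⟩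
  · have : 0 ≤ ∑ k ∈ Finset.range (n + 1), |C k| := Finset.sum_nonneg fun _ _ => abs_nonneg _
    linarith
  · have := Finset.single_le_sum (f := fun k => |C k|) (fun i _ => abs_nonneg (C i))
      (Finset.mem_range.2 (Nat.lt_succ_of_le hk))
    have h2 := le_abs_self (C k)
    linarith

lemma const (c : F) : BoundedSmooth (fun _ : E => c) := by
  refine ⟨contDiff_const, fun k => ⟨‖c‖, fun x => ?_⟩⟩
  rcases Nat.eq_zero_or_pos k with rfl | hk
  · simp
  · simp [iteratedFDeriv_const_of_ne hk.ne']

lemma add {f g : E → F} (hf : BoundedSmooth f) (hg : BoundedSmooth g) :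
    BoundedSmooth (fun x => f x + g x) := by
  refine ⟨hf.smooth.add hg.smooth, fun k => ?_⟩
  obtain ⟨C, hC⟩ := hf.bounded k
  obtain ⟨D, hD⟩ := hg.bounded k
  refine ⟨C + D, fun x => ?_⟩
  have := iteratedFDeriv_add_apply (𝕜 := ℝ) (i := k) (x := x)
    (hf.smooth.contDiffAt.of_le (by exact_mod_cast le_top))
    (hg.smooth.contDiffAt.of_le (by exact_mod_cast le_top))
  change ‖iteratedFDeriv ℝ k (f + g) x‖ ≤ _
  rw [this]
  exact (norm_add_le _ _).trans (add_le_add (hC x) (hD x))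

lemma clm_comp {f : E → F} (hf : BoundedSmooth f) (L : F →L[ℝ] G) :
    BoundedSmooth (fun x => L (f x)) := by
  refine ⟨L.contDiff.comp hf.smooth, fun k => ?_⟩
  obtain ⟨C, hC⟩ := hf.bounded k
  refine ⟨‖L‖ * C, fun x => ?_⟩
  refine (L.norm_iteratedFDeriv_comp_left (hf.smooth.contDiffAt (x := x))
    (by exact_mod_cast le_top)).trans ?_
  gcongr
  exact hC x

lemma neg {f : E → F} (hf : BoundedSmooth f) : BoundedSmooth (fun x => -f x) :=
  hf.clm_comp (-ContinuousLinearMap.id ℝ F)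

lemma sub {f g : E → F} (hf : BoundedSmooth f) (hg : BoundedSmooth g) :
    BoundedSmooth (fun x => f x - g x) := by
  simpa [sub_eq_add_neg] using hf.add hg.neg

lemma sum {ι : Type*} (s : Finset ι) {f : ι → E → F} (hf : ∀ i ∈ s, BoundedSmooth (f i)) :
    BoundedSmooth (fun x => ∑ i ∈ s, f i x) := by
  classical
  induction s using Finset.induction_on with
  | empty => simpa using const (E := E) (0 : F)
  | insert a s ha ih =>
    simp only [Finset.sum_insert ha]
    exact (hf a (Finset.mem_insert_self a s)).add
      (ih fun i hi => hf i (Finset.mem_insert_of_mem hi))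

lemma mul {f g : E → ℝ} (hf : BoundedSmooth f) (hg : BoundedSmooth g) :
    BoundedSmooth (fun x => f x * g x) := by
  refine ⟨hf.smooth.mul hg.smooth, fun k => ?_⟩
  obtain ⟨C, hC1, hC⟩ := hf.exists_uniform k
  obtain ⟨D, hD1, hD⟩ := hg.exists_uniform k
  refine ⟨∑ i ∈ Finset.range (k + 1), (k.choose i : ℝ) * C * D, fun x => ?_⟩
  refine (norm_iteratedFDeriv_mul_le hf.smooth hg.smooth x (n := k)
    (by exact_mod_cast le_top)).trans (Finset.sum_le_sum fun i hi => ?_)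
  have hi' : i ≤ k := Nat.lt_succ_iff.1 (Finset.mem_range.1 hi)
  have := hC i hi' x
  have := hD (k - i) (Nat.sub_le _ _) x
  gcongr

lemma comp {g : F → G} {f : E → F} (hg : BoundedSmooth g) (hf : BoundedSmooth f) :
    BoundedSmooth (fun x => g (f x)) := by
  refine ⟨hg.smooth.comp hf.smooth, fun k => ?_⟩
  obtain ⟨C, hC1, hC⟩ := hg.exists_uniform k
  obtain ⟨D, hD1, hD⟩ := hf.exists_uniform k
  refine ⟨k.factorial * C * D ^ k, fun x => ?_⟩
  refine norm_iteratedFDeriv_comp_le hg.smooth hf.smooth (by exact_mod_cast le_top) x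
    (fun i hi => hC i hi _) (fun i hi1 hi => (hD i hi x).trans ?_)
  exact le_self_pow₀ hD1 (by omega)

lemma fderiv {f : E → F} (hf : BoundedSmooth f) : BoundedSmooth (fderiv ℝ f) := by
  refine ⟨hf.smooth.fderiv_right (by simp), fun k => ?_⟩
  obtain ⟨C, hC⟩ := hf.bounded (k + 1)
  exact ⟨C, fun x => by rw [norm_iteratedFDeriv_fderiv]; exact hC x⟩

lemma of_hasCompactSupport {f : E → F} (hf : ContDiff ℝ (⊤ : ℕ∞) f) (h : HasCompactSupport f) :
    BoundedSmooth f := by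
  refine ⟨hf, fun k => ?_⟩
  obtain ⟨x₀, hx₀⟩ := (hf.continuous_iteratedFDeriv (m := k)
    (by exact_mod_cast le_top)).norm.exists_forall_ge_of_hasCompactSupport
    ((h.iteratedFDeriv k).norm)
  exact ⟨_, hx₀⟩

lemma deriv {f : ℝ → F} (hf : BoundedSmooth f) : BoundedSmooth (_root_.deriv f) := by
  have := hf.fderiv.clm_comp (ContinuousLinearMap.apply ℝ F (1 : ℝ))
  simpa using this

end General

section Integral

universe u
variable {Z : Type*} [MeasurableSpace Z] {E : Type u} [NormedAddCommGroup E] [NormedSpace ℝ E]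

lemma integrable_affine {F : Type u} [NormedAddCommGroup F] [NormedSpace ℝ F]
    {ν : Measure Z} [IsFiniteMeasure ν] {a c : Z → ℝ} {b : Z → E}
    (ha : StronglyMeasurable a) (hb : StronglyMeasurable b) (hc : StronglyMeasurable c)
    (hc1 : ∀ z, |c z| ≤ 1) {f : E → F} (hf : BoundedSmooth f) (x : E) :
    Integrable (fun z => c z • f (a z • x + b z)) ν := by
  obtain ⟨C, hC⟩ := hf.exists_bound
  refine Integrable.of_bound (C := C) ?_ (Eventually.of_forall fun z => ?_)
  · exact (hc.smul (hf.continuous.comp_stronglyMeasurable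
      ((ha.smul stronglyMeasurable_const).add hb))).aestronglyMeasurable
  · rw [norm_smul]
    have := hC (a z • x + b z)
    have h0 := norm_nonneg (f (a z • x + b z))
    have h1 := hc1 z
    rw [← Real.norm_eq_abs] at h1
    nlinarith [norm_nonneg (c z)]

lemma hasFDerivAt_integral_affine {F : Type u} [NormedAddCommGroup F] [NormedSpace ℝ F]
    {ν : Measure Z} [IsFiniteMeasure ν] {a c : Z → ℝ} {b : Z → E}
    (ha : StronglyMeasurable a) (hb : StronglyMeasurable b) (hc : StronglyMeasurable c)
    (ha1 : ∀ z, |a z| ≤ 1) (hc1 : ∀ z, |c z| ≤ 1) {f : E → F} (hf : BoundedSmooth f) (x : E) :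
    HasFDerivAt (fun x => ∫ z, c z • f (a z • x + b z) ∂ν)
      (∫ z, (c z * a z) • _root_.fderiv ℝ f (a z • x + b z) ∂ν) x := by
  obtain ⟨C, hC⟩ := hf.fderiv.exists_bound
  have hca : ∀ z, |c z * a z| ≤ 1 := fun z => by
    rw [abs_mul]; exact mul_le_one₀ (hc1 z) (abs_nonneg _) (ha1 z)
  refine hasFDerivAt_integral_of_dominated_of_fderiv_le (s := Set.univ)
    (F' := fun x z => (c z * a z) • _root_.fderiv ℝ f (a z • x + b z))
    (bound := fun _ => C) univ_mem
    (Eventually.of_forall fun y => (integrable_affine ha hb hc hc1 hf y).aestronglyMeasurable)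
    (integrable_affine ha hb hc hc1 hf x)
    (integrable_affine ha hb (hc.mul ha) hca hf.fderiv x).aestronglyMeasurable
    (Eventually.of_forall fun z y _ => ?_) (integrable_const C)
    (Eventually.of_forall fun z y _ => ?_)
  · rw [norm_smul]
    have := hC (a z • y + b z)
    have h0 := norm_nonneg (_root_.fderiv ℝ f (a z • y + b z))
    have h1 := hca z
    rw [← Real.norm_eq_abs] at h1
    nlinarith [norm_nonneg (c z * a z)]
  · have h1 : HasFDerivAt (fun y : E => a z • y + b z) (a z • ContinuousLinearMap.id ℝ E) y :=
      ((hasFDerivAt_id y).const_smul (a z)).add_const (b z)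
    have h2 := ((hf.differentiable _).hasFDerivAt.comp y h1).const_smul (c z)
    refine h2.congr_fderiv ?_
    ext v
    simp [mul_smul]

lemma contDiff_integral_affine {ν : Measure Z} [IsFiniteMeasure ν] {a : Z → ℝ} {b : Z → E}
    (ha : StronglyMeasurable a) (hb : StronglyMeasurable b) (ha1 : ∀ z, |a z| ≤ 1) (n : ℕ) :
    ∀ {F : Type u} [NormedAddCommGroup F] [NormedSpace ℝ F] {c : Z → ℝ}
      (_ : StronglyMeasurable c) (_ : ∀ z, |c z| ≤ 1) {f : E → F} (_ : BoundedSmooth f),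
      ContDiff ℝ n (fun x => ∫ z, c z • f (a z • x + b z) ∂ν) ∧
      ∃ C : ℝ, ∀ x, ‖iteratedFDeriv ℝ n (fun x => ∫ z, c z • f (a z • x + b z) ∂ν) x‖ ≤ C := by
  induction n with
  | zero =>
    intro F _ _ c hc hc1 f hf
    obtain ⟨C, hC⟩ := hf.exists_bound
    refine ⟨?_, C * ν.real Set.univ, fun x => ?_⟩
    · exact contDiff_zero.2 (continuous_iff_continuousAt.2 fun x =>
        (hasFDerivAt_integral_affine ha hb hc ha1 hc1 hf x).continuousAt)
    · rw [norm_iteratedFDeriv_zero]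
      refine norm_integral_le_of_norm_le_const (Eventually.of_forall fun z => ?_)
      rw [norm_smul]
      have := hC (a z • x + b z)
      have h0 := norm_nonneg (f (a z • x + b z))
      have h1 := hc1 z
      rw [← Real.norm_eq_abs] at h1
      nlinarith [norm_nonneg (c z)]
  | succ n ih =>
    intro F _ _ c hc hc1 f hf
    have hca : ∀ z, |c z * a z| ≤ 1 := fun z => by
      rw [abs_mul]; exact mul_le_one₀ (hc1 z) (abs_nonneg _) (ha1 z)
    have hd : _root_.fderiv ℝ (fun x => ∫ z, c z • f (a z • x + b z) ∂ν) =
        fun x => ∫ z, (c z * a z) • _root_.fderiv ℝ f (a z • x + b z) ∂ν :=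
      funext fun x => (hasFDerivAt_integral_affine ha hb hc ha1 hc1 hf x).fderiv
    obtain ⟨h1, C, hC⟩ := ih (hc.mul ha) hca hf.fderiv
    refine ⟨?_, C, fun x => ?_⟩
    · rw [show ((n + 1 : ℕ) : WithTop ℕ∞) = (n : WithTop ℕ∞) + 1 by simp]
      refine contDiff_succ_iff_fderiv.2 ⟨fun x =>
        (hasFDerivAt_integral_affine ha hb hc ha1 hc1 hf x).differentiableAt, by simp, ?_⟩
      rw [hd]; exact h1
    · rw [← norm_iteratedFDeriv_fderiv, hd]; exact hC x

lemma integral_affine {F : Type u} [NormedAddCommGroup F] [NormedSpace ℝ F]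
    {ν : Measure Z} [IsFiniteMeasure ν] {a c : Z → ℝ} {b : Z → E}
    (ha : StronglyMeasurable a) (hb : StronglyMeasurable b) (hc : StronglyMeasurable c)
    (ha1 : ∀ z, |a z| ≤ 1) (hc1 : ∀ z, |c z| ≤ 1) {f : E → F} (hf : BoundedSmooth f) :
    BoundedSmooth (fun x => ∫ z, c z • f (a z • x + b z) ∂ν) :=
  ⟨contDiff_infty.2 fun n => (contDiff_integral_affine ha hb ha1 n hc hc1 hf).1,
    fun k => (contDiff_integral_affine ha hb ha1 k hc hc1 hf).2⟩

end Integral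

end BoundedSmooth

section HilbertTmul

variable {H : Type*} [NormedAddCommGroup H] [InnerProductSpace ℝ H]

lemma hilbertTmul_add_left (a b c : H) :
    hilbertTmul (a + b) c = hilbertTmul a c + hilbertTmul b c := by
  simp only [hilbertTmul, TensorProduct.add_tmul]
  exact UniformSpace.Completion.coe_add _ _

lemma hilbertTmul_add_right (a b c : H) :
    hilbertTmul a (b + c) = hilbertTmul a b + hilbertTmul a c := by
  simp only [hilbertTmul, TensorProduct.tmul_add]
  exact UniformSpace.Completion.coe_add _ _

lemma hilbertTmul_smul_left (r : ℝ) (a b : H) :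
    hilbertTmul (r • a) b = r • hilbertTmul a b := by
  rw [hilbertTmul, ← TensorProduct.smul_tmul', UniformSpace.Completion.coe_smul, hilbertTmul]

lemma hilbertTmul_smul_right (r : ℝ) (a b : H) :
    hilbertTmul a (r • b) = r • hilbertTmul a b := by
  rw [hilbertTmul, TensorProduct.tmul_smul, UniformSpace.Completion.coe_smul, hilbertTmul]

/-- The elementary tensor as a bilinear map. -/
noncomputable def hilbertTmulₗ : H →ₗ[ℝ] H →ₗ[ℝ] HilbertTensorSq H :=
  LinearMap.mk₂ ℝ hilbertTmul hilbertTmul_add_left hilbertTmul_smul_left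
    hilbertTmul_add_right hilbertTmul_smul_right

lemma hilbertTmulₗ_apply (a b : H) : hilbertTmulₗ a b = hilbertTmul a b := rfl

lemma hilbertTmul_sum_left {ι : Type*} (s : Finset ι) (f : ι → H) (b : H) :
    hilbertTmul (∑ i ∈ s, f i) b = ∑ i ∈ s, hilbertTmul (f i) b := by
  simp only [← hilbertTmulₗ_apply, map_sum, LinearMap.sum_apply]

lemma hilbertTmul_sum_right {ι : Type*} (s : Finset ι) (f : ι → H) (b : H) :
    hilbertTmul b (∑ i ∈ s, f i) = ∑ i ∈ s, hilbertTmul b (f i) := by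
  simp only [← hilbertTmulₗ_apply, map_sum]

lemma hilbertTmul_sub_left (a b c : H) :
    hilbertTmul (a - b) c = hilbertTmul a c - hilbertTmul b c := by
  simp only [← hilbertTmulₗ_apply, map_sub, LinearMap.sub_apply]

lemma hilbertTmul_sub_right (a b c : H) :
    hilbertTmul a (b - c) = hilbertTmul a b - hilbertTmul a c := by
  simp only [← hilbertTmulₗ_apply, map_sub]

lemma inner_hilbertTmul (a b c d : H) :
    inner ℝ (hilbertTmul a b) (hilbertTmul c d) = inner ℝ a c * inner ℝ b d := by
  simp [hilbertTmul, UniformSpace.Completion.inner_coe]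

lemma norm_hilbertTmul (a b : H) : ‖hilbertTmul a b‖ = ‖a‖ * ‖b‖ := by
  simp [hilbertTmul]

lemma continuous_hilbertTmul : Continuous fun p : H × H => hilbertTmul p.1 p.2 :=
  (UniformSpace.Completion.continuous_coe _).comp (TensorProduct.continuous_tmul)

lemma norm_hilbertTmul_self_sub_le (a b : H) :
    ‖hilbertTmul a a - hilbertTmul b b‖ ≤ ‖a - b‖ * (‖a‖ + ‖b‖) := by
  have : hilbertTmul a a - hilbertTmul b b = hilbertTmul (a - b) a + hilbertTmul b (a - b) := by
    rw [hilbertTmul_sub_left, hilbertTmul_sub_right]; abel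
  rw [this]
  refine (norm_add_le _ _).trans ?_
  rw [norm_hilbertTmul, norm_hilbertTmul]
  linarith [mul_comm ‖b‖ ‖a - b‖]

end HilbertTmul

section PartialDeriv

variable {n : ℕ}

lemma partialDeriv_add {f g : (Fin n → ℝ) → ℝ} (hf : Differentiable ℝ f) (hg : Differentiable ℝ g)
    (i : Fin n) : partialDeriv i (fun x => f x + g x) =
      fun x => partialDeriv i f x + partialDeriv i g x := by
  funext x
  simp [partialDeriv, fderiv_fun_add (hf x) (hg x)]

lemma partialDeriv_sub {f g : (Fin n → ℝ) → ℝ} (hf : Differentiable ℝ f) (hg : Differentiable ℝ g)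
    (i : Fin n) : partialDeriv i (fun x => f x - g x) =
      fun x => partialDeriv i f x - partialDeriv i g x := by
  funext x
  simp [partialDeriv, fderiv_fun_sub (hf x) (hg x)]

lemma partialDeriv_mul {f g : (Fin n → ℝ) → ℝ} (hf : Differentiable ℝ f) (hg : Differentiable ℝ g)
    (i : Fin n) : partialDeriv i (fun x => f x * g x) =
      fun x => f x * partialDeriv i g x + g x * partialDeriv i f x := by
  funext x
  simp [partialDeriv, fderiv_fun_mul (hf x) (hg x)]

lemma partialDeriv_const_mul {f : (Fin n → ℝ) → ℝ} (hf : Differentiable ℝ f) (c : ℝ)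
    (i : Fin n) : partialDeriv i (fun x => c * f x) = fun x => c * partialDeriv i f x := by
  funext x
  simp [partialDeriv, fderiv_const_mul (hf x)]

lemma partialDeriv_sum {ι : Type*} (s : Finset ι) {f : ι → (Fin n → ℝ) → ℝ}
    (hf : ∀ i ∈ s, Differentiable ℝ (f i)) (k : Fin n) :
    partialDeriv k (fun x => ∑ i ∈ s, f i x) = fun x => ∑ i ∈ s, partialDeriv k (f i) x := by
  funext x
  simp [partialDeriv, fderiv_fun_sum (fun i hi => (hf i hi) x)]

lemma partialDeriv_comp {θ : ℝ → ℝ} {f : (Fin n → ℝ) → ℝ} (hθ : Differentiable ℝ θ)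
    (hf : Differentiable ℝ f) (i : Fin n) :
    partialDeriv i (fun x => θ (f x)) = fun x => deriv θ (f x) * partialDeriv i f x := by
  funext x
  have := ((hθ (f x)).hasDerivAt.comp_hasFDerivAt x (hf x).hasFDerivAt).fderiv
  rw [partialDeriv, show (fun x => θ (f x)) = θ ∘ f from rfl, this]
  simp [partialDeriv]

lemma partialDeriv_proj (i k : Fin n) (x : Fin n → ℝ) :
    partialDeriv k (fun x => x i) x = if i = k then 1 else 0 := by
  have : fderiv ℝ (fun x : Fin n → ℝ => x i) x = ContinuousLinearMap.proj i :=
    (ContinuousLinearMap.proj (R := ℝ) (φ := fun _ : Fin n => ℝ) i).fderiv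
  rw [partialDeriv, this]
  simp [Pi.single_apply]

lemma fderiv_eq_sum_partialDeriv (f : (Fin n → ℝ) → ℝ) (x c : Fin n → ℝ) :
    fderiv ℝ f x c = ∑ i, partialDeriv i f x * c i := by
  conv_lhs => rw [← Finset.univ_sum_single c, map_sum]
  refine Finset.sum_congr rfl fun i _ => ?_
  rw [partialDeriv, mul_comm, ← smul_eq_mul, ← map_smul, ← Pi.single_smul']
  simp

lemma BoundedSmooth.partialDeriv {f : (Fin n → ℝ) → ℝ} (hf : BoundedSmooth f) (i : Fin n) :
    BoundedSmooth (partialDeriv i f) :=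
  hf.fderiv.clm_comp (ContinuousLinearMap.apply ℝ ℝ (Pi.single i 1))

lemma partialDeriv_comm {f : (Fin n → ℝ) → ℝ} (hf : BoundedSmooth f) (i j : Fin n) :
    partialDeriv i (partialDeriv j f) = partialDeriv j (partialDeriv i f) := by
  have key : ∀ (i j : Fin n) x, partialDeriv i (partialDeriv j f) x =
      fderiv ℝ (fderiv ℝ f) x (Pi.single i 1) (Pi.single j 1) := by
    intro i j x
    have h := (ContinuousLinearMap.apply ℝ ℝ (Pi.single j 1 : Fin n → ℝ)).hasFDerivAt.comp x
      (hf.fderiv.differentiable x).hasFDerivAt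
    rw [_root_.partialDeriv, show _root_.partialDeriv j f =
      (ContinuousLinearMap.apply ℝ ℝ (Pi.single j 1 : Fin n → ℝ)) ∘ fderiv ℝ f from rfl, h.fderiv]
    simp
  funext x
  rw [key, key]
  exact (hf.smooth.contDiffAt.isSymmSndFDerivAt
    (by simpa using WithTop.coe_le_coe.2 (le_top : (2 : ℕ∞) ≤ ⊤))) _ _

end PartialDeriv

section Cylindrical

variable {H : Type*} [NormedAddCommGroup H] [InnerProductSpace ℝ H] {n : ℕ} (φ : Fin n → H)

/-- The gradient in `H` of the cylindrical functional `u (W φ₁, …, W φₙ)`. -/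
noncomputable def cylGrad (u : (Fin n → ℝ) → ℝ) (x : Fin n → ℝ) : H :=
  ∑ i, partialDeriv i u x • φ i

/-- The Hessian in `H ⊗ H` of the cylindrical functional `u (W φ₁, …, W φₙ)`. -/
noncomputable def cylHess (u : (Fin n → ℝ) → ℝ) (x : Fin n → ℝ) : HilbertTensorSq H :=
  ∑ i, ∑ j, partialDeriv i (partialDeriv j u) x • hilbertTmul (φ i) (φ j)

/-- The number operator (minus the Ornstein–Uhlenbeck generator) on cylindrical functionals. -/
noncomputable def cylNum (u : (Fin n → ℝ) → ℝ) (x : Fin n → ℝ) : ℝ :=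
  ∑ i, x i * partialDeriv i u x -
    ∑ i, ∑ j, inner ℝ (φ i) (φ j) * partialDeriv i (partialDeriv j u) x

variable {φ}

lemma inner_cylGrad (u : (Fin n → ℝ) → ℝ) (x : Fin n → ℝ) (h : H) :
    inner ℝ (cylGrad φ u x) h = ∑ i, partialDeriv i u x * inner ℝ (φ i) h := by
  simp [cylGrad, sum_inner, inner_smul_left]

lemma cylHess_eq_sum (u : (Fin n → ℝ) → ℝ) (x : Fin n → ℝ) :
    cylHess φ u x = ∑ j, hilbertTmul (cylGrad φ (partialDeriv j u) x) (φ j) := by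
  simp only [cylGrad, hilbertTmul_sum_left, hilbertTmul_smul_left]
  exact Finset.sum_comm

lemma cylNum_eq (u : (Fin n → ℝ) → ℝ) (x : Fin n → ℝ) :
    cylNum φ u x = ∑ i, (x i * partialDeriv i u x -
      inner ℝ (cylGrad φ (partialDeriv i u) x) (φ i)) := by
  rw [cylNum, Finset.sum_sub_distrib]
  congr 1
  simp only [inner_cylGrad]
  rw [Finset.sum_comm]
  exact Finset.sum_congr rfl fun i _ => Finset.sum_congr rfl fun j _ => mul_comm _ _

lemma cylGrad_mul {f g : (Fin n → ℝ) → ℝ} (hf : Differentiable ℝ f) (hg : Differentiable ℝ g)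
    (x : Fin n → ℝ) : cylGrad φ (fun x => f x * g x) x =
      f x • cylGrad φ g x + g x • cylGrad φ f x := by
  simp [cylGrad, partialDeriv_mul hf hg, Finset.smul_sum, add_smul, mul_smul,
    Finset.sum_add_distrib]

lemma cylGrad_add {f g : (Fin n → ℝ) → ℝ} (hf : Differentiable ℝ f) (hg : Differentiable ℝ g)
    (x : Fin n → ℝ) : cylGrad φ (fun x => f x + g x) x = cylGrad φ f x + cylGrad φ g x := by
  simp [cylGrad, partialDeriv_add hf hg, add_smul, Finset.sum_add_distrib]

lemma cylGrad_sub {f g : (Fin n → ℝ) → ℝ} (hf : Differentiable ℝ f) (hg : Differentiable ℝ g)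
    (x : Fin n → ℝ) : cylGrad φ (fun x => f x - g x) x = cylGrad φ f x - cylGrad φ g x := by
  simp [cylGrad, partialDeriv_sub hf hg, sub_smul, Finset.sum_sub_distrib]

lemma cylGrad_comp {θ : ℝ → ℝ} {f : (Fin n → ℝ) → ℝ} (hθ : Differentiable ℝ θ)
    (hf : Differentiable ℝ f) (x : Fin n → ℝ) :
    cylGrad φ (fun x => θ (f x)) x = deriv θ (f x) • cylGrad φ f x := by
  simp [cylGrad, partialDeriv_comp hθ hf, Finset.smul_sum, mul_smul]

lemma cylHess_add {f g : (Fin n → ℝ) → ℝ} (hf : BoundedSmooth f) (hg : BoundedSmooth g)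
    (x : Fin n → ℝ) : cylHess φ (fun x => f x + g x) x = cylHess φ f x + cylHess φ g x := by
  simp only [cylHess_eq_sum, partialDeriv_add hf.differentiable hg.differentiable,
    cylGrad_add (hf.partialDeriv _).differentiable (hg.partialDeriv _).differentiable,
    hilbertTmul_add_left, Finset.sum_add_distrib]

lemma cylHess_sub {f g : (Fin n → ℝ) → ℝ} (hf : BoundedSmooth f) (hg : BoundedSmooth g)
    (x : Fin n → ℝ) : cylHess φ (fun x => f x - g x) x = cylHess φ f x - cylHess φ g x := by
  simp only [cylHess_eq_sum, partialDeriv_sub hf.differentiable hg.differentiable,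
    cylGrad_sub (hf.partialDeriv _).differentiable (hg.partialDeriv _).differentiable,
    hilbertTmul_sub_left, Finset.sum_sub_distrib]

lemma cylHess_mul {f g : (Fin n → ℝ) → ℝ} (hf : BoundedSmooth f) (hg : BoundedSmooth g)
    (x : Fin n → ℝ) : cylHess φ (fun x => f x * g x) x =
      f x • cylHess φ g x + g x • cylHess φ f x +
        hilbertTmul (cylGrad φ f x) (cylGrad φ g x) +
        hilbertTmul (cylGrad φ g x) (cylGrad φ f x) := by
  have h : ∀ j, hilbertTmul (cylGrad φ (partialDeriv j fun x => f x * g x) x) (φ j) =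
      f x • hilbertTmul (cylGrad φ (partialDeriv j g) x) (φ j) +
      g x • hilbertTmul (cylGrad φ (partialDeriv j f) x) (φ j) +
      hilbertTmul (cylGrad φ f x) (partialDeriv j g x • φ j) +
      hilbertTmul (cylGrad φ g x) (partialDeriv j f x • φ j) := by
    intro j
    rw [partialDeriv_mul hf.differentiable hg.differentiable,
      cylGrad_add (hf.mul (hg.partialDeriv j)).differentiable
        (hg.mul (hf.partialDeriv j)).differentiable,
      cylGrad_mul hf.differentiable (hg.partialDeriv j).differentiable,
      cylGrad_mul hg.differentiable (hf.partialDeriv j).differentiable]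
    simp only [hilbertTmul_add_left, hilbertTmul_smul_left, hilbertTmul_smul_right]
    abel
  simp only [cylHess_eq_sum, h, Finset.sum_add_distrib, ← hilbertTmul_sum_right, ← Finset.smul_sum]
  rfl

lemma cylHess_comp {θ : ℝ → ℝ} {f : (Fin n → ℝ) → ℝ} (hθ : BoundedSmooth θ)
    (hf : BoundedSmooth f) (x : Fin n → ℝ) :
    cylHess φ (fun x => θ (f x)) x = deriv θ (f x) • cylHess φ f x +
      deriv (deriv θ) (f x) • hilbertTmul (cylGrad φ f x) (cylGrad φ f x) := by
  have h : ∀ j, hilbertTmul (cylGrad φ (partialDeriv j fun x => θ (f x)) x) (φ j) =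
      deriv θ (f x) • hilbertTmul (cylGrad φ (partialDeriv j f) x) (φ j) +
      deriv (deriv θ) (f x) • hilbertTmul (cylGrad φ f x) (partialDeriv j f x • φ j) := by
    intro j
    rw [partialDeriv_comp hθ.differentiable hf.differentiable,
      cylGrad_mul (hθ.deriv.comp hf).differentiable (hf.partialDeriv j).differentiable,
      cylGrad_comp hθ.deriv.differentiable hf.differentiable]
    simp only [hilbertTmul_add_left, hilbertTmul_smul_left, hilbertTmul_smul_right]
    rw [smul_comm]
  simp only [cylHess_eq_sum, h, Finset.sum_add_distrib, ← hilbertTmul_sum_right, ← Finset.smul_sum]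
  rfl

lemma cylNum_sub {f g : (Fin n → ℝ) → ℝ} (hf : BoundedSmooth f) (hg : BoundedSmooth g)
    (x : Fin n → ℝ) : cylNum φ (fun x => f x - g x) x = cylNum φ f x - cylNum φ g x := by
  simp only [cylNum_eq, partialDeriv_sub hf.differentiable hg.differentiable,
    cylGrad_sub (hf.partialDeriv _).differentiable (hg.partialDeriv _).differentiable,
    inner_sub_left, ← Finset.sum_sub_distrib]
  exact Finset.sum_congr rfl fun i _ => by ring

lemma inner_cylHess_hilbertTmul (u : (Fin n → ℝ) → ℝ) (x : Fin n → ℝ) (a b : H) :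
    inner ℝ (cylHess φ u x) (hilbertTmul a b) =
      ∑ j, inner ℝ (cylGrad φ (partialDeriv j u) x) a * inner ℝ (φ j) b := by
  simp only [cylHess_eq_sum, sum_inner, inner_hilbertTmul]

lemma norm_cylHess_sq (u : (Fin n → ℝ) → ℝ) (x : Fin n → ℝ) :
    ‖cylHess φ u x‖ ^ 2 = ∑ k, ∑ l, inner ℝ (φ k) (φ l) *
      inner ℝ (cylGrad φ (partialDeriv l u) x) (cylGrad φ (partialDeriv k u) x) := by
  rw [← real_inner_self_eq_norm_sq]
  simp only [cylHess_eq_sum, sum_inner, inner_sum, inner_hilbertTmul]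
  exact Finset.sum_congr rfl fun i _ => Finset.sum_congr rfl fun j _ => by
    rw [mul_comm, real_inner_comm (φ i) (φ j)]

/-- The carré du champ `‖Du‖²`. -/
noncomputable def cylEnergy (φ : Fin n → H) (u : (Fin n → ℝ) → ℝ) (x : Fin n → ℝ) : ℝ :=
  ∑ i, ∑ j, inner ℝ (φ i) (φ j) * (partialDeriv i u x * partialDeriv j u x)

lemma cylEnergy_eq (u : (Fin n → ℝ) → ℝ) (x : Fin n → ℝ) :
    cylEnergy φ u x = ‖cylGrad φ u x‖ ^ 2 := by
  rw [← real_inner_self_eq_norm_sq]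
  simp only [cylGrad, cylEnergy, sum_inner, inner_sum, real_inner_smul_left, real_inner_smul_right]
  exact Finset.sum_congr rfl fun i _ => Finset.sum_congr rfl fun j _ => by
    rw [real_inner_comm (φ i) (φ j)]; ring

lemma BoundedSmooth.cylEnergy {u : (Fin n → ℝ) → ℝ} (hu : BoundedSmooth u) :
    BoundedSmooth (cylEnergy φ u) :=
  BoundedSmooth.sum _ fun i _ => BoundedSmooth.sum _ fun j _ =>
    (BoundedSmooth.const _).mul ((hu.partialDeriv i).mul (hu.partialDeriv j))

lemma inner_cylGrad_cylEnergy {u : (Fin n → ℝ) → ℝ} (hu : BoundedSmooth u) (x : Fin n → ℝ) :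
    inner ℝ (cylGrad φ (cylEnergy φ u) x) (cylGrad φ u x) =
      2 * inner ℝ (cylHess φ u x) (hilbertTmul (cylGrad φ u x) (cylGrad φ u x)) := by
  have hp : ∀ k, partialDeriv k (cylEnergy φ u) x = 2 * ∑ j, inner ℝ (φ j) (cylGrad φ u x) *
      partialDeriv k (partialDeriv j u) x := by
    intro k
    have e1 : ∀ i, Differentiable ℝ fun x => ∑ j, inner ℝ (φ i) (φ j) *
        (partialDeriv i u x * partialDeriv j u x) := fun i =>
      (BoundedSmooth.sum _ fun j _ => (BoundedSmooth.const _).mul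
        ((hu.partialDeriv i).mul (hu.partialDeriv j))).differentiable
    unfold cylEnergy
    rw [partialDeriv_sum _ (fun i _ => e1 i)]
    have e2 : ∀ i, partialDeriv k (fun x => ∑ j, inner ℝ (φ i) (φ j) *
        (partialDeriv i u x * partialDeriv j u x)) x = ∑ j, inner ℝ (φ i) (φ j) *
        (partialDeriv i u x * partialDeriv k (partialDeriv j u) x +
          partialDeriv j u x * partialDeriv k (partialDeriv i u) x) := by
      intro i
      rw [partialDeriv_sum _ (fun j _ => ((BoundedSmooth.const _).mul
        ((hu.partialDeriv i).mul (hu.partialDeriv j))).differentiable)]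
      refine Finset.sum_congr rfl fun j _ => ?_
      rw [partialDeriv_const_mul ((hu.partialDeriv i).mul (hu.partialDeriv j)).differentiable,
        partialDeriv_mul (hu.partialDeriv i).differentiable (hu.partialDeriv j).differentiable]
    simp only [e2, mul_add, Finset.sum_add_distrib]
    rw [two_mul]
    congr 1
    · rw [Finset.sum_comm]
      refine Finset.sum_congr rfl fun j _ => ?_
      rw [real_inner_comm, inner_cylGrad, Finset.sum_mul]
      exact Finset.sum_congr rfl fun i _ => by ring
    · refine Finset.sum_congr rfl fun j _ => ?_
      rw [real_inner_comm, inner_cylGrad, Finset.sum_mul]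
      exact Finset.sum_congr rfl fun i _ => by rw [real_inner_comm]; ring
  rw [inner_cylHess_hilbertTmul, inner_cylGrad]
  simp only [hp, inner_cylGrad, Finset.sum_mul, Finset.mul_sum]
  rw [Finset.sum_comm]
  exact Finset.sum_congr rfl fun i _ => Finset.sum_congr rfl fun j _ => by ring

lemma differentiable_proj_mul {u : (Fin n → ℝ) → ℝ} (hu : Differentiable ℝ u) (i : Fin n) :
    Differentiable ℝ fun x : Fin n → ℝ => x i * u x :=
  (differentiable_apply i).mul hu

lemma partialDeriv_cylNum {u : (Fin n → ℝ) → ℝ} (hu : BoundedSmooth u) (k : Fin n)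
    (x : Fin n → ℝ) : partialDeriv k (cylNum φ u) x =
      partialDeriv k u x + cylNum φ (partialDeriv k u) x := by
  unfold cylNum
  have h1 : ∀ i, Differentiable ℝ fun x : Fin n → ℝ => x i * partialDeriv i u x :=
    fun i => differentiable_proj_mul (hu.partialDeriv i).differentiable i
  have h2 : ∀ i j, Differentiable ℝ fun x : Fin n → ℝ =>
      inner ℝ (φ i) (φ j) * partialDeriv i (partialDeriv j u) x :=
    fun i j => ((hu.partialDeriv j).partialDeriv i).differentiable.const_mul _
  rw [partialDeriv_sub (Differentiable.fun_sum fun i _ => h1 i)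
    (Differentiable.fun_sum fun i _ => Differentiable.fun_sum fun j _ => h2 i j),
    partialDeriv_sum _ (fun i _ => h1 i),
    partialDeriv_sum _ (fun i _ => Differentiable.fun_sum fun j _ => h2 i j)]
  have e1 : ∀ i, partialDeriv k (fun x : Fin n → ℝ => x i * partialDeriv i u x) x =
      x i * partialDeriv i (partialDeriv k u) x + if i = k then partialDeriv i u x else 0 := by
    intro i
    rw [partialDeriv_mul (differentiable_apply i) (hu.partialDeriv i).differentiable,
      partialDeriv_comm hu k i]
    simp [partialDeriv_proj]
  have e2 : ∀ i, partialDeriv k (fun x : Fin n → ℝ => ∑ j, inner ℝ (φ i) (φ j) *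
      partialDeriv i (partialDeriv j u) x) x = ∑ j, inner ℝ (φ i) (φ j) *
      partialDeriv i (partialDeriv j (partialDeriv k u)) x := by
    intro i
    rw [partialDeriv_sum _ (fun j _ => h2 i j)]
    refine Finset.sum_congr rfl fun j _ => ?_
    rw [partialDeriv_const_mul ((hu.partialDeriv j).partialDeriv i).differentiable,
      partialDeriv_comm (hu.partialDeriv j) k i, partialDeriv_comm hu k j]
  simp only [e1, e2, Finset.sum_add_distrib, Finset.sum_ite_eq', Finset.mem_univ, if_true]
  ring

end Cylindrical

lemma integrable_gaussianReal_iff {v : ℝ≥0} (hv : v ≠ 0) {g : ℝ → ℝ} :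
    Integrable g (gaussianReal 0 v) ↔ Integrable (fun x => gaussianPDFReal 0 v x * g x) := by
  rw [gaussianReal_of_var_ne_zero _ hv, integrable_withDensity_iff_integrable_smul'
    (measurable_gaussianPDF 0 v) (Eventually.of_forall fun x => gaussianPDF_lt_top)]
  simp [toReal_gaussianPDF]

lemma hasDerivAt_gaussianPDFReal {v : ℝ≥0} (hv : v ≠ 0) (x : ℝ) :
    HasDerivAt (gaussianPDFReal 0 v) (-(x / v) * gaussianPDFReal 0 v x) x := by
  have hv' : (v : ℝ) ≠ 0 := by exact_mod_cast hv
  rw [gaussianPDFReal_def]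
  have h1 : HasDerivAt (fun x : ℝ => -(x - 0) ^ 2 / (2 * (v : ℝ))) (-(x / v)) x := by
    have := ((((hasDerivAt_id x).sub_const 0).pow 2).neg).div_const (2 * (v : ℝ))
    refine this.congr_deriv ?_
    simp
    field_simp
  refine (h1.exp.const_mul _).congr_deriv ?_
  ring

/-- Gaussian integration by parts in dimension one. -/
lemma integral_id_mul_gaussianReal {v : ℝ≥0} (hv : v ≠ 0) {g g' : ℝ → ℝ}
    (hg : ∀ x, HasDerivAt g (g' x) x) (h0 : Integrable g (gaussianReal 0 v))
    (h1 : Integrable g' (gaussianReal 0 v)) (h2 : Integrable (fun x => x * g x) (gaussianReal 0 v)) :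
    ∫ x, x * g x ∂(gaussianReal 0 v) = v * ∫ x, g' x ∂(gaussianReal 0 v) := by
  have hv' : (v : ℝ) ≠ 0 := by exact_mod_cast hv
  rw [integrable_gaussianReal_iff hv] at h0 h1 h2
  rw [integral_gaussianReal_eq_integral_smul hv, integral_gaussianReal_eq_integral_smul hv]
  have := integral_mul_deriv_eq_deriv_mul_of_integrable (u := g) (u' := g')
    (v := gaussianPDFReal 0 v) (v' := fun x => -(x / v) * gaussianPDFReal 0 v x)
    (fun x _ => hg x) (fun x _ => hasDerivAt_gaussianPDFReal hv x)
    (by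
      refine (h2.const_mul (-(v : ℝ)⁻¹)).congr (Eventually.of_forall fun x => ?_)
      simp only [Pi.mul_apply]
      field_simp)
    (by simpa [mul_comm] using! h1) (by simpa [mul_comm] using! h0)
  simp only [smul_eq_mul]
  have e1 : ∫ x, gaussianPDFReal 0 v x * (x * g x) =
      -v * ∫ x, g x * (-(x / v) * gaussianPDFReal 0 v x) := by
    rw [← integral_const_mul]
    refine integral_congr_ae (Eventually.of_forall fun x => ?_)
    simp only
    field_simp
  rw [e1, this]
  simp only [mul_comm (g' _)]
  ring

namespace IsIsonormal

variable {H Ω : Type*} [NormedAddCommGroup H] [InnerProductSpace ℝ H]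
  [MeasurableSpace Ω] {P : Measure Ω} {W : H → Ω → ℝ}

lemma isProbabilityMeasure (hW : IsIsonormal P W) : IsProbabilityMeasure P :=
  hW.gaussian.isProbabilityMeasure

lemma memLp (hW : IsIsonormal P W) (h : H) {p : ℝ≥0∞} (hp : p ≠ ⊤) : MemLp (W h) p P :=
  (hW.gaussian.hasGaussianLaw_eval h).memLp hp

lemma covariance_eq (hW : IsIsonormal P W) (h g : H) : cov[W h, W g; P] = inner ℝ h g := by
  rw [ProbabilityTheory.covariance, ← hW.covariance]
  simp [hW.centered]

lemma map_eq (hW : IsIsonormal P W) (h : H) :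
    P.map (W h) = gaussianReal 0 (‖h‖₊ ^ 2) := by
  have := hW.isProbabilityMeasure
  rw [(hW.gaussian.hasGaussianLaw_eval h).map_eq_gaussianReal, hW.centered,
    ← covariance_self (hW.measurable h).aemeasurable, hW.covariance_eq, real_inner_self_eq_norm_sq]
  congr 1
  ext
  simp

lemma indepFun_residual (hW : IsIsonormal P W) {n : ℕ} (φ : Fin n → H) (h : H) (hh : h ≠ 0) :
    IndepFun (W h) (fun ω i => W (φ i) ω - W h ω * (inner ℝ (φ i) h / ‖h‖ ^ 2)) P := by
  classical
  have := hW.isProbabilityMeasure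
  have hp : IsGaussianProcess (Sum.elim (fun _ : Unit => W h)
      (fun (i : Fin n) ω => W (φ i) ω - W h ω * (inner ℝ (φ i) h / ‖h‖ ^ 2))) P := by
    refine hW.gaussian.of_isGaussianProcess fun s => ?_
    rcases s with s | i
    · exact ⟨{h}, ContinuousLinearMap.proj ⟨h, by simp⟩, fun ω => rfl⟩
    · refine ⟨{φ i, h}, ContinuousLinearMap.proj ⟨φ i, by simp⟩ -
        (inner ℝ (φ i) h / ‖h‖ ^ 2) • ContinuousLinearMap.proj ⟨h, by simp⟩, fun ω => ?_⟩
      simp [mul_comm]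
  have hm : ∀ i, Measurable fun ω => W (φ i) ω - W h ω * (inner ℝ (φ i) h / ‖h‖ ^ 2) :=
    fun i => (hW.measurable _).sub ((hW.measurable _).mul_const _)
  have := hp.indepFun_of_covariance_eq_zero (fun _ => (hW.measurable h).aemeasurable)
    (fun i => (hm i).aemeasurable) (fun _ i => ?_)
  · exact this.comp (measurable_pi_apply ()) measurable_id
  · rw [covariance_fun_sub_right (hW.memLp h (by simp)) (hW.memLp _ (by simp))
      ((hW.memLp h (by simp)).mul_const _), covariance_mul_const_right, hW.covariance_eq,
      hW.covariance_eq, real_inner_self_eq_norm_sq, real_inner_comm]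
    have : ‖h‖ ≠ 0 := norm_ne_zero_iff.2 hh
    field_simp
    simp

lemma measurable_vec (hW : IsIsonormal P W) {n : ℕ} (φ : Fin n → H) :
    Measurable fun ω i => W (φ i) ω :=
  measurable_pi_lambda _ fun i => hW.measurable (φ i)

lemma memLp_vec (hW : IsIsonormal P W) {n : ℕ} (φ : Fin n → H) {p : ℝ≥0∞} (hp : p ≠ ⊤) :
    MemLp (fun ω i => W (φ i) ω) p P :=
  MemLp.of_eval fun i => hW.memLp (φ i) hp

lemma memLp_of_linear_growth (hW : IsIsonormal P W) {n : ℕ} (φ : Fin n → H) {F : Type*}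
    [NormedAddCommGroup F] {g : (Fin n → ℝ) → F} (hg : Continuous g) {K : ℝ}
    (hK : ∀ x, ‖g x‖ ≤ K * (1 + ‖x‖)) {p : ℝ≥0∞} (hp : p ≠ ⊤) :
    MemLp (fun ω => g (fun i => W (φ i) ω)) p P := by
  have := hW.isProbabilityMeasure
  have h1 : MemLp (fun ω => K * (1 + ‖fun i => W (φ i) ω‖)) p P :=
    ((memLp_const (1 : ℝ)).add (hW.memLp_vec φ hp).norm).const_mul K
  refine h1.mono (hg.comp_aestronglyMeasurable (hW.measurable_vec φ).aestronglyMeasurable)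
    (Eventually.of_forall fun ω => ?_)
  exact (hK _).trans (Real.le_norm_self _)

/-- Gaussian integration by parts for an isonormal process. -/
theorem integral_mul_cylindrical (hW : IsIsonormal P W) {n : ℕ} (φ : Fin n → H) (h : H)
    {g : (Fin n → ℝ) → ℝ} (hg : ContDiff ℝ 1 g) {K : ℝ} (hK : ∀ x, ‖g x‖ ≤ K * (1 + ‖x‖))
    (hK' : ∀ x, ‖fderiv ℝ g x‖ ≤ K * (1 + ‖x‖)) :
    ∫ ω, W h ω * g (fun i => W (φ i) ω) ∂P =
      ∫ ω, fderiv ℝ g (fun i => W (φ i) ω) (fun i => inner ℝ (φ i) h) ∂P := by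
  have := hW.isProbabilityMeasure
  by_cases hh : h = 0
  · subst hh
    have h0 : W 0 =ᵐ[P] 0 := by
      have h1 := hW.covariance 0 0
      rw [inner_zero_left, integral_eq_zero_iff_of_nonneg (fun ω => mul_self_nonneg _)
        ((hW.memLp 0 (p := 2) (by simp)).integrable_mul (hW.memLp 0 (p := 2) (by simp)))] at h1
      filter_upwards [h1] with ω hω
      simpa using hω
    have h2 : (fun i => inner ℝ (φ i) (0 : H)) = (0 : Fin n → ℝ) := by ext; simp
    rw [h2]
    simp only [map_zero, integral_zero]
    refine integral_eq_zero_of_ae ?_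
    filter_upwards [h0] with ω hω
    simp [hω]
  set c : Fin n → ℝ := fun i => inner ℝ (φ i) h / ‖h‖ ^ 2 with hc
  have hn : ‖h‖ ≠ 0 := norm_ne_zero_iff.2 hh
  have hcc : (fun i => inner ℝ (φ i) h) = ‖h‖ ^ 2 • c := by
    ext i; simp [hc]; field_simp
  set v : ℝ≥0 := ‖h‖₊ ^ 2 with hv
  have hv0 : v ≠ 0 := by simp [hv, hh]
  set Y : Ω → Fin n → ℝ := fun ω i => W (φ i) ω - W h ω * c i with hY
  have hYm : Measurable Y := measurable_pi_lambda _ fun i =>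
    (hW.measurable _).sub ((hW.measurable _).mul_const _)
  have hX : ∀ ω, (fun i => W (φ i) ω) = Y ω + W h ω • c := fun ω => by ext i; simp [hY]
  have hind := hW.indepFun_residual φ h hh
  rw [indepFun_iff_map_prod_eq_prod_map_map (hW.measurable h).aemeasurable hYm.aemeasurable,
    hW.map_eq] at hind
  have hpm : Measurable fun ω => (W h ω, Y ω) := (hW.measurable h).prodMk hYm
  have : IsProbabilityMeasure (P.map Y) := Measure.isProbabilityMeasure_map hYm.aemeasurable
  have hgc : Continuous g := hg.continuous
  have hgc' : Continuous (fderiv ℝ g) := hg.continuous_fderiv (by simp)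
  have c1 : Continuous fun p : ℝ × (Fin n → ℝ) => p.1 * g (p.2 + p.1 • c) := by fun_prop
  have c2 : Continuous fun p : ℝ × (Fin n → ℝ) => fderiv ℝ g (p.2 + p.1 • c) (‖h‖ ^ 2 • c) := by
    fun_prop
  have c3 : Continuous fun p : ℝ × (Fin n → ℝ) => g (p.2 + p.1 • c) := by fun_prop
  have hgL := hW.memLp_of_linear_growth φ hgc hK (p := 2) (by simp)
  have hgL' := hW.memLp_of_linear_growth φ hgc' hK' (p := 2) (by simp)
  have i1 : Integrable (fun p : ℝ × (Fin n → ℝ) => p.1 * g (p.2 + p.1 • c))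
      ((gaussianReal 0 v).prod (P.map Y)) := by
    rw [← hind, integrable_map_measure c1.aestronglyMeasurable hpm.aemeasurable]
    simp only [Function.comp_def, ← hX]
    exact (hW.memLp h (p := 2) (by simp)).integrable_mul hgL
  have i3 : Integrable (fun p : ℝ × (Fin n → ℝ) => g (p.2 + p.1 • c))
      ((gaussianReal 0 v).prod (P.map Y)) := by
    rw [← hind, integrable_map_measure c3.aestronglyMeasurable hpm.aemeasurable]
    simp only [Function.comp_def, ← hX]
    exact hgL.integrable (by simp)
  have i2 : Integrable (fun p : ℝ × (Fin n → ℝ) => fderiv ℝ g (p.2 + p.1 • c) (‖h‖ ^ 2 • c))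
      ((gaussianReal 0 v).prod (P.map Y)) := by
    rw [← hind, integrable_map_measure c2.aestronglyMeasurable hpm.aemeasurable]
    simp only [Function.comp_def, ← hX]
    exact (hgL'.integrable (by simp)).apply_continuousLinearMap _
  have e1 : ∫ ω, W h ω * g (fun i => W (φ i) ω) ∂P =
      ∫ p, p.1 * g (p.2 + p.1 • c) ∂((gaussianReal 0 v).prod (P.map Y)) := by
    rw [← hind, integral_map hpm.aemeasurable c1.aestronglyMeasurable]
    simp only [← hX]
  have e2 : ∫ ω, fderiv ℝ g (fun i => W (φ i) ω) (‖h‖ ^ 2 • c) ∂P =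
      ∫ p, fderiv ℝ g (p.2 + p.1 • c) (‖h‖ ^ 2 • c) ∂((gaussianReal 0 v).prod (P.map Y)) := by
    rw [← hind, integral_map hpm.aemeasurable c2.aestronglyMeasurable]
    simp only [← hX]
  rw [hcc, e1, e2, integral_prod_symm _ i1, integral_prod_symm _ i2]
  refine integral_congr_ae ?_
  filter_upwards [i1.prod_left_ae, i2.prod_left_ae, i3.prod_left_ae] with y h1 h2 h3
  have hvr : (v : ℝ) = ‖h‖ ^ 2 := by simp [hv]
  simp only [map_smul, smul_eq_mul] at h2 ⊢
  have h2' : Integrable (fun z : ℝ => fderiv ℝ g (y + z • c) c) (gaussianReal 0 v) := by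
    have := h2.const_mul ((‖h‖ ^ 2)⁻¹)
    refine this.congr (Eventually.of_forall fun z => ?_)
    simp only
    field_simp
  rw [integral_const_mul, ← hvr]
  refine integral_id_mul_gaussianReal hv0 (fun z => ?_) h3 h2' h1
  have hl : HasDerivAt (fun z : ℝ => y + z • c) c z := by
    simpa using ((hasDerivAt_id z).smul_const c).const_add y
  exact ((hg.differentiable (by simp)) _).hasFDerivAt.comp_hasDerivAt z hl

end IsIsonormal

lemma MeasureTheory.MemLp.integrable_inner_of_two {Ω E : Type*} [NormedAddCommGroup E] [InnerProductSpace ℝ E]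
    [MeasurableSpace Ω] {P : Measure Ω} {f g : Ω → E} (hf : MemLp f 2 P) (hg : MemLp g 2 P) :
    Integrable (fun ω => inner ℝ (f ω) (g ω)) P :=
  (hf.norm.integrable_mul hg.norm).mono (hf.1.inner hg.1) (Eventually.of_forall fun _ =>
    (norm_inner_le_norm _ _).trans (Real.le_norm_self _))

/-- A continuous function of at most linear growth. -/
def LinearGrowth {E F : Type*} [NormedAddCommGroup E] [NormedAddCommGroup F] (g : E → F) : Prop :=
  Continuous g ∧ ∃ K : ℝ, ∀ x, ‖g x‖ ≤ K * (1 + ‖x‖)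

namespace LinearGrowth

variable {E F : Type*} [NormedAddCommGroup E] [NormedAddCommGroup F]

lemma add {f g : E → F} (hf : LinearGrowth f) (hg : LinearGrowth g) :
    LinearGrowth fun x => f x + g x := by
  obtain ⟨hf, K, hK⟩ := hf
  obtain ⟨hg, L, hL⟩ := hg
  exact ⟨hf.add hg, K + L, fun x => (norm_add_le _ _).trans (by linarith [hK x, hL x])⟩

lemma sub {f g : E → F} (hf : LinearGrowth f) (hg : LinearGrowth g) :
    LinearGrowth fun x => f x - g x := by
  obtain ⟨hf, K, hK⟩ := hf
  obtain ⟨hg, L, hL⟩ := hg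
  exact ⟨hf.sub hg, K + L, fun x => (norm_sub_le _ _).trans (by linarith [hK x, hL x])⟩

lemma sum {ι : Type*} (s : Finset ι) {f : ι → E → F} (hf : ∀ i ∈ s, LinearGrowth (f i)) :
    LinearGrowth fun x => ∑ i ∈ s, f i x := by
  classical
  induction s using Finset.induction_on with
  | empty => exact ⟨by simpa using! continuous_const, 0, fun x => by simp⟩
  | insert a s ha ih =>
    simp only [Finset.sum_insert ha]
    exact (hf a (Finset.mem_insert_self a s)).add
      (ih fun i hi => hf i (Finset.mem_insert_of_mem hi))

lemma mul_bounded [NormedSpace ℝ E] {f g : E → ℝ} (hf : LinearGrowth f) (hg : BoundedSmooth g) :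
    LinearGrowth fun x => f x * g x := by
  obtain ⟨hf, K, hK⟩ := hf
  obtain ⟨C, hC⟩ := hg.exists_bound
  refine ⟨hf.mul hg.continuous, K * C, fun x => ?_⟩
  rw [norm_mul]
  have h1 := mul_le_mul (hK x) (hC x) (norm_nonneg _) ((norm_nonneg _).trans (hK x))
  linarith

end LinearGrowth

lemma BoundedSmooth.linearGrowth {E F : Type*} [NormedAddCommGroup E] [NormedSpace ℝ E]
    [NormedAddCommGroup F] [NormedSpace ℝ F] {f : E → F} (hf : BoundedSmooth f) :
    LinearGrowth f := by
  obtain ⟨C, hC⟩ := hf.exists_bound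
  refine ⟨hf.continuous, C, fun x => (hC x).trans ?_⟩
  nlinarith [norm_nonneg x, (norm_nonneg _).trans (hC x)]

lemma linearGrowth_proj {n : ℕ} (i : Fin n) : LinearGrowth fun x : Fin n → ℝ => x i :=
  ⟨continuous_apply i, 1, fun x => by linarith [norm_le_pi_norm x i]⟩

lemma BoundedSmooth.smul_const {E F : Type*} [NormedAddCommGroup E] [NormedSpace ℝ E]
    [NormedAddCommGroup F] [NormedSpace ℝ F] {f : E → ℝ} (hf : BoundedSmooth f) (c : F) :
    BoundedSmooth fun x => f x • c :=
  hf.clm_comp (ContinuousLinearMap.toSpanSingleton ℝ c)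

section Cylindrical

variable {H : Type*} [NormedAddCommGroup H] [InnerProductSpace ℝ H] {n : ℕ} {φ : Fin n → H}

lemma BoundedSmooth.cylGrad {u : (Fin n → ℝ) → ℝ} (hu : BoundedSmooth u) :
    BoundedSmooth (cylGrad φ u) :=
  BoundedSmooth.sum _ fun i _ => (hu.partialDeriv i).smul_const _

lemma BoundedSmooth.cylHess {u : (Fin n → ℝ) → ℝ} (hu : BoundedSmooth u) :
    BoundedSmooth (cylHess φ u) :=
  BoundedSmooth.sum _ fun i _ => BoundedSmooth.sum _ fun j _ =>
    ((hu.partialDeriv j).partialDeriv i).smul_const _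

lemma linearGrowth_cylNum {u : (Fin n → ℝ) → ℝ} (hu : BoundedSmooth u) :
    LinearGrowth (cylNum φ u) :=
  (LinearGrowth.sum _ fun i _ => (linearGrowth_proj i).mul_bounded (hu.partialDeriv i)).sub
    (BoundedSmooth.sum _ fun i _ => BoundedSmooth.sum _ fun j _ =>
      (BoundedSmooth.const _).mul ((hu.partialDeriv j).partialDeriv i)).linearGrowth

lemma contDiff_cylNum {u : (Fin n → ℝ) → ℝ} (hu : BoundedSmooth u) :
    ContDiff ℝ 1 (cylNum φ u) := by
  have h : ∀ {f : (Fin n → ℝ) → ℝ}, BoundedSmooth f → ContDiff ℝ 1 f := fun hf =>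
    hf.smooth.of_le (by exact_mod_cast le_top)
  exact (ContDiff.sum fun i _ => (contDiff_apply ℝ ℝ i).mul (h (hu.partialDeriv i))).sub
    (ContDiff.sum fun i _ => ContDiff.sum fun j _ => contDiff_const.mul
      (h ((hu.partialDeriv j).partialDeriv i)))

lemma linearGrowth_fderiv {g : (Fin n → ℝ) → ℝ}
    (h : ∀ i, LinearGrowth (partialDeriv i g)) : LinearGrowth (fderiv ℝ g) := by
  have e : fderiv ℝ g = fun x => ∑ i, partialDeriv i g x •
      (ContinuousLinearMap.proj i : (Fin n → ℝ) →L[ℝ] ℝ) := by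
    funext x
    ext1 c
    rw [fderiv_eq_sum_partialDeriv]
    simp
  rw [e]
  refine LinearGrowth.sum _ fun i _ => ?_
  obtain ⟨hc, K, hK⟩ := h i
  refine ⟨hc.smul continuous_const, K * ‖(ContinuousLinearMap.proj i : (Fin n → ℝ) →L[ℝ] ℝ)‖,
    fun x => ?_⟩
  rw [norm_smul]
  have := mul_le_mul_of_nonneg_right (hK x)
    (norm_nonneg (ContinuousLinearMap.proj i : (Fin n → ℝ) →L[ℝ] ℝ))
  linarith

/-- The operator `1 - L`, with `L` the Ornstein–Uhlenbeck generator. -/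
noncomputable def cylOp (φ : Fin n → H) (u : (Fin n → ℝ) → ℝ) (x : Fin n → ℝ) : ℝ :=
  u x + cylNum φ u x

lemma linearGrowth_cylOp {u : (Fin n → ℝ) → ℝ} (hu : BoundedSmooth u) :
    LinearGrowth (cylOp φ u) :=
  hu.linearGrowth.add (linearGrowth_cylNum hu)

lemma cylOp_sub {f g : (Fin n → ℝ) → ℝ} (hf : BoundedSmooth f) (hg : BoundedSmooth g)
    (x : Fin n → ℝ) : cylOp φ (fun x => f x - g x) x = cylOp φ f x - cylOp φ g x := by
  simp only [cylOp, cylNum_sub hf hg]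
  ring

variable {Ω : Type*} [MeasurableSpace Ω] {P : Measure Ω} {W : H → Ω → ℝ}

lemma LinearGrowth.memLp (hW : IsIsonormal P W) (φ : Fin n → H) {F : Type*}
    [NormedAddCommGroup F] {g : (Fin n → ℝ) → F} (hg : LinearGrowth g) {p : ℝ≥0∞} (hp : p ≠ ⊤) :
    MemLp (fun ω => g (fun i => W (φ i) ω)) p P := by
  obtain ⟨hg, K, hK⟩ := hg
  exact hW.memLp_of_linear_growth φ hg hK hp

lemma LinearGrowth.integrable_mul (hW : IsIsonormal P W) (φ : Fin n → H)
    {f g : (Fin n → ℝ) → ℝ} (hf : LinearGrowth f) (hg : LinearGrowth g) :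
    Integrable (fun ω => f (fun i => W (φ i) ω) * g (fun i => W (φ i) ω)) P :=
  (hf.memLp hW φ (p := 2) (by simp)).integrable_mul (hg.memLp hW φ (p := 2) (by simp))

lemma LinearGrowth.integrable_inner (hW : IsIsonormal P W) (φ : Fin n → H)
    {f g : (Fin n → ℝ) → H} (hf : LinearGrowth f) (hg : LinearGrowth g) :
    Integrable (fun ω => inner ℝ (f fun i => W (φ i) ω) (g fun i => W (φ i) ω)) P :=
  MemLp.integrable_inner_of_two (hf.memLp hW φ (p := 2) (by simp)) (hg.memLp hW φ (p := 2) (by simp))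

lemma linearGrowth_cylGrad {g : (Fin n → ℝ) → ℝ} (h : ∀ i, LinearGrowth (partialDeriv i g)) :
    LinearGrowth (cylGrad φ g) := by
  refine LinearGrowth.sum _ fun i _ => ?_
  obtain ⟨hc, K, hK⟩ := h i
  refine ⟨hc.smul continuous_const, K * ‖φ i‖, fun x => ?_⟩
  rw [norm_smul]
  have := mul_le_mul_of_nonneg_right (hK x) (norm_nonneg (φ i))
  linarith

lemma integral_mul_cylNum (hW : IsIsonormal P W) {u g : (Fin n → ℝ) → ℝ} (hu : BoundedSmooth u)
    (hg : ContDiff ℝ 1 g) (hgl : LinearGrowth g) (hgd : ∀ i, LinearGrowth (partialDeriv i g)) :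
    ∫ ω, g (fun i => W (φ i) ω) * cylNum φ u (fun i => W (φ i) ω) ∂P =
      ∫ ω, inner ℝ (cylGrad φ u fun i => W (φ i) ω) (cylGrad φ g fun i => W (φ i) ω) ∂P := by
  have hgD : Differentiable ℝ g := hg.differentiable (by simp)
  have hu1 : ∀ i, ContDiff ℝ 1 (partialDeriv i u) := fun i =>
    (hu.partialDeriv i).smooth.of_le (by exact_mod_cast le_top)
  have hgrow : ∀ i, LinearGrowth fun x => partialDeriv i u x * g x := fun i => by
    simpa [mul_comm] using hgl.mul_bounded (hu.partialDeriv i)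
  have hpd : ∀ i k, LinearGrowth (partialDeriv k fun x => partialDeriv i u x * g x) := fun i k => by
    rw [partialDeriv_mul (hu.partialDeriv i).differentiable hgD]
    simpa [mul_comm] using ((hgd k).mul_bounded (hu.partialDeriv i)).add
      (hgl.mul_bounded ((hu.partialDeriv i).partialDeriv k))
  have key : ∀ i, ∫ ω, W (φ i) ω * (partialDeriv i u (fun i => W (φ i) ω) *
      g (fun i => W (φ i) ω)) ∂P = ∫ ω, (partialDeriv i u (fun i => W (φ i) ω) *
        inner ℝ (cylGrad φ g fun i => W (φ i) ω) (φ i) + g (fun i => W (φ i) ω) *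
        inner ℝ (cylGrad φ (partialDeriv i u) fun i => W (φ i) ω) (φ i)) ∂P := by
    intro i
    obtain ⟨-, K, hK⟩ := hgrow i
    obtain ⟨-, K', hK'⟩ := linearGrowth_fderiv (hpd i)
    have := hW.integral_mul_cylindrical φ (φ i) ((hu1 i).mul hg) (K := max K K')
      (fun x => (hK x).trans (by gcongr; exact le_max_left _ _))
      (fun x => (hK' x).trans (by gcongr; exact le_max_right _ _))
    rw [this]
    refine integral_congr_ae (Eventually.of_forall fun ω => ?_)
    simp only
    rw [fderiv_eq_sum_partialDeriv, ← inner_cylGrad,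
      cylGrad_mul (hu.partialDeriv i).differentiable hgD, inner_add_left, real_inner_smul_left,
      real_inner_smul_left]
  have hin : ∀ {w : (Fin n → ℝ) → ℝ} (i : Fin n), (∀ k, LinearGrowth (partialDeriv k w)) →
      LinearGrowth fun x => inner ℝ (cylGrad φ w x) (φ i) := fun {w} i h => by
    simp only [inner_cylGrad]
    exact LinearGrowth.sum _ fun k _ => (h k).mul_bounded (BoundedSmooth.const _)
  have I1 : ∀ i, Integrable (fun ω => W (φ i) ω * (partialDeriv i u (fun i => W (φ i) ω) *
      g (fun i => W (φ i) ω))) P := fun i =>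
    (linearGrowth_proj i).integrable_mul hW φ (hgrow i)
  have I2 : ∀ i, Integrable (fun ω => g (fun i => W (φ i) ω) *
      inner ℝ (cylGrad φ (partialDeriv i u) fun i => W (φ i) ω) (φ i)) P := fun i =>
    hgl.integrable_mul hW φ (hin i fun k => ((hu.partialDeriv i).partialDeriv k).linearGrowth)
  have I3 : ∀ i, Integrable (fun ω => partialDeriv i u (fun i => W (φ i) ω) *
        inner ℝ (cylGrad φ g fun i => W (φ i) ω) (φ i)) P := fun i =>
    (hu.partialDeriv i).linearGrowth.integrable_mul hW φ (hin i hgd)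
  calc ∫ ω, g (fun i => W (φ i) ω) * cylNum φ u (fun i => W (φ i) ω) ∂P
      = ∫ ω, ∑ i, (W (φ i) ω * (partialDeriv i u (fun i => W (φ i) ω) *
        g (fun i => W (φ i) ω)) - g (fun i => W (φ i) ω) *
          inner ℝ (cylGrad φ (partialDeriv i u) fun i => W (φ i) ω) (φ i)) ∂P := by
        refine integral_congr_ae (Eventually.of_forall fun ω => ?_)
        simp only
        rw [cylNum_eq, Finset.mul_sum]
        exact Finset.sum_congr rfl fun i _ => by ring
    _ = ∑ i, ∫ ω, partialDeriv i u (fun i => W (φ i) ω) *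
        inner ℝ (cylGrad φ g fun i => W (φ i) ω) (φ i) ∂P := by
        rw [integral_finsetSum _ fun i _ => Integrable.sub' (I1 i) (I2 i)]
        refine Finset.sum_congr rfl fun i _ => ?_
        rw [integral_sub (I1 i) (I2 i), key i, integral_add (I3 i) (I2 i)]
        ring
    _ = _ := by
        rw [← integral_finsetSum _ fun i _ => I3 i]
        refine integral_congr_ae (Eventually.of_forall fun ω => ?_)
        simp only
        rw [inner_cylGrad]
        exact Finset.sum_congr rfl fun i _ => by rw [real_inner_comm]

lemma linearGrowth_partialDeriv_cylNum {u : (Fin n → ℝ) → ℝ} (hu : BoundedSmooth u) (k : Fin n) :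
    LinearGrowth (partialDeriv k (cylNum φ u)) := by
  rw [show partialDeriv k (cylNum φ u) = _ from funext (partialDeriv_cylNum hu k)]
  exact (hu.partialDeriv k).linearGrowth.add (linearGrowth_cylNum (hu.partialDeriv k))

lemma integral_cylNum_sq (hW : IsIsonormal P W) {u : (Fin n → ℝ) → ℝ} (hu : BoundedSmooth u) :
    ∫ ω, cylNum φ u (fun i => W (φ i) ω) ^ 2 ∂P =
      ∫ ω, ‖cylGrad φ u fun i => W (φ i) ω‖ ^ 2 ∂P +
        ∫ ω, ‖cylHess φ u fun i => W (φ i) ω‖ ^ 2 ∂P := by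
  have h1 := integral_mul_cylNum (φ := φ) hW hu (contDiff_cylNum (φ := φ) hu)
    (linearGrowth_cylNum hu) (linearGrowth_partialDeriv_cylNum hu)
  simp only [sq (cylNum φ u _)]
  rw [h1]
  have e : ∀ x, inner ℝ (cylGrad φ u x) (cylGrad φ (cylNum φ u) x) = ‖cylGrad φ u x‖ ^ 2 +
      ∑ k, ∑ l, inner ℝ (φ k) (φ l) * (partialDeriv l u x * cylNum φ (partialDeriv k u) x) := by
    intro x
    have : cylGrad φ (cylNum φ u) x =
        cylGrad φ u x + ∑ k, cylNum φ (partialDeriv k u) x • φ k := by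
      simp [cylGrad, partialDeriv_cylNum hu, add_smul, Finset.sum_add_distrib]
    rw [this, inner_add_right, real_inner_self_eq_norm_sq]
    congr 1
    rw [inner_sum]
    refine Finset.sum_congr rfl fun k _ => ?_
    rw [real_inner_smul_right, inner_cylGrad, Finset.mul_sum]
    exact Finset.sum_congr rfl fun l _ => by rw [real_inner_comm]; ring
  have I1 : Integrable (fun ω => ‖cylGrad φ u fun i => W (φ i) ω‖ ^ 2) P :=
    (hu.cylGrad.linearGrowth.memLp hW φ (p := 2) (by simp)).integrable_norm_pow (by simp)
  have I2 : ∀ k l, Integrable (fun ω => inner ℝ (φ k) (φ l) *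
      (partialDeriv l u (fun i => W (φ i) ω) *
        cylNum φ (partialDeriv k u) (fun i => W (φ i) ω))) P := fun k l =>
    ((hu.partialDeriv l).linearGrowth.integrable_mul hW φ
      (linearGrowth_cylNum (hu.partialDeriv k))).const_mul _
  have I3 : ∀ k l, Integrable (fun ω => inner ℝ (φ k) (φ l) *
      inner ℝ (cylGrad φ (partialDeriv l u) fun i => W (φ i) ω)
        (cylGrad φ (partialDeriv k u) fun i => W (φ i) ω)) P := fun k l =>
    ((hu.partialDeriv l).cylGrad.linearGrowth.integrable_inner hW φ
      (hu.partialDeriv k).cylGrad.linearGrowth).const_mul _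
  simp only [e, norm_cylHess_sq]
  rw [integral_add I1 (integrable_finsetSum _ fun k _ => integrable_finsetSum _ fun l _ => I2 k l)]
  congr 1
  rw [integral_finsetSum _ fun k _ => integrable_finsetSum _ fun l _ => I2 k l,
    integral_finsetSum _ fun k _ => integrable_finsetSum _ fun l _ => I3 k l]
  refine Finset.sum_congr rfl fun k _ => ?_
  rw [integral_finsetSum _ fun l _ => I2 k l, integral_finsetSum _ fun l _ => I3 k l]
  refine Finset.sum_congr rfl fun l _ => ?_
  rw [integral_const_mul, integral_const_mul]
  congr 1
  rw [integral_mul_cylNum hW (hu.partialDeriv k)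
    ((hu.partialDeriv l).smooth.of_le (by exact_mod_cast le_top)) (hu.partialDeriv l).linearGrowth
    fun i => ((hu.partialDeriv l).partialDeriv i).linearGrowth]
  exact integral_congr_ae (Eventually.of_forall fun ω => by
    simp only [real_inner_comm])

/-- The graph norm of `1 - L` controls the Sobolev norm. -/
theorem integral_cylOp_sq (hW : IsIsonormal P W) {u : (Fin n → ℝ) → ℝ} (hu : BoundedSmooth u) :
    ∫ ω, cylOp φ u (fun i => W (φ i) ω) ^ 2 ∂P =
      ∫ ω, u (fun i => W (φ i) ω) ^ 2 ∂P + 3 * ∫ ω, ‖cylGrad φ u fun i => W (φ i) ω‖ ^ 2 ∂P +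
        ∫ ω, ‖cylHess φ u fun i => W (φ i) ω‖ ^ 2 ∂P := by
  have h1 := integral_mul_cylNum (φ := φ) hW hu
    (hu.smooth.of_le (by exact_mod_cast le_top)) hu.linearGrowth
    (fun i => (hu.partialDeriv i).linearGrowth)
  simp only [real_inner_self_eq_norm_sq] at h1
  have h2 := integral_cylNum_sq (φ := φ) hW hu
  have I1 := hu.linearGrowth.integrable_mul hW φ hu.linearGrowth
  have I2 := hu.linearGrowth.integrable_mul hW φ (linearGrowth_cylNum (φ := φ) hu)
  have I3 := (linearGrowth_cylNum (φ := φ) hu).integrable_mul hW φ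
    (linearGrowth_cylNum (φ := φ) hu)
  have e : ∀ x, cylOp φ u x ^ 2 = u x * u x + (2 * (u x * cylNum φ u x) +
      cylNum φ u x * cylNum φ u x) := fun x => by rw [cylOp]; ring
  have I4 : Integrable (fun ω => 2 * (u (fun i => W (φ i) ω) * cylNum φ u (fun i => W (φ i) ω)) +
      cylNum φ u (fun i => W (φ i) ω) * cylNum φ u (fun i => W (φ i) ω)) P :=
    (I2.const_mul 2).add I3
  simp only [e]
  rw [integral_add I1 I4, integral_add (I2.const_mul 2) I3,
    integral_const_mul, h1]
  simp only [← sq]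
  rw [h2]
  ring

end Cylindrical

section Energy

variable {H : Type*} [NormedAddCommGroup H] [InnerProductSpace ℝ H] {n : ℕ} {φ : Fin n → H}
variable {Ω : Type*} [MeasurableSpace Ω] {P : Measure Ω} {W : H → Ω → ℝ}

lemma partialDeriv_inv_one_add {u : (Fin n → ℝ) → ℝ} (hu : Differentiable ℝ u)
    (hu0 : ∀ x, 0 ≤ u x) (k : Fin n) :
    partialDeriv k (fun x => (1 + u x)⁻¹) =
      fun x => -(partialDeriv k u x * ((1 + u x)⁻¹ * (1 + u x)⁻¹)) := by
  funext x
  have h0 : 1 + u x ≠ 0 := by linarith [hu0 x]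
  have h1 := (hasDerivAt_inv h0).comp_hasFDerivAt x ((hu x).hasFDerivAt.const_add 1)
  have h2 : HasFDerivAt (fun x => (1 + u x)⁻¹) (-((1 + u x) ^ 2)⁻¹ • fderiv ℝ u x) x := h1
  rw [partialDeriv, h2.fderiv]
  simp only [_root_.smul_apply, smul_eq_mul, partialDeriv]
  field_simp

lemma bounded_inv_one_add {t : ℝ} (ht : 0 ≤ t) : ‖(1 + t)⁻¹‖ ≤ 1 := by
  rw [norm_inv, Real.norm_of_nonneg (by linarith)]
  exact inv_le_one_of_one_le₀ (by linarith)

/-- For a nonnegative functional `u` of the Sobolev space, `‖Du‖² / (1 + u)` is square integrable,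
with an explicit bound. -/
theorem integral_energy_div_sq_le (hW : IsIsonormal P W) {u : (Fin n → ℝ) → ℝ}
    (hu : BoundedSmooth u) (hu0 : ∀ x, 0 ≤ u x) :
    ∫ ω, (‖cylGrad φ u fun i => W (φ i) ω‖ ^ 2 * (1 + u (fun i => W (φ i) ω))⁻¹) ^ 2 ∂P ≤
      10 * ∫ ω, cylOp φ u (fun i => W (φ i) ω) ^ 2 ∂P := by
  have hpos : ∀ x, 0 < 1 + u x := fun x => by linarith [hu0 x]
  have hrD : Differentiable ℝ fun x => (1 + u x)⁻¹ := fun x =>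
    ((hu.differentiable x).const_add 1).fun_inv (hpos x).ne'
  have hrc : Continuous fun x => (1 + u x)⁻¹ := hrD.continuous
  have hE := hu.cylEnergy (φ := φ)
  have hg : ContDiff ℝ 1 fun x => cylEnergy φ u x * (1 + u x)⁻¹ := by
    refine (hE.smooth.of_le (by exact_mod_cast le_top)).mul (ContDiff.inv ?_ fun x => (hpos x).ne')
    exact contDiff_const.add (hu.smooth.of_le (by exact_mod_cast le_top))
  have bdd : ∀ {w : (Fin n → ℝ) → ℝ}, Continuous w → (∃ C, ∀ x, ‖w x‖ ≤ C) → LinearGrowth w := by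
    rintro w hw ⟨C, hC⟩
    exact ⟨hw, C, fun x => (hC x).trans (by nlinarith [norm_nonneg x, (norm_nonneg _).trans (hC x)])⟩
  have hgb : LinearGrowth fun x => cylEnergy φ u x * (1 + u x)⁻¹ := by
    obtain ⟨C, hC⟩ := hE.exists_bound
    refine bdd hg.continuous ⟨C, fun x => ?_⟩
    rw [norm_mul]
    nlinarith [hC x, bounded_inv_one_add (hu0 x), norm_nonneg (1 + u x)⁻¹,
      norm_nonneg (cylEnergy φ u x)]
  have hgd : ∀ k, LinearGrowth (partialDeriv k fun x => cylEnergy φ u x * (1 + u x)⁻¹) := by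
    intro k
    obtain ⟨C, hC⟩ := hE.exists_bound
    obtain ⟨D, hD⟩ := (hu.partialDeriv k).exists_bound
    obtain ⟨K, hK⟩ := (hE.partialDeriv k).exists_bound
    rw [partialDeriv_mul hE.differentiable hrD, partialDeriv_inv_one_add hu.differentiable hu0]
    refine bdd ?_ ⟨C * D + K, fun x => ?_⟩
    · exact (hE.continuous.mul (((hu.partialDeriv k).continuous.mul (hrc.mul hrc)).neg)).add
        (hrc.mul (hE.partialDeriv k).continuous)
    · have h1 := bounded_inv_one_add (hu0 x)
      have h0 := norm_nonneg (1 + u x)⁻¹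
      refine (norm_add_le _ _).trans (add_le_add ?_ ?_)
      · rw [norm_mul, norm_neg, norm_mul, norm_mul]
        refine mul_le_mul (hC x) ?_ (by positivity) ((norm_nonneg _).trans (hC x))
        calc _ ≤ D * (1 * 1) := mul_le_mul (hD x) (mul_le_mul h1 h1 h0 zero_le_one) (by positivity)
              ((norm_nonneg _).trans (hD x))
          _ = D := by ring
      · rw [norm_mul]
        calc _ ≤ 1 * K := mul_le_mul h1 (hK x) (norm_nonneg _) zero_le_one
          _ = K := one_mul K
  have hibp := integral_mul_cylNum (φ := φ) hW hu hg hgb hgd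
  have hgrad : ∀ x, inner ℝ (cylGrad φ u x) (cylGrad φ (fun x => cylEnergy φ u x * (1 + u x)⁻¹) x) =
      -(cylEnergy φ u x * (1 + u x)⁻¹) ^ 2 + (1 + u x)⁻¹ *
        (2 * inner ℝ (cylHess φ u x) (hilbertTmul (cylGrad φ u x) (cylGrad φ u x))) := by
    intro x
    have e1 : cylGrad φ (fun x => (1 + u x)⁻¹) x =
        -((1 + u x)⁻¹ * (1 + u x)⁻¹) • cylGrad φ u x := by
      simp only [cylGrad, partialDeriv_inv_one_add hu.differentiable hu0, Finset.smul_sum, smul_smul]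
      exact Finset.sum_congr rfl fun i _ => by congr 1; ring
    rw [cylGrad_mul hE.differentiable hrD, inner_add_right, real_inner_smul_right,
      real_inner_smul_right, real_inner_comm (cylGrad φ (cylEnergy φ u) x),
      inner_cylGrad_cylEnergy hu, e1, real_inner_smul_right,
      real_inner_self_eq_norm_sq, ← cylEnergy_eq]
    ring
  have hIm := hgb.integrable_mul hW φ hgb
  have hIn := hgb.integrable_mul hW φ (linearGrowth_cylNum (φ := φ) hu)
  have hIg : Integrable (fun ω => inner ℝ (cylGrad φ u fun i => W (φ i) ω)
      (cylGrad φ (fun x => cylEnergy φ u x * (1 + u x)⁻¹) fun i => W (φ i) ω)) P :=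
    hu.cylGrad.linearGrowth.integrable_inner hW φ (linearGrowth_cylGrad hgd)
  have hIh : Integrable (fun ω => ‖cylHess φ u fun i => W (φ i) ω‖ ^ 2) P :=
    (hu.cylHess.linearGrowth.memLp hW φ (p := 2) (by simp)).integrable_norm_pow (by simp)
  have hIN : Integrable (fun ω => cylNum φ u (fun i => W (φ i) ω) ^ 2) P := by
    simpa only [sq] using (linearGrowth_cylNum (φ := φ) hu).integrable_mul hW φ
      (linearGrowth_cylNum (φ := φ) hu)
  have hpt : ∀ x, inner ℝ (cylGrad φ u x) (cylGrad φ (fun x => cylEnergy φ u x * (1 + u x)⁻¹) x) -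
      cylEnergy φ u x * (1 + u x)⁻¹ * cylNum φ u x ≤
      -(1 / 2) * ((cylEnergy φ u x * (1 + u x)⁻¹) * (cylEnergy φ u x * (1 + u x)⁻¹)) +
        (4 * ‖cylHess φ u x‖ ^ 2 + cylNum φ u x ^ 2) := by
    intro x
    rw [hgrad]
    have hr0 : 0 < (1 + u x)⁻¹ := inv_pos.2 (hpos x)
    have h1 : inner ℝ (cylHess φ u x) (hilbertTmul (cylGrad φ u x) (cylGrad φ u x)) ≤
        ‖cylHess φ u x‖ * cylEnergy φ u x := by
      refine (real_inner_le_norm _ _).trans (le_of_eq ?_)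
      rw [norm_hilbertTmul, cylEnergy_eq, sq]
    have h2 : (1 + u x)⁻¹ * (2 * inner ℝ (cylHess φ u x)
        (hilbertTmul (cylGrad φ u x) (cylGrad φ u x))) ≤
        2 * ‖cylHess φ u x‖ * (cylEnergy φ u x * (1 + u x)⁻¹) := by
      have := mul_le_mul_of_nonneg_left h1 hr0.le
      linarith
    nlinarith [sq_nonneg (cylEnergy φ u x * (1 + u x)⁻¹ - (2 * ‖cylHess φ u x‖ - cylNum φ u x)),
      sq_nonneg (2 * ‖cylHess φ u x‖ + cylNum φ u x)]
  have hIs : Integrable (fun ω => 4 * ‖cylHess φ u fun i => W (φ i) ω‖ ^ 2 +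
      cylNum φ u (fun i => W (φ i) ω) ^ 2) P := (hIh.const_mul 4).add hIN
  have hint := integral_mono (hIg.sub hIn) ((hIm.const_mul (-(1 / 2))).add
    hIs) fun ω => hpt (fun i => W (φ i) ω)
  simp only [Pi.add_apply, Pi.sub_apply] at hint
  rw [integral_sub hIg hIn, hibp, sub_self, integral_add (hIm.const_mul (-(1 / 2)))
    hIs, integral_const_mul,
    integral_add (hIh.const_mul 4) hIN, integral_const_mul, integral_cylNum_sq hW hu] at hint
  rw [integral_cylOp_sq hW hu]
  simp only [← sq, cylEnergy_eq] at hint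
  have h1 : 0 ≤ ∫ ω, u (fun i => W (φ i) ω) ^ 2 ∂P := integral_nonneg fun ω => sq_nonneg _
  have h2 : 0 ≤ ∫ ω, ‖cylGrad φ u fun i => W (φ i) ω‖ ^ 2 ∂P := integral_nonneg fun ω => sq_nonneg _
  linarith

end Energy

section Rotation

variable {E : Type*} [NormedAddCommGroup E] [NormedSpace ℝ E] {Ω : Type*} [MeasurableSpace Ω]
  {P : Measure Ω} [IsProbabilityMeasure P] {X : Ω → E} {p : E → ℝ}

lemma norm_le_of_norm_fderiv_le (hp : ContDiff ℝ 1 p) {C : ℝ} (hC : ∀ x, ‖fderiv ℝ p x‖ ≤ C)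
    (y : E) : ‖p y‖ ≤ ‖p 0‖ + C * ‖y‖ := by
  have := (convex_univ (E := E)).norm_image_sub_le_of_norm_fderiv_le (𝕜 := ℝ) (f := p) (C := C)
    (fun x _ => (hp.differentiable (by simp)) x) (fun x _ => hC x) (Set.mem_univ 0)
    (Set.mem_univ y)
  rw [sub_zero] at this
  have h2 := norm_le_norm_add_norm_sub' (p y) (p 0)
  linarith

lemma stronglyMeasurable_rotation (hX : StronglyMeasurable X) (x : E) (θ : ℝ) :
    StronglyMeasurable fun ω => Real.sin θ • x + Real.cos θ • X ω :=
  (hX.const_smul _).const_add _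

lemma norm_rotation_le (x y : E) (θ : ℝ) :
    ‖Real.sin θ • x + Real.cos θ • y‖ ≤ ‖x‖ + ‖y‖ := by
  refine (norm_add_le _ _).trans (add_le_add ?_ ?_) <;> rw [norm_smul]
  · nlinarith [Real.abs_sin_le_one θ, norm_nonneg x, Real.norm_eq_abs (Real.sin θ)]
  · nlinarith [Real.abs_cos_le_one θ, norm_nonneg y, Real.norm_eq_abs (Real.cos θ)]

lemma norm_fderiv_rotation_le {C : ℝ} (hC : ∀ x, ‖fderiv ℝ p x‖ ≤ C) (x y : E) (θ : ℝ) :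
    ‖fderiv ℝ p (Real.sin θ • x + Real.cos θ • y) (Real.cos θ • x - Real.sin θ • y)‖ ≤
      C * (‖x‖ + ‖y‖) := by
  refine (ContinuousLinearMap.le_opNorm _ _).trans
    (mul_le_mul (hC _) ?_ (norm_nonneg _) ((norm_nonneg _).trans (hC 0)))
  refine (norm_sub_le _ _).trans (add_le_add ?_ ?_) <;> rw [norm_smul]
  · nlinarith [Real.abs_cos_le_one θ, norm_nonneg x, Real.norm_eq_abs (Real.cos θ)]
  · nlinarith [Real.abs_sin_le_one θ, norm_nonneg y, Real.norm_eq_abs (Real.sin θ)]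

lemma integrable_rotation (hXm : StronglyMeasurable X) (hX : Integrable X P)
    (hp : ContDiff ℝ 1 p) {C : ℝ} (hC : ∀ x, ‖fderiv ℝ p x‖ ≤ C) (x : E) (θ : ℝ) :
    Integrable (fun ω => p (Real.sin θ • x + Real.cos θ • X ω)) P := by
  have hC0 : 0 ≤ C := (norm_nonneg _).trans (hC 0)
  refine Integrable.mono' (g := fun ω => ‖p 0‖ + C * (‖x‖ + ‖X ω‖))
    ((integrable_const _).add (((integrable_const _).add hX.norm).const_mul C))
    (hp.continuous.comp_stronglyMeasurable
      (stronglyMeasurable_rotation hXm x θ)).aestronglyMeasurable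
    (Eventually.of_forall fun ω => (norm_le_of_norm_fderiv_le hp hC _).trans ?_)
  gcongr
  exact norm_rotation_le x (X ω) θ

lemma stronglyMeasurable_fderiv_rotation (hXm : StronglyMeasurable X) (hp : ContDiff ℝ 1 p)
    (x : E) (θ : ℝ) : StronglyMeasurable fun ω =>
      fderiv ℝ p (Real.sin θ • x + Real.cos θ • X ω) (Real.cos θ • x - Real.sin θ • X ω) := by
  have hc : Continuous fun y : E =>
      fderiv ℝ p (Real.sin θ • x + Real.cos θ • y) (Real.cos θ • x - Real.sin θ • y) := by
    have := hp.continuous_fderiv (by simp)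
    fun_prop
  exact hc.comp_stronglyMeasurable hXm

lemma hasDerivAt_integral_rotation (hXm : StronglyMeasurable X) (hX : Integrable X P)
    (hp : ContDiff ℝ 1 p) {C : ℝ} (hC : ∀ x, ‖fderiv ℝ p x‖ ≤ C) (x : E) (θ : ℝ) :
    HasDerivAt (fun θ => ∫ ω, p (Real.sin θ • x + Real.cos θ • X ω) ∂P)
      (∫ ω, fderiv ℝ p (Real.sin θ • x + Real.cos θ • X ω)
        (Real.cos θ • x - Real.sin θ • X ω) ∂P) θ := by
  refine (hasDerivAt_integral_of_dominated_loc_of_deriv_le (s := Set.univ)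
    (F := fun θ ω => p (Real.sin θ • x + Real.cos θ • X ω))
    (F' := fun θ ω => fderiv ℝ p (Real.sin θ • x + Real.cos θ • X ω)
        (Real.cos θ • x - Real.sin θ • X ω))
    (bound := fun ω => C * (‖x‖ + ‖X ω‖)) univ_mem
    (Eventually.of_forall fun θ => (integrable_rotation hXm hX hp hC x θ).aestronglyMeasurable)
    (integrable_rotation hXm hX hp hC x θ)
    (stronglyMeasurable_fderiv_rotation hXm hp x θ).aestronglyMeasurable
    (Eventually.of_forall fun ω θ _ => norm_fderiv_rotation_le hC x (X ω) θ)
    (((integrable_const _).add hX.norm).const_mul C)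
    (Eventually.of_forall fun ω θ _ => ?_)).2
  have h1 : HasDerivAt (fun θ => Real.sin θ • x + Real.cos θ • X ω)
      (Real.cos θ • x - Real.sin θ • X ω) θ := by
    have := ((Real.hasDerivAt_sin θ).smul_const x).add ((Real.hasDerivAt_cos θ).smul_const (X ω))
    rw [neg_smul, ← sub_eq_add_neg] at this
    exact this
  exact ((hp.differentiable (by simp)) _).hasFDerivAt.comp_hasDerivAt θ h1

lemma continuous_integral_fderiv_rotation (hXm : StronglyMeasurable X) (hX : Integrable X P)
    (hp : ContDiff ℝ 1 p) {C : ℝ} (hC : ∀ x, ‖fderiv ℝ p x‖ ≤ C) (x : E) :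
    Continuous fun θ => ∫ ω, fderiv ℝ p (Real.sin θ • x + Real.cos θ • X ω)
        (Real.cos θ • x - Real.sin θ • X ω) ∂P := by
  refine continuous_of_dominated (bound := fun ω => C * (‖x‖ + ‖X ω‖))
    (fun θ => (stronglyMeasurable_fderiv_rotation hXm hp x θ).aestronglyMeasurable)
    (fun θ => Eventually.of_forall fun ω => norm_fderiv_rotation_le hC x (X ω) θ)
    (((integrable_const _).add hX.norm).const_mul C)
    (Eventually.of_forall fun ω => ?_)
  have := hp.continuous_fderiv (by simp)
  fun_prop

lemma integral_fderiv_rotation (hXm : StronglyMeasurable X) (hX : Integrable X P)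
    (hp : ContDiff ℝ 1 p) {C : ℝ} (hC : ∀ x, ‖fderiv ℝ p x‖ ≤ C) (x : E) :
    ∫ θ in (0 : ℝ)..(Real.pi / 2), ∫ ω, fderiv ℝ p (Real.sin θ • x + Real.cos θ • X ω)
        (Real.cos θ • x - Real.sin θ • X ω) ∂P = p x - ∫ ω, p (X ω) ∂P := by
  rw [intervalIntegral.integral_eq_sub_of_hasDerivAt
    (fun θ _ => hasDerivAt_integral_rotation hXm hX hp hC x θ)
    ((continuous_integral_fderiv_rotation hXm hX hp hC x).intervalIntegrable _ _)]
  simp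

lemma integral_sin_mul_fderiv_rotation (hXm : StronglyMeasurable X) (hX : Integrable X P)
    (hp : ContDiff ℝ 1 p) {C : ℝ} (hC : ∀ x, ‖fderiv ℝ p x‖ ≤ C) (x : E) :
    ∫ θ in (0 : ℝ)..(Real.pi / 2), (Real.cos θ * ∫ ω, p (Real.sin θ • x + Real.cos θ • X ω) ∂P +
      Real.sin θ * ∫ ω, fderiv ℝ p (Real.sin θ • x + Real.cos θ • X ω)
        (Real.cos θ • x - Real.sin θ • X ω) ∂P) = p x := by
  have hc : Continuous fun θ => ∫ ω, p (Real.sin θ • x + Real.cos θ • X ω) ∂P :=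
    continuous_iff_continuousAt.2 fun θ =>
      (hasDerivAt_integral_rotation hXm hX hp hC x θ).continuousAt
  rw [intervalIntegral.integral_eq_sub_of_hasDerivAt
    (fun θ _ => (Real.hasDerivAt_sin θ).mul (hasDerivAt_integral_rotation hXm hX hp hC x θ))
    (((Real.continuous_cos.mul hc).add (Real.continuous_sin.mul
      (continuous_integral_fderiv_rotation hXm hX hp hC x))).intervalIntegrable _ _)]
  simp

end Rotation

section Mehler

variable {n : ℕ} {Ω : Type*} [MeasurableSpace Ω]

/-- Averages of `p (sin θ • x + cos θ • X)` over `X` and over `θ ∈ [0, π/2]` with weight `c θ`. -/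
noncomputable def mehlerAverage (P : Measure Ω) (X : Ω → Fin n → ℝ) (c : ℝ → ℝ)
    (p : (Fin n → ℝ) → ℝ) (x : Fin n → ℝ) : ℝ :=
  ∫ z : ℝ × Ω, c z.1 • p (Real.sin z.1 • x + Real.cos z.1 • X z.2)
    ∂((volume.restrict (Set.Ioc 0 (Real.pi / 2))).prod P)

variable {P : Measure Ω} [IsProbabilityMeasure P] {X : Ω → Fin n → ℝ} (hX : Measurable X)
  {c : ℝ → ℝ} (hc : Continuous c) (hc1 : ∀ θ, |c θ| ≤ 1)
  {p : (Fin n → ℝ) → ℝ} (hp : BoundedSmooth p)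

lemma stronglyMeasurable_sin_fst : StronglyMeasurable fun z : ℝ × Ω => Real.sin z.1 :=
  (Real.measurable_sin.comp measurable_fst).stronglyMeasurable

include hX in
lemma stronglyMeasurable_cos_smul : StronglyMeasurable fun z : ℝ × Ω => Real.cos z.1 • X z.2 :=
  ((Real.measurable_cos.comp measurable_fst).smul (hX.comp measurable_snd)).stronglyMeasurable

include hX hc hc1 hp in
lemma BoundedSmooth.mehlerAverage : BoundedSmooth (mehlerAverage P X c p) :=
  BoundedSmooth.integral_affine (a := fun z : ℝ × Ω => Real.sin z.1)
    (b := fun z : ℝ × Ω => Real.cos z.1 • X z.2) (c := fun z : ℝ × Ω => c z.1)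
    stronglyMeasurable_sin_fst (stronglyMeasurable_cos_smul hX)
    (hc.measurable.comp measurable_fst).stronglyMeasurable
    (fun _ => Real.abs_sin_le_one _) (fun _ => hc1 _) hp

include hX hc hc1 hp in
lemma partialDeriv_mehlerAverage (i : Fin n) : partialDeriv i (mehlerAverage P X c p) =
    mehlerAverage P X (fun θ => c θ * Real.sin θ) (partialDeriv i p) := by
  funext x
  have hcm : StronglyMeasurable fun z : ℝ × Ω => c z.1 :=
    (hc.measurable.comp measurable_fst).stronglyMeasurable
  have h := BoundedSmooth.hasFDerivAt_integral_affine
    (ν := (volume.restrict (Set.Ioc 0 (Real.pi / 2))).prod P)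
    (a := fun z : ℝ × Ω => Real.sin z.1)
    (b := fun z : ℝ × Ω => Real.cos z.1 • X z.2) (c := fun z : ℝ × Ω => c z.1)
    stronglyMeasurable_sin_fst (stronglyMeasurable_cos_smul hX) hcm
    (fun z => Real.abs_sin_le_one _) (fun z => hc1 _) hp x
  have hi := BoundedSmooth.integrable_affine
    (ν := (volume.restrict (Set.Ioc 0 (Real.pi / 2))).prod P)
    (a := fun z : ℝ × Ω => Real.sin z.1)
    (b := fun z : ℝ × Ω => Real.cos z.1 • X z.2) (c := fun z : ℝ × Ω => c z.1 * Real.sin z.1)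
    stronglyMeasurable_sin_fst (stronglyMeasurable_cos_smul hX)
    (hcm.mul stronglyMeasurable_sin_fst)
    (fun z => by rw [abs_mul]; exact mul_le_one₀ (hc1 _) (abs_nonneg _) (Real.abs_sin_le_one _))
    hp.fderiv x
  rw [partialDeriv, show mehlerAverage P X c p = _ from rfl]
  unfold mehlerAverage
  rw [h.fderiv, ContinuousLinearMap.integral_apply hi]
  rfl

include hX hc hc1 hp in
lemma mehlerAverage_eq (x : Fin n → ℝ) : mehlerAverage P X c p x =
    ∫ θ in (0 : ℝ)..(Real.pi / 2), c θ * ∫ ω, p (Real.sin θ • x + Real.cos θ • X ω) ∂P := by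
  have hi := BoundedSmooth.integrable_affine
    (ν := (volume.restrict (Set.Ioc 0 (Real.pi / 2))).prod P)
    (a := fun z : ℝ × Ω => Real.sin z.1)
    (b := fun z : ℝ × Ω => Real.cos z.1 • X z.2) (c := fun z : ℝ × Ω => c z.1)
    stronglyMeasurable_sin_fst (stronglyMeasurable_cos_smul hX)
    (hc.measurable.comp measurable_fst).stronglyMeasurable
    (fun z => hc1 _) hp x
  rw [mehlerAverage, integral_prod _ hi, intervalIntegral.integral_of_le (by positivity)]
  simp only [smul_eq_mul, integral_const_mul]

include hX hp in
lemma continuous_integral_rotation (x : Fin n → ℝ) :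
    Continuous fun θ => ∫ ω, p (Real.sin θ • x + Real.cos θ • X ω) ∂P := by
  obtain ⟨C, hC⟩ := hp.exists_bound
  have := hp.continuous
  refine continuous_of_dominated (bound := fun ω => C)
    (fun θ => (hp.continuous.comp_stronglyMeasurable
      (stronglyMeasurable_rotation hX.stronglyMeasurable x θ)).aestronglyMeasurable)
    (fun θ => Eventually.of_forall fun ω => hC _) (integrable_const _)
    (Eventually.of_forall fun ω => by fun_prop)

end Mehler

section Resolvent

variable {H : Type*} [NormedAddCommGroup H] [InnerProductSpace ℝ H] {n : ℕ} (φ : Fin n → H)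
variable {Ω : Type*} [MeasurableSpace Ω] (P : Measure Ω) (W : H → Ω → ℝ)

/-- The resolvent `(1 - L)⁻¹` of the Ornstein–Uhlenbeck operator, given by Mehler's formula. -/
noncomputable def cylResolvent (p : (Fin n → ℝ) → ℝ) : (Fin n → ℝ) → ℝ :=
  mehlerAverage P (fun ω i => W (φ i) ω) Real.cos p

variable {φ P W}

lemma BoundedSmooth.cylResolvent (hW : IsIsonormal P W) {p : (Fin n → ℝ) → ℝ}
    (hp : BoundedSmooth p) : BoundedSmooth (cylResolvent φ P W p) := by
  have := hW.isProbabilityMeasure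
  exact BoundedSmooth.mehlerAverage (hW.measurable_vec φ) Real.continuous_cos Real.abs_cos_le_one hp

lemma cylResolvent_nonneg (hW : IsIsonormal P W) {p : (Fin n → ℝ) → ℝ} (hp : ∀ x, 0 ≤ p x)
    (x : Fin n → ℝ) : 0 ≤ cylResolvent φ P W p x := by
  have := hW.isProbabilityMeasure
  refine integral_nonneg_of_ae ?_
  have : ∀ᵐ z ∂((volume.restrict (Set.Ioc 0 (Real.pi / 2))).prod P),
      z.1 ∈ Set.Ioc 0 (Real.pi / 2) :=
    Measure.quasiMeasurePreserving_fst.ae (ae_restrict_mem measurableSet_Ioc)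
  filter_upwards [this] with z hz
  exact mul_nonneg (Real.cos_nonneg_of_mem_Icc ⟨by linarith [hz.1, Real.pi_pos], hz.2⟩) (hp _)

theorem cylOp_cylResolvent (hW : IsIsonormal P W) {p : (Fin n → ℝ) → ℝ}
    (hp : BoundedSmooth p) (x : Fin n → ℝ) : cylOp φ (cylResolvent φ P W p) x = p x := by
  have := hW.isProbabilityMeasure
  have hX := hW.measurable_vec φ
  have hcc : Continuous fun θ => Real.cos θ * Real.sin θ := by fun_prop
  have hcs1 : ∀ θ, |Real.cos θ * Real.sin θ| ≤ 1 := fun θ => by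
    rw [abs_mul]; exact mul_le_one₀ (Real.abs_cos_le_one _) (abs_nonneg _) (Real.abs_sin_le_one _)
  have hccs : Continuous fun θ => Real.cos θ * Real.sin θ * Real.sin θ := by fun_prop
  have hcss1 : ∀ θ, |Real.cos θ * Real.sin θ * Real.sin θ| ≤ 1 := fun θ => by
    rw [abs_mul]; exact mul_le_one₀ (hcs1 θ) (abs_nonneg _) (Real.abs_sin_le_one _)
  have hd1 : ∀ i, partialDeriv i (cylResolvent φ P W p) = _ := fun i =>
    partialDeriv_mehlerAverage hX Real.continuous_cos Real.abs_cos_le_one hp i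
  have hd2 := fun i j => partialDeriv_mehlerAverage (P := P) hX hcc hcs1 (hp.partialDeriv j) i
  obtain ⟨C, hC⟩ := hp.fderiv.exists_bound
  have hp1 : ContDiff ℝ 1 p := hp.smooth.of_le (by exact_mod_cast le_top)
  have hXi : Integrable (fun ω i => W (φ i) ω) P :=
    memLp_one_iff_integrable.1 (hW.memLp_vec φ (by simp))
  have hk : ∀ {q : (Fin n → ℝ) → ℝ} (_ : BoundedSmooth q),
      Continuous fun θ => ∫ ω, q (Real.sin θ • x + Real.cos θ • fun i => W (φ i) ω) ∂P :=
    fun hq => continuous_integral_rotation hX hq x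
  have hint : ∀ {q : (Fin n → ℝ) → ℝ} (_ : BoundedSmooth q) (θ : ℝ),
      Integrable (fun ω => q (Real.sin θ • x + Real.cos θ • fun i => W (φ i) ω)) P := by
    intro q hq θ
    obtain ⟨D, hD⟩ := hq.fderiv.exists_bound
    exact integrable_rotation hX.stronglyMeasurable hXi
      (hq.smooth.of_le (by exact_mod_cast le_top)) hD x θ
  have hIBP : ∀ i θ, ∫ ω, W (φ i) ω *
      partialDeriv i p (Real.sin θ • x + Real.cos θ • fun i => W (φ i) ω) ∂P =
      Real.cos θ * ∑ j, inner ℝ (φ i) (φ j) * ∫ ω, partialDeriv i (partialDeriv j p)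
        (Real.sin θ • x + Real.cos θ • fun i => W (φ i) ω) ∂P := by
    intro i θ
    have hq := hp.partialDeriv i
    obtain ⟨A, hA⟩ := hq.exists_bound
    obtain ⟨B, hB⟩ := hq.fderiv.exists_bound
    have haff : ∀ y, HasFDerivAt (fun y : Fin n → ℝ => Real.sin θ • x + Real.cos θ • y)
        (Real.cos θ • ContinuousLinearMap.id ℝ (Fin n → ℝ)) y := fun y =>
      ((hasFDerivAt_id y).const_smul (Real.cos θ)).const_add _
    have hfd : ∀ y, HasFDerivAt (fun y => partialDeriv i p (Real.sin θ • x + Real.cos θ • y))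
        (Real.cos θ • fderiv ℝ (partialDeriv i p) (Real.sin θ • x + Real.cos θ • y)) y := by
      intro y
      refine ((hq.differentiable _).hasFDerivAt.comp y (haff y)).congr_fderiv ?_
      ext v
      simp
    have hB0 : 0 ≤ B := (norm_nonneg _).trans (hB 0)
    have hA0 : 0 ≤ A := (norm_nonneg _).trans (hA 0)
    have := hW.integral_mul_cylindrical φ (φ i)
      (g := fun y => partialDeriv i p (Real.sin θ • x + Real.cos θ • y))
      ((hq.smooth.of_le (by exact_mod_cast le_top)).comp (by fun_prop)) (K := A + B)
      (fun y => (hA _).trans (by nlinarith [norm_nonneg y]))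
      (fun y => by
        rw [(hfd y).fderiv, norm_smul]
        have h1 := hB (Real.sin θ • x + Real.cos θ • y)
        have h2 := Real.abs_cos_le_one θ
        rw [← Real.norm_eq_abs] at h2
        have h3 := mul_le_mul h2 h1 (norm_nonneg _) zero_le_one
        nlinarith [norm_nonneg y])
    rw [this]
    simp only [(hfd _).fderiv, _root_.smul_apply, smul_eq_mul,
      fderiv_eq_sum_partialDeriv (partialDeriv i p)]
    rw [integral_const_mul, integral_finsetSum _ fun j _ => (hint (hq.partialDeriv j) θ).mul_const _]
    congr 1
    refine Finset.sum_congr rfl fun j _ => ?_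
    rw [integral_mul_const, partialDeriv_comm hp i j, mul_comm, real_inner_comm]
  have hfdr : ∀ θ, ∫ ω, fderiv ℝ p (Real.sin θ • x + Real.cos θ • fun i => W (φ i) ω)
      (Real.cos θ • x - Real.sin θ • fun i => W (φ i) ω) ∂P =
      ∑ i, (Real.cos θ * x i * ∫ ω, partialDeriv i p
        (Real.sin θ • x + Real.cos θ • fun i => W (φ i) ω) ∂P - Real.sin θ * (Real.cos θ *
          ∑ j, inner ℝ (φ i) (φ j) * ∫ ω, partialDeriv i (partialDeriv j p)
            (Real.sin θ • x + Real.cos θ • fun i => W (φ i) ω) ∂P)) := by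
    intro θ
    have hmul : ∀ i, Integrable (fun ω => W (φ i) ω * partialDeriv i p
        (Real.sin θ • x + Real.cos θ • fun i => W (φ i) ω)) P := by
      intro i
      obtain ⟨A, hA⟩ := (hp.partialDeriv i).exists_bound
      refine ((hW.memLp (φ i) (p := 1) (by simp)).integrable le_rfl).mul_bdd (c := A)
        (hint (hp.partialDeriv i) θ).aestronglyMeasurable (Eventually.of_forall fun ω => hA _)
    have e : ∀ ω, fderiv ℝ p (Real.sin θ • x + Real.cos θ • fun i => W (φ i) ω)
        (Real.cos θ • x - Real.sin θ • fun i => W (φ i) ω) = ∑ i, (Real.cos θ * x i *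
        partialDeriv i p (Real.sin θ • x + Real.cos θ • fun i => W (φ i) ω) - Real.sin θ *
        (W (φ i) ω * partialDeriv i p (Real.sin θ • x + Real.cos θ • fun i => W (φ i) ω))) := by
      intro ω
      rw [fderiv_eq_sum_partialDeriv]
      refine Finset.sum_congr rfl fun i _ => ?_
      simp only [Pi.sub_apply, Pi.smul_apply, smul_eq_mul]
      ring
    simp only [e]
    rw [integral_finsetSum _ fun i _ => ((hint (hp.partialDeriv i) θ).const_mul _).sub'
      ((hmul i).const_mul _)]
    refine Finset.sum_congr rfl fun i _ => ?_
    rw [integral_sub ((hint (hp.partialDeriv i) θ).const_mul _) ((hmul i).const_mul _),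
      integral_const_mul, integral_const_mul, hIBP]
  have hmain := integral_sin_mul_fderiv_rotation hX.stronglyMeasurable hXi hp1 hC x
  rw [← hmain, cylOp, cylNum]
  simp only [hd1, hd2]
  rw [cylResolvent, mehlerAverage_eq hX Real.continuous_cos Real.abs_cos_le_one hp]
  simp only [mehlerAverage_eq hX hcc hcs1 (hp.partialDeriv _),
    mehlerAverage_eq hX hccs hcss1 ((hp.partialDeriv _).partialDeriv _),
    ← intervalIntegral.integral_const_mul]
  have ii : ∀ {f : ℝ → ℝ}, Continuous f → IntervalIntegrable f volume 0 (Real.pi / 2) :=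
    fun hf => hf.intervalIntegrable _ _
  have k1 : ∀ i, Continuous fun θ => x i * (Real.cos θ * Real.sin θ * ∫ ω, partialDeriv i p
      (Real.sin θ • x + Real.cos θ • fun i => W (φ i) ω) ∂P) := fun i =>
    continuous_const.mul (hcc.mul (hk (hp.partialDeriv i)))
  have k2 : ∀ i j, Continuous fun θ => inner ℝ (φ i) (φ j) * (Real.cos θ * Real.sin θ *
      Real.sin θ * ∫ ω, partialDeriv i (partialDeriv j p)
      (Real.sin θ • x + Real.cos θ • fun i => W (φ i) ω) ∂P) := fun i j =>
    continuous_const.mul (hccs.mul (hk ((hp.partialDeriv j).partialDeriv i)))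
  have k3 : Continuous fun θ => Real.cos θ *
      ∫ ω, p (Real.sin θ • x + Real.cos θ • fun i => W (φ i) ω) ∂P :=
    Real.continuous_cos.mul (hk hp)
  have k4 : Continuous fun θ => ∑ i, x i * (Real.cos θ * Real.sin θ * ∫ ω, partialDeriv i p
      (Real.sin θ • x + Real.cos θ • fun i => W (φ i) ω) ∂P) - ∑ i, ∑ j, inner ℝ (φ i) (φ j) *
      (Real.cos θ * Real.sin θ * Real.sin θ * ∫ ω, partialDeriv i (partialDeriv j p)
      (Real.sin θ • x + Real.cos θ • fun i => W (φ i) ω) ∂P) :=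
    (continuous_finsetSum _ fun i _ => k1 i).sub
      (continuous_finsetSum _ fun i _ => continuous_finsetSum _ fun j _ => k2 i j)
  rw [← intervalIntegral.integral_finsetSum fun i _ => ii (k1 i)]
  simp only [← intervalIntegral.integral_finsetSum fun j _ => ii (k2 _ j)]
  rw [← intervalIntegral.integral_finsetSum fun i _ => ii (continuous_finsetSum _ fun j _ => k2 i j),
    ← intervalIntegral.integral_sub (ii (continuous_finsetSum _ fun i _ => k1 i))
      (ii (continuous_finsetSum _ fun i _ => continuous_finsetSum _ fun j _ => k2 i j)),
    ← intervalIntegral.integral_add (ii k3) (ii k4)]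
  refine intervalIntegral.integral_congr fun θ _ => ?_
  simp only [hfdr, Finset.sum_sub_distrib, mul_sub, Finset.mul_sum]
  congr 2
  · exact Finset.sum_congr rfl fun i _ => by ring
  · exact Finset.sum_congr rfl fun i _ => Finset.sum_congr rfl fun j _ => by ring

end Resolvent

section SquareIntegrable

variable {Ω E F : Type*} [MeasurableSpace Ω] {P : Measure Ω} [NormedAddCommGroup E]
  [NormedAddCommGroup F]

lemma MeasureTheory.MemLp.integral_norm_sq {f : Ω → E} (hf : MemLp f 2 P) :
    ∫ ω, ‖f ω‖ ^ 2 ∂P = (eLpNorm f 2 P).toReal ^ 2 := by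
  have h0 : 0 ≤ ∫ ω, ‖f ω‖ ^ 2 ∂P := integral_nonneg fun ω => sq_nonneg _
  rw [hf.eLpNorm_eq_integral_rpow_norm (by simp) (by simp)]
  simp only [ENNReal.toReal_ofNat, Real.rpow_ofNat]
  rw [ENNReal.toReal_ofReal (by positivity), ← one_div, ← Real.sqrt_eq_rpow, Real.sq_sqrt h0]

lemma MeasureTheory.MemLp.integrable_norm_sq {f : Ω → E} (hf : MemLp f 2 P) :
    Integrable (fun ω => ‖f ω‖ ^ 2) P :=
  hf.integrable_norm_pow (by simp)

lemma MeasureTheory.MemLp.integrable_norm_mul_norm {f : Ω → E} {g : Ω → F} (hf : MemLp f 2 P)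
    (hg : MemLp g 2 P) : Integrable (fun ω => ‖f ω‖ * ‖g ω‖) P :=
  hf.norm.integrable_mul hg.norm

lemma MeasureTheory.MemLp.integral_norm_mul_norm_le {f : Ω → E} {g : Ω → F} (hf : MemLp f 2 P)
    (hg : MemLp g 2 P) : ∫ ω, ‖f ω‖ * ‖g ω‖ ∂P ≤
      Real.sqrt (∫ ω, ‖f ω‖ ^ 2 ∂P) * Real.sqrt (∫ ω, ‖g ω‖ ^ 2 ∂P) := by
  have := integral_mul_le_Lp_mul_Lq_of_nonneg (μ := P) (p := 2) (q := 2)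
    (Real.HolderConjugate.two_two) (f := fun ω => ‖f ω‖) (g := fun ω => ‖g ω‖)
    (Eventually.of_forall fun _ => norm_nonneg _) (Eventually.of_forall fun _ => norm_nonneg _)
    (by simpa using hf.norm) (by simpa using hg.norm)
  simpa [Real.sqrt_eq_rpow] using this

lemma integral_norm_sq_le_of_sub {f g : Ω → E} (hf : MemLp f 2 P) (hg : MemLp g 2 P) :
    ∫ ω, ‖f ω‖ ^ 2 ∂P ≤ 2 * ∫ ω, ‖f ω - g ω‖ ^ 2 ∂P + 2 * ∫ ω, ‖g ω‖ ^ 2 ∂P := by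
  have h1 : Integrable (fun ω => ‖f ω - g ω‖ ^ 2) P := (hf.sub hg).integrable_norm_sq
  rw [← integral_const_mul, ← integral_const_mul, ← integral_add (h1.const_mul 2)
    (hg.integrable_norm_sq.const_mul 2)]
  refine integral_mono hf.integrable_norm_sq
    ((h1.const_mul 2).add (hg.integrable_norm_sq.const_mul 2)) fun ω => ?_
  have h2 := norm_add_le (f ω - g ω) (g ω)
  rw [sub_add_cancel] at h2
  beta_reduce
  nlinarith [sq_nonneg (‖f ω - g ω‖ - ‖g ω‖), norm_nonneg (f ω), norm_nonneg (f ω - g ω)]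

lemma integral_norm_sub_sq_le {f g h : Ω → E} (hf : MemLp f 2 P) (hg : MemLp g 2 P)
    (hh : MemLp h 2 P) : ∫ ω, ‖f ω - h ω‖ ^ 2 ∂P ≤
      2 * ∫ ω, ‖g ω - f ω‖ ^ 2 ∂P + 2 * ∫ ω, ‖g ω - h ω‖ ^ 2 ∂P := by
  have := integral_norm_sq_le_of_sub (hh.sub hf) (hh.sub hg)
  simp only [Pi.sub_apply, sub_sub_sub_cancel_left] at this
  simpa only [norm_sub_rev (h _)] using this

lemma tendsto_integral_norm_sub_sq {f : ℕ → Ω → E} {g : Ω → E} (hf : ∀ m, MemLp (f m) 2 P)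
    (hg : MemLp g 2 P)
    (h : Tendsto (fun m => eLpNorm (fun ω => f m ω - g ω) 2 P) atTop (𝓝 0)) :
    Tendsto (fun m => ∫ ω, ‖f m ω - g ω‖ ^ 2 ∂P) atTop (𝓝 0) := by
  have h1 : ∀ m, ∫ ω, ‖f m ω - g ω‖ ^ 2 ∂P =
      (eLpNorm (fun ω => f m ω - g ω) 2 P).toReal ^ 2 := fun m =>
    MemLp.integral_norm_sq ((hf m).sub hg)
  simp only [h1]
  have h2 := (ENNReal.tendsto_toReal (by simp : (0 : ℝ≥0∞) ≠ ⊤)).comp h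
  simpa using h2.pow 2

end SquareIntegrable

section Approximation

lemma contDiff_sqrt_sq_add_one {E : Type*} [NormedAddCommGroup E] [NormedSpace ℝ E] {q : E → ℝ}
    (hq : ContDiff ℝ (⊤ : ℕ∞) q) : ContDiff ℝ (⊤ : ℕ∞) fun x => Real.sqrt (q x ^ 2 + 1) :=
  ((hq.pow 2).add contDiff_const).sqrt fun x => by positivity

lemma BoundedSmooth.sqrt_sq_add_one {E : Type*} [NormedAddCommGroup E] [NormedSpace ℝ E]
    {q : E → ℝ} (hq : ContDiff ℝ (⊤ : ℕ∞) q) (hc : HasCompactSupport q) :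
    BoundedSmooth fun x => Real.sqrt (q x ^ 2 + 1) := by
  have h1 : BoundedSmooth fun x => Real.sqrt (q x ^ 2 + 1) - 1 :=
    BoundedSmooth.of_hasCompactSupport ((contDiff_sqrt_sq_add_one hq).sub contDiff_const)
      (hc.comp_left (g := fun t => Real.sqrt (t ^ 2 + 1) - 1) (by simp))
  simpa using h1.add (BoundedSmooth.const (1 : ℝ))

lemma abs_half_add_sqrt_le (t : ℝ) : ((1 / 2) * (Real.sqrt (t ^ 2 + 1) + t)) ^ 2 ≤ t ^ 2 + 1 := by
  have h := Real.sq_sqrt (show (0 : ℝ) ≤ t ^ 2 + 1 by positivity)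
  nlinarith [sq_nonneg (Real.sqrt (t ^ 2 + 1) - t)]

variable {H : Type*} [NormedAddCommGroup H] [InnerProductSpace ℝ H] {n : ℕ} {φ : Fin n → H}
variable {Ω : Type*} [MeasurableSpace Ω] {P : Measure Ω} {W : H → Ω → ℝ}

/-- A cylindrical functional is, up to a small error in the Sobolev norm, a difference of
nonnegative ones whose Sobolev norms are controlled. -/
theorem exists_nonneg_sub_approx (hW : IsIsonormal P W) {f : (Fin n → ℝ) → ℝ}
    (hf : BoundedSmooth f) {ε : ℝ} (hε : 0 < ε) :
    ∃ α β : (Fin n → ℝ) → ℝ, BoundedSmooth α ∧ BoundedSmooth β ∧ (∀ x, 0 ≤ α x) ∧ (∀ x, 0 ≤ β x) ∧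
      ∫ ω, cylOp φ (fun x => f x - (α x - β x)) (fun i => W (φ i) ω) ^ 2 ∂P ≤ ε ^ 2 ∧
      ∫ ω, cylOp φ α (fun i => W (φ i) ω) ^ 2 ∂P ≤
        2 * ∫ ω, cylOp φ f (fun i => W (φ i) ω) ^ 2 ∂P + 2 * ε ^ 2 + 1 ∧
      ∫ ω, cylOp φ β (fun i => W (φ i) ω) ^ 2 ∂P ≤
        2 * ∫ ω, cylOp φ f (fun i => W (φ i) ω) ^ 2 ∂P + 2 * ε ^ 2 + 1 := by
  have := hW.isProbabilityMeasure
  have hX := hW.measurable_vec φ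
  have hpr : IsProbabilityMeasure (P.map fun ω i => W (φ i) ω) :=
    Measure.isProbabilityMeasure_map hX.aemeasurable
  have hgl := linearGrowth_cylOp (φ := φ) hf
  have hgm : MemLp (fun ω => cylOp φ f fun i => W (φ i) ω) 2 P := hgl.memLp hW φ (by simp)
  have hgm' : MemLp (cylOp φ f) 2 (P.map fun ω i => W (φ i) ω) := by
    rw [memLp_map_measure_iff hgl.1.aestronglyMeasurable hX.aemeasurable]
    exact hgm
  obtain ⟨q, hqc, hqs, hq⟩ := hgm'.exist_eLpNorm_sub_le (by simp) (by simp) hε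
  have hqb : BoundedSmooth q := BoundedSmooth.of_hasCompactSupport hqs hqc
  have hqm : MemLp (fun ω => q fun i => W (φ i) ω) 2 P := hqb.linearGrowth.memLp hW φ (by simp)
  rw [eLpNorm_map_measure (hgl.1.sub hqs.continuous).aestronglyMeasurable hX.aemeasurable] at hq
  have hq2 : ∫ ω, ‖cylOp φ f (fun i => W (φ i) ω) - q (fun i => W (φ i) ω)‖ ^ 2 ∂P ≤ ε ^ 2 := by
    have h1 := MemLp.integral_norm_sq (hgm.sub hqm)
    simp only [Pi.sub_apply] at h1
    rw [h1]
    gcongr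
    exact ENNReal.toReal_le_of_le_ofReal hε.le hq
  have hs := BoundedSmooth.sqrt_sq_add_one hqs hqc
  have hp1 : BoundedSmooth fun x => (1 / 2) * (Real.sqrt (q x ^ 2 + 1) + q x) :=
    (BoundedSmooth.const _).mul (hs.add hqb)
  have hp2 : BoundedSmooth fun x => (1 / 2) * (Real.sqrt (q x ^ 2 + 1) - q x) :=
    (BoundedSmooth.const _).mul (hs.sub hqb)
  have habs : ∀ t : ℝ, |t| ≤ Real.sqrt (t ^ 2 + 1) := fun t =>
    Real.abs_le_sqrt (by linarith)
  have hsq : ∫ ω, q (fun i => W (φ i) ω) ^ 2 ∂P ≤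
      2 * ∫ ω, cylOp φ f (fun i => W (φ i) ω) ^ 2 ∂P + 2 * ε ^ 2 := by
    have h1 := integral_norm_sq_le_of_sub hqm hgm
    simp only [norm_sub_rev (q _)] at h1
    simp only [Real.norm_eq_abs, sq_abs] at h1 hq2
    linarith
  have hbd : ∀ {p : (Fin n → ℝ) → ℝ}, BoundedSmooth p → (∀ x, p x ^ 2 ≤ q x ^ 2 + 1) →
      ∫ ω, cylOp φ (cylResolvent φ P W p) (fun i => W (φ i) ω) ^ 2 ∂P ≤
        2 * ∫ ω, cylOp φ f (fun i => W (φ i) ω) ^ 2 ∂P + 2 * ε ^ 2 + 1 := by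
    intro p hp hpq
    simp only [cylOp_cylResolvent hW hp]
    have hI : Integrable (fun ω => q (fun i => W (φ i) ω) ^ 2) P := by
      simpa using hqm.integrable_norm_sq
    have h2 : ∫ ω, p (fun i => W (φ i) ω) ^ 2 ∂P ≤ ∫ ω, (q (fun i => W (φ i) ω) ^ 2 + 1) ∂P :=
      integral_mono (by simpa using (hp.linearGrowth.memLp hW φ (p := 2) (by simp)).integrable_norm_sq)
        (hI.add (integrable_const _)) fun ω => hpq _
    rw [integral_add hI (integrable_const _)] at h2
    simp at h2
    linarith
  refine ⟨cylResolvent φ P W fun x => (1 / 2) * (Real.sqrt (q x ^ 2 + 1) + q x),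
    cylResolvent φ P W fun x => (1 / 2) * (Real.sqrt (q x ^ 2 + 1) - q x),
    hp1.cylResolvent hW, hp2.cylResolvent hW,
    cylResolvent_nonneg hW fun x => by linarith [neg_le_of_abs_le (habs (q x))],
    cylResolvent_nonneg hW fun x => by linarith [le_of_abs_le (habs (q x))], ?_,
    hbd hp1 fun x => abs_half_add_sqrt_le _, hbd hp2 fun x => ?_⟩
  · have e : ∀ x, cylOp φ (fun x => f x -
        (cylResolvent φ P W (fun x => (1 / 2) * (Real.sqrt (q x ^ 2 + 1) + q x)) x -
        cylResolvent φ P W (fun x => (1 / 2) * (Real.sqrt (q x ^ 2 + 1) - q x)) x)) x =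
        cylOp φ f x - q x := by
      intro x
      rw [cylOp_sub hf ((hp1.cylResolvent hW).sub (hp2.cylResolvent hW)),
        cylOp_sub (hp1.cylResolvent hW) (hp2.cylResolvent hW), cylOp_cylResolvent hW hp1,
        cylOp_cylResolvent hW hp2]
      ring
    simp only [e]
    simpa only [Real.norm_eq_abs, sq_abs] using hq2
  · have := abs_half_add_sqrt_le (-q x)
    simpa [sub_eq_add_neg] using this

end Approximation

section Cutoff

/-- `ζ` is a smooth cutoff at scale `R` on the half-line, with derivatives controlled by `K`. -/
structure IsCutoff (K R : ℝ) (ζ : ℝ → ℝ) : Prop where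
  smooth : BoundedSmooth ζ
  nonneg : ∀ t, 0 ≤ ζ t
  le_one : ∀ t, ζ t ≤ 1
  one_sub_le : ∀ t, 0 ≤ t → 1 - ζ t ≤ min 1 ((t / R) ^ 2)
  deriv_le : ∀ t, 0 ≤ t → R * |deriv ζ t| ≤ K * min 1 ((t / R) ^ 2)
  deriv2_le : ∀ t, 0 ≤ t → R ^ 2 * |deriv (deriv ζ) t| ≤ K * min 1 ((t / R) ^ 2)
  eq_zero : ∀ t, 2 * R < t → ζ t = 0 ∧ deriv ζ t = 0 ∧ deriv (deriv ζ) t = 0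

theorem exists_isCutoff : ∃ K : ℝ, 0 ≤ K ∧ ∀ R : ℝ, 1 ≤ R → ∃ ζ, IsCutoff K R ζ := by
  let χ : ContDiffBump (0 : ℝ) := ⟨1, 2, one_pos, one_lt_two⟩
  have hχ : BoundedSmooth χ := BoundedSmooth.of_hasCompactSupport χ.contDiff χ.hasCompactSupport
  obtain ⟨A, hA⟩ := hχ.deriv.exists_bound
  obtain ⟨B, hB⟩ := hχ.deriv.deriv.exists_bound
  have hA0 : 0 ≤ A := (norm_nonneg _).trans (hA 0)
  have hB0 : 0 ≤ B := (norm_nonneg _).trans (hB 0)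
  refine ⟨A + B, by positivity, fun R hR => ⟨fun t => χ (R⁻¹ * t), ?_⟩⟩
  have hR0 : 0 < R := by linarith
  have hone : ∀ t, |t| ≤ R → χ (R⁻¹ * t) = 1 := fun t ht => by
    refine χ.one_of_mem_closedBall ?_
    rw [mem_closedBall_zero_iff, norm_mul, norm_inv, Real.norm_of_nonneg hR0.le, Real.norm_eq_abs]
    change R⁻¹ * |t| ≤ 1
    rw [inv_mul_le_iff₀ hR0]; linarith
  have hzero : ∀ t, 2 * R ≤ |t| → χ (R⁻¹ * t) = 0 := fun t ht => by
    refine χ.zero_of_le_dist ?_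
    rw [dist_zero_right, norm_mul, norm_inv, Real.norm_of_nonneg hR0.le, Real.norm_eq_abs]
    change 2 ≤ R⁻¹ * |t|
    rw [le_inv_mul_iff₀ hR0]; linarith
  have hsm : BoundedSmooth fun t => χ (R⁻¹ * t) := by
    refine BoundedSmooth.of_hasCompactSupport (χ.contDiff.comp (contDiff_const.mul contDiff_id)) ?_
    refine HasCompactSupport.intro (isCompact_Icc (a := -(2 * R)) (b := 2 * R)) fun t ht => ?_
    refine hzero t ?_
    by_contra h
    exact ht ⟨by linarith [(abs_lt.1 (not_le.1 h)).1], by linarith [(abs_lt.1 (not_le.1 h)).2]⟩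
  have hd1 : deriv (fun t => χ (R⁻¹ * t)) = fun t => R⁻¹ * deriv χ (R⁻¹ * t) := by
    funext t
    simpa using deriv_comp_mul_left R⁻¹ (χ : ℝ → ℝ) t
  have hd2 : deriv (deriv (fun t => χ (R⁻¹ * t))) =
      fun t => R⁻¹ * (R⁻¹ * deriv (deriv χ) (R⁻¹ * t)) := by
    rw [hd1]
    funext t
    rw [deriv_const_mul_field]
    congr 1
    simpa using deriv_comp_mul_left R⁻¹ (deriv (χ : ℝ → ℝ)) t
  have hmin : ∀ t, R ≤ t → min 1 ((t / R) ^ 2) = 1 := fun t ht => by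
    refine min_eq_left ?_
    have : 1 ≤ t / R := (one_le_div hR0).2 ht
    nlinarith
  have hmin0 : ∀ t, 0 ≤ min 1 ((t / R) ^ 2) := fun t => le_min zero_le_one (sq_nonneg _)
  have hloc : ∀ t, 0 ≤ t → t < R → (fun t => χ (R⁻¹ * t)) =ᶠ[𝓝 t] fun _ => 1 := fun t h0 ht => by
    filter_upwards [Ioo_mem_nhds (show -R < t by linarith) ht] with s hs
    exact hone s (abs_le.2 ⟨hs.1.le, hs.2.le⟩)
  have hloc0 : ∀ t, 2 * R < t → (fun t => χ (R⁻¹ * t)) =ᶠ[𝓝 t] fun _ => 0 := fun t ht => by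
    filter_upwards [Ioi_mem_nhds ht] with s hs
    exact hzero s (by rw [Set.mem_Ioi] at hs; exact hs.le.trans (le_abs_self s))
  refine ⟨hsm, fun t => χ.nonneg, fun t => χ.le_one, fun t ht => ?_, fun t ht => ?_,
    fun t ht => ?_, fun t ht => ?_⟩
  · rcases lt_or_ge t R with h | h
    · rw [hone t (by rw [abs_of_nonneg ht]; exact h.le)]
      simpa using hmin0 t
    · rw [hmin t h]
      linarith [χ.nonneg (x := R⁻¹ * t)]
  · rcases lt_or_ge t R with h | h
    · rw [(hloc t ht h).deriv_eq]
      have := hmin0 t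
      simp
      positivity
    · rw [hmin t h, hd1, abs_mul, abs_of_pos (inv_pos.2 hR0), mul_inv_cancel_left₀ hR0.ne']
      have := hA (R⁻¹ * t)
      rw [Real.norm_eq_abs] at this
      linarith
  · rcases lt_or_ge t R with h | h
    · rw [(hloc t ht h).deriv.deriv_eq]
      have := hmin0 t
      simp
      positivity
    · rw [hmin t h, hd2, abs_mul, abs_mul, abs_of_pos (inv_pos.2 hR0)]
      have := hB (R⁻¹ * t)
      rw [Real.norm_eq_abs] at this
      rw [show ∀ z : ℝ, R ^ 2 * (R⁻¹ * (R⁻¹ * z)) = z from fun z => by field_simp]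
      linarith
  · refine ⟨(hloc0 t ht).eq_of_nhds, ?_, ?_⟩
    · rw [(hloc0 t ht).deriv_eq]; simp
    · rw [(hloc0 t ht).deriv.deriv_eq]; simp

end Cutoff

section Localized

variable {H : Type*} [NormedAddCommGroup H] [InnerProductSpace ℝ H] {n : ℕ} {φ : Fin n → H}
variable {Ω : Type*} [MeasurableSpace Ω] {P : Measure Ω} {W : H → Ω → ℝ}

/-- The sum of the ratios `‖Dα‖² / (1 + α)` and `‖Dβ‖² / (1 + β)`. -/
noncomputable def cylRatio (φ : Fin n → H) (α β : (Fin n → ℝ) → ℝ) (x : Fin n → ℝ) : ℝ :=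
  ‖cylGrad φ α x‖ ^ 2 * (1 + α x)⁻¹ + ‖cylGrad φ β x‖ ^ 2 * (1 + β x)⁻¹

lemma cylRatio_nonneg {α β : (Fin n → ℝ) → ℝ} (hα : ∀ x, 0 ≤ α x) (hβ : ∀ x, 0 ≤ β x)
    (x : Fin n → ℝ) : 0 ≤ cylRatio φ α β x := by
  have h1 := hα x
  have h2 := hβ x
  exact add_nonneg (by positivity) (by positivity)

lemma norm_add_sq_le_cylRatio {α β : (Fin n → ℝ) → ℝ} (hα : ∀ x, 0 ≤ α x) (hβ : ∀ x, 0 ≤ β x)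
    {R : ℝ} (hR : 1 ≤ R) {x : Fin n → ℝ} (hx : α x + β x ≤ 2 * R) :
    (‖cylGrad φ α x‖ + ‖cylGrad φ β x‖) ^ 2 ≤ 6 * R * cylRatio φ α β x := by
  have h1 := hα x
  have h2 := hβ x
  have e1 : ‖cylGrad φ α x‖ ^ 2 = (‖cylGrad φ α x‖ ^ 2 * (1 + α x)⁻¹) * (1 + α x) := by
    field_simp
  have e2 : ‖cylGrad φ β x‖ ^ 2 = (‖cylGrad φ β x‖ ^ 2 * (1 + β x)⁻¹) * (1 + β x) := by
    field_simp
  have k1 : ‖cylGrad φ α x‖ ^ 2 ≤ (‖cylGrad φ α x‖ ^ 2 * (1 + α x)⁻¹) * (3 * R) := by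
    conv_lhs => rw [e1]
    gcongr
    linarith
  have k2 : ‖cylGrad φ β x‖ ^ 2 ≤ (‖cylGrad φ β x‖ ^ 2 * (1 + β x)⁻¹) * (3 * R) := by
    conv_lhs => rw [e2]
    gcongr
    linarith
  rw [cylRatio]
  nlinarith [sq_nonneg (‖cylGrad φ α x‖ - ‖cylGrad φ β x‖)]

lemma linearGrowth_of_bounded {E F : Type*} [NormedAddCommGroup E] [NormedAddCommGroup F]
    {g : E → F} (hg : Continuous g) {C : ℝ} (hC : ∀ x, ‖g x‖ ≤ C) : LinearGrowth g :=
  ⟨hg, C, fun x => (hC x).trans (by nlinarith [norm_nonneg x, (norm_nonneg _).trans (hC x)])⟩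

lemma linearGrowth_hilbertTmul {a b : (Fin n → ℝ) → H} (ha : BoundedSmooth a)
    (hb : BoundedSmooth b) : LinearGrowth fun x => hilbertTmul (a x) (b x) := by
  obtain ⟨A, hA⟩ := ha.exists_bound
  obtain ⟨B, hB⟩ := hb.exists_bound
  refine linearGrowth_of_bounded (continuous_hilbertTmul.comp (ha.continuous.prodMk hb.continuous))
    (C := A * B) fun x => ?_
  rw [norm_hilbertTmul]
  exact mul_le_mul (hA x) (hB x) (norm_nonneg _) ((norm_nonneg _).trans (hA x))

lemma linearGrowth_ratio {u : (Fin n → ℝ) → ℝ} (hu : BoundedSmooth u) (hu0 : ∀ x, 0 ≤ u x) :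
    LinearGrowth fun x => ‖cylGrad φ u x‖ ^ 2 * (1 + u x)⁻¹ := by
  obtain ⟨C, hC⟩ := (hu.cylGrad (φ := φ)).exists_bound
  refine linearGrowth_of_bounded (C := C ^ 2) ?_ fun x => ?_
  · refine (hu.cylGrad.continuous.norm.pow 2).mul ((continuous_const.add hu.continuous).inv₀ ?_)
    intro x
    have := hu0 x
    exact (by linarith : (0 : ℝ) < 1 + u x).ne'
  · rw [norm_mul, norm_pow, norm_norm]
    have h1 := bounded_inv_one_add (hu0 x)
    have h2 : ‖cylGrad φ u x‖ ^ 2 ≤ C ^ 2 := by gcongr; exact hC x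
    nlinarith [sq_nonneg ‖cylGrad φ u x‖, norm_nonneg (1 + u x)⁻¹]

lemma linearGrowth_cylRatio {α β : (Fin n → ℝ) → ℝ} (hα : BoundedSmooth α) (hβ : BoundedSmooth β)
    (hα0 : ∀ x, 0 ≤ α x) (hβ0 : ∀ x, 0 ≤ β x) : LinearGrowth (cylRatio φ α β) :=
  (linearGrowth_ratio hα hα0).add (linearGrowth_ratio hβ hβ0)

lemma hasMalliavinDeriv2_cylindrical (hW : IsIsonormal P W) {f : (Fin n → ℝ) → ℝ}
    (hf : BoundedSmooth f) : HasMalliavinDeriv2 P W (fun ω => f fun i => W (φ i) ω)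
      (fun ω => cylGrad φ f fun i => W (φ i) ω) (fun ω => cylHess φ f fun i => W (φ i) ω) where
  memLp := hf.linearGrowth.memLp hW φ (by simp)
  memLp_deriv := hf.cylGrad.linearGrowth.memLp hW φ (by simp)
  memLp_deriv2 := hf.cylHess.linearGrowth.memLp hW φ (by simp)
  exists_approx := by
    refine ⟨fun _ => ⟨n, φ, f, hf.smooth, hf.bounded⟩, ?_, ?_, ?_⟩
    · simp [SmoothCylindrical.eval]
    · simp [SmoothCylindrical.deriv, cylGrad]
    · simp [SmoothCylindrical.deriv2, cylHess]

/-- The second derivative of `θ(w) ζ(y)`. -/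
lemma cylHess_localized {θ ζ : ℝ → ℝ} (hθ : BoundedSmooth θ) (hζ : BoundedSmooth ζ)
    {w y : (Fin n → ℝ) → ℝ} (hw : BoundedSmooth w) (hy : BoundedSmooth y) (x : Fin n → ℝ) :
    cylHess φ (fun x => θ (w x) * ζ (y x)) x =
      (ζ (y x) * deriv θ (w x)) • cylHess φ w x +
      (ζ (y x) * deriv (deriv θ) (w x)) • hilbertTmul (cylGrad φ w x) (cylGrad φ w x) +
      (θ (w x) • (deriv ζ (y x) • cylHess φ y x +
          deriv (deriv ζ) (y x) • hilbertTmul (cylGrad φ y x) (cylGrad φ y x)) +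
        (deriv θ (w x) * deriv ζ (y x)) • (hilbertTmul (cylGrad φ w x) (cylGrad φ y x) +
          hilbertTmul (cylGrad φ y x) (cylGrad φ w x))) := by
  rw [cylHess_mul (hθ.comp hw) (hζ.comp hy), cylHess_comp hθ hw, cylHess_comp hζ hy,
    cylGrad_comp hθ.differentiable hw.differentiable,
    cylGrad_comp hζ.differentiable hy.differentiable]
  simp only [hilbertTmul_smul_left, hilbertTmul_smul_right, smul_smul, smul_add]
  rw [mul_comm (deriv ζ (y x)) (deriv θ (w x))]
  abel

lemma norm_localized_remainder_le {θ ζ : ℝ → ℝ} {K R M₀ M₁ : ℝ} (hR : 1 ≤ R) (hK : 0 ≤ K)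
    (hζ : IsCutoff K R ζ) (hM₀ : ∀ t, |θ t| ≤ M₀) (hM₁ : ∀ t, |deriv θ t| ≤ M₁)
    {α β : (Fin n → ℝ) → ℝ} (hα : BoundedSmooth α) (hβ : BoundedSmooth β)
    (hα0 : ∀ x, 0 ≤ α x) (hβ0 : ∀ x, 0 ≤ β x) (x : Fin n → ℝ) :
    ‖θ (α x - β x) • (deriv ζ (α x + β x) • cylHess φ (fun x => α x + β x) x +
          deriv (deriv ζ) (α x + β x) • hilbertTmul (cylGrad φ (fun x => α x + β x) x)
            (cylGrad φ (fun x => α x + β x) x)) +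
        (deriv θ (α x - β x) * deriv ζ (α x + β x)) •
          (hilbertTmul (cylGrad φ (fun x => α x - β x) x) (cylGrad φ (fun x => α x + β x) x) +
          hilbertTmul (cylGrad φ (fun x => α x + β x) x) (cylGrad φ (fun x => α x - β x) x))‖ ≤
      K * (6 * M₀ + 12 * M₁) * (min 1 (((α x + β x) / R) ^ 2) *
        (cylRatio φ α β x + ‖cylHess φ (fun x => α x + β x) x‖)) := by
  have hy0 : 0 ≤ α x + β x := add_nonneg (hα0 x) (hβ0 x)
  have hm0 := cylRatio_nonneg (φ := φ) hα0 hβ0 x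
  have hb0 : 0 ≤ min 1 (((α x + β x) / R) ^ 2) := le_min zero_le_one (sq_nonneg _)
  have hM₀0 : 0 ≤ M₀ := (abs_nonneg _).trans (hM₀ 0)
  have hM₁0 : 0 ≤ M₁ := (abs_nonneg _).trans (hM₁ 0)
  have hR0 : 0 < R := by linarith
  rcases lt_or_ge (2 * R) (α x + β x) with h | h
  · obtain ⟨-, h1, h2⟩ := hζ.eq_zero _ h
    rw [h1, h2]
    simp only [zero_smul, smul_zero, add_zero, mul_zero, norm_zero]
    positivity
  have hd1 := hζ.deriv_le _ hy0
  have hd2 := hζ.deriv2_le _ hy0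
  have hn := norm_add_sq_le_cylRatio (φ := φ) hα0 hβ0 hR h
  rw [cylGrad_add hα.differentiable hβ.differentiable, cylGrad_sub hα.differentiable hβ.differentiable]
  set b := min 1 (((α x + β x) / R) ^ 2)
  set m := cylRatio φ α β x
  set a := cylGrad φ α x
  set c := cylGrad φ β x
  set h2 := cylHess φ (fun x => α x + β x) x
  set z1 := deriv ζ (α x + β x)
  set z2 := deriv (deriv ζ) (α x + β x)
  have hp : ‖a + c‖ ≤ ‖a‖ + ‖c‖ := norm_add_le _ _
  have hs : ‖a - c‖ ≤ ‖a‖ + ‖c‖ := norm_sub_le _ _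
  have hpp : ‖a + c‖ * ‖a + c‖ ≤ 6 * R * m := by
    refine le_trans ?_ hn
    rw [sq]; gcongr
  have hsp : ‖a - c‖ * ‖a + c‖ ≤ 6 * R * m := by
    refine le_trans ?_ hn
    rw [sq]; gcongr
  have z1b : |z1| ≤ K * b := by nlinarith [abs_nonneg z1]
  have z2b : |z2| * (6 * R * m) ≤ 6 * (K * b * m) := by
    have h5 : R * |z2| ≤ K * b := by
      nlinarith [mul_le_mul_of_nonneg_right hR (mul_nonneg hR0.le (abs_nonneg z2))]
    nlinarith [mul_le_mul_of_nonneg_right h5 hm0]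
  have z1c : |z1| * (6 * R * m) ≤ 6 * (K * b * m) := by
    nlinarith [mul_le_mul_of_nonneg_right hd1 hm0]
  have t1 : ‖z1 • h2 + z2 • hilbertTmul (a + c) (a + c)‖ ≤ K * b * ‖h2‖ + 6 * (K * b * m) := by
    refine (norm_add_le _ _).trans (add_le_add ?_ ?_)
    · rw [norm_smul, Real.norm_eq_abs]; gcongr
    · rw [norm_smul, Real.norm_eq_abs, norm_hilbertTmul]
      exact (mul_le_mul_of_nonneg_left hpp (abs_nonneg _)).trans z2b
  have t2 : ‖hilbertTmul (a - c) (a + c) + hilbertTmul (a + c) (a - c)‖ ≤ 2 * (6 * R * m) := by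
    refine (norm_add_le _ _).trans ?_
    rw [norm_hilbertTmul, norm_hilbertTmul, mul_comm ‖a + c‖]
    linarith
  calc _ ≤ M₀ * (K * b * ‖h2‖ + 6 * (K * b * m)) + M₁ * (2 * (6 * (K * b * m))) := by
        refine (norm_add_le _ _).trans (add_le_add ?_ ?_)
        · rw [norm_smul, Real.norm_eq_abs]
          exact mul_le_mul (hM₀ _) t1 (norm_nonneg _) hM₀0
        · rw [norm_smul, norm_mul, Real.norm_eq_abs, Real.norm_eq_abs, mul_assoc]
          refine mul_le_mul (hM₁ _) ?_ (by positivity) hM₁0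
          have := mul_le_mul_of_nonneg_left t2 (abs_nonneg z1)
          linarith
    _ ≤ _ := by
        have h6 : 0 ≤ K * b * ‖h2‖ := by positivity
        nlinarith [mul_nonneg hM₀0 h6, mul_nonneg hM₁0 h6]

/-- The duality formula for `δ²` applied to the localized functional `θ(α - β) ζ(α + β)`. -/
theorem abs_integral_localized_le (hW : IsIsonormal P W) {v : Ω → HilbertTensorSq H} {F : Ω → ℝ}
    (hv : MemLp v 2 P) (hFv : IsDivergence2 P W v F)
    {θ ζ : ℝ → ℝ} (hθ : BoundedSmooth θ) {K R M₀ M₁ M₂ : ℝ} (hR : 1 ≤ R) (hK : 0 ≤ K)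
    (hζ : IsCutoff K R ζ) (hM₀ : ∀ t, |θ t| ≤ M₀) (hM₁ : ∀ t, |deriv θ t| ≤ M₁)
    (hM₂ : ∀ t, |deriv (deriv θ) t| ≤ M₂)
    {α β : (Fin n → ℝ) → ℝ} (hα : BoundedSmooth α) (hβ : BoundedSmooth β)
    (hα0 : ∀ x, 0 ≤ α x) (hβ0 : ∀ x, 0 ≤ β x) {w y m b h2 : Ω → ℝ} {Dw : Ω → H}
    {D2w : Ω → HilbertTensorSq H}
    (hw : w = fun ω => α (fun i => W (φ i) ω) - β (fun i => W (φ i) ω))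
    (hy : y = fun ω => α (fun i => W (φ i) ω) + β (fun i => W (φ i) ω))
    (hDw : Dw = fun ω => cylGrad φ (fun x => α x - β x) fun i => W (φ i) ω)
    (hD2w : D2w = fun ω => cylHess φ (fun x => α x - β x) fun i => W (φ i) ω)
    (hm : m = fun ω => cylRatio φ α β fun i => W (φ i) ω)
    (hh2 : h2 = fun ω => ‖cylHess φ (fun x => α x + β x) fun i => W (φ i) ω‖)
    (hb : b = fun ω => min 1 ((y ω / R) ^ 2)) :
    |∫ ω, θ (w ω) * ζ (y ω) * F ω ∂P -
      ∫ ω, ζ (y ω) * deriv θ (w ω) * inner ℝ (D2w ω) (v ω) ∂P| ≤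
      M₂ * ∫ ω, ζ (y ω) * |inner ℝ (hilbertTmul (Dw ω) (Dw ω)) (v ω)| ∂P +
        K * (6 * M₀ + 12 * M₁) * ∫ ω, b ω * (m ω + h2 ω) * ‖v ω‖ ∂P := by
  subst hw hy hDw hD2w hm hh2 hb
  have := hW.isProbabilityMeasure
  have hwS := hα.sub hβ
  have hyS := hα.add hβ
  have hdual := hFv.2 _ _ _
    (hasMalliavinDeriv2_cylindrical (φ := φ) hW ((hθ.comp hwS).mul (hζ.smooth.comp hyS)))
  have hXm := (hW.measurable_vec φ).aestronglyMeasurable (μ := P)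
  have cont : ∀ {g : (Fin n → ℝ) → ℝ}, Continuous g →
      AEStronglyMeasurable (fun ω => g fun i => W (φ i) ω) P := fun hg =>
    hg.comp_aestronglyMeasurable hXm
  have I1 : Integrable (fun ω => ζ (α (fun i => W (φ i) ω) + β (fun i => W (φ i) ω)) *
      deriv θ (α (fun i => W (φ i) ω) - β (fun i => W (φ i) ω)) *
      inner ℝ (cylHess φ (fun x => α x - β x) fun i => W (φ i) ω) (v ω)) P := by
    obtain ⟨C, hC⟩ := ((hζ.smooth.comp hyS).mul (hθ.deriv.comp hwS)).exists_bound
    exact ((hwS.cylHess.linearGrowth.memLp hW φ (by simp)).integrable_inner_of_two hv).bdd_mul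
      (c := C) (cont ((hζ.smooth.comp hyS).mul (hθ.deriv.comp hwS)).continuous)
      (Eventually.of_forall fun ω => hC _)
  have I2 : Integrable (fun ω => inner ℝ (cylHess φ (fun x => θ (α x - β x) * ζ (α x + β x))
      fun i => W (φ i) ω) (v ω)) P :=
    (((hθ.comp hwS).mul (hζ.smooth.comp hyS)).cylHess.linearGrowth.memLp hW φ
      (by simp)).integrable_inner_of_two hv
  have I3 : Integrable (fun ω => ζ (α (fun i => W (φ i) ω) + β (fun i => W (φ i) ω)) *
      |inner ℝ (hilbertTmul (cylGrad φ (fun x => α x - β x) fun i => W (φ i) ω)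
        (cylGrad φ (fun x => α x - β x) fun i => W (φ i) ω)) (v ω)|) P := by
    obtain ⟨C, hC⟩ := (hζ.smooth.comp hyS).exists_bound
    exact (((linearGrowth_hilbertTmul hwS.cylGrad hwS.cylGrad).memLp hW φ
      (by simp)).integrable_inner_of_two hv).abs.bdd_mul
      (c := C) (cont (hζ.smooth.comp hyS).continuous) (Eventually.of_forall fun ω => hC _)
  have hρ : MemLp (fun ω => cylRatio φ α β (fun i => W (φ i) ω) +
      ‖cylHess φ (fun x => α x + β x) fun i => W (φ i) ω‖) 2 P :=
    ((linearGrowth_cylRatio hα hβ hα0 hβ0).memLp hW φ (by simp)).add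
      (hyS.cylHess.linearGrowth.memLp hW φ (p := 2) (by simp)).norm
  have I4 : Integrable (fun ω =>
      min 1 (((α (fun i => W (φ i) ω) + β (fun i => W (φ i) ω)) / R) ^ 2) *
      (cylRatio φ α β (fun i => W (φ i) ω) +
        ‖cylHess φ (fun x => α x + β x) fun i => W (φ i) ω‖) * ‖v ω‖) P := by
    have : Integrable (fun ω => (cylRatio φ α β (fun i => W (φ i) ω) +
        ‖cylHess φ (fun x => α x + β x) fun i => W (φ i) ω‖) * ‖v ω‖) P :=
      hρ.integrable_mul hv.norm
    simp only [mul_assoc]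
    refine this.bdd_mul (c := 1) (cont (g := fun x => min 1 (((α x + β x) / R) ^ 2))
      (continuous_const.min ((hyS.continuous.div_const R).pow 2)))
      (Eventually.of_forall fun ω => ?_)
    rw [Real.norm_of_nonneg (le_min zero_le_one (sq_nonneg _))]
    exact min_le_left _ _
  have hpt : ∀ ω, |inner ℝ (cylHess φ (fun x => θ (α x - β x) * ζ (α x + β x))
      fun i => W (φ i) ω) (v ω) - ζ (α (fun i => W (φ i) ω) + β (fun i => W (φ i) ω)) *
      deriv θ (α (fun i => W (φ i) ω) - β (fun i => W (φ i) ω)) *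
      inner ℝ (cylHess φ (fun x => α x - β x) fun i => W (φ i) ω) (v ω)| ≤
      M₂ * (ζ (α (fun i => W (φ i) ω) + β (fun i => W (φ i) ω)) *
      |inner ℝ (hilbertTmul (cylGrad φ (fun x => α x - β x) fun i => W (φ i) ω)
        (cylGrad φ (fun x => α x - β x) fun i => W (φ i) ω)) (v ω)|) +
      K * (6 * M₀ + 12 * M₁) *
      (min 1 (((α (fun i => W (φ i) ω) + β (fun i => W (φ i) ω)) / R) ^ 2) *
      (cylRatio φ α β (fun i => W (φ i) ω) +
        ‖cylHess φ (fun x => α x + β x) fun i => W (φ i) ω‖) * ‖v ω‖) := by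
    intro ω
    rw [cylHess_localized (φ := φ) hθ hζ.smooth hwS hyS, inner_add_left, inner_add_left,
      real_inner_smul_left, real_inner_smul_left, add_assoc, add_sub_cancel_left]
    refine (abs_add_le _ _).trans (add_le_add ?_ ?_)
    · rw [abs_mul, abs_mul, abs_of_nonneg (hζ.nonneg _)]
      have h1 := hM₂ (α (fun i => W (φ i) ω) - β (fun i => W (φ i) ω))
      have h2 := mul_le_mul_of_nonneg_left h1 (hζ.nonneg
        (α (fun i => W (φ i) ω) + β (fun i => W (φ i) ω)))
      have h3 := mul_le_mul_of_nonneg_right h2 (abs_nonneg (inner ℝ (hilbertTmul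
        (cylGrad φ (fun x => α x - β x) fun i => W (φ i) ω)
        (cylGrad φ (fun x => α x - β x) fun i => W (φ i) ω)) (v ω)))
      linarith
    · refine (abs_real_inner_le_norm _ _).trans ?_
      have := mul_le_mul_of_nonneg_right (norm_localized_remainder_le (φ := φ) hR hK hζ hM₀ hM₁
        hα hβ hα0 hβ0 fun i => W (φ i) ω) (norm_nonneg (v ω))
      linarith
  rw [hdual, ← integral_sub I2 I1]
  refine (abs_integral_le_integral_abs).trans ?_
  rw [← integral_const_mul, ← integral_const_mul, ← integral_add (I3.const_mul _) (I4.const_mul _)]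
  exact integral_mono (I2.sub I1).abs ((I3.const_mul _).add (I4.const_mul _)) hpt

end Localized

section LocalApprox

variable {H Ω : Type*} [NormedAddCommGroup H] [InnerProductSpace ℝ H] [MeasurableSpace Ω]

/-- `w` approximates `F` in the Sobolev norm up to `d`, and comes with a control variable `y` at
which it can be localized, at the cost of remainders controlled by `g`. -/
structure IsLocalApprox (P : Measure Ω) (v : Ω → HilbertTensorSq H) (F : Ω → ℝ) (DF : Ω → H)
    (D2F : Ω → HilbertTensorSq H) (C d : ℝ) (w y g : Ω → ℝ) (Dw : Ω → H)
    (D2w : Ω → HilbertTensorSq H) : Prop where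
  memLp : MemLp w 2 P
  memLp_deriv : MemLp Dw 2 P
  memLp_deriv2 : MemLp D2w 2 P
  memLp_control : MemLp y 2 P
  memLp_remainder : MemLp g 2 P
  control_nonneg : ∀ ω, 0 ≤ y ω
  remainder_nonneg : ∀ ω, 0 ≤ g ω
  norm_deriv_sq_le : ∀ R : ℝ, 1 ≤ R → ∀ ω, y ω ≤ 2 * R → ‖Dw ω‖ ^ 2 ≤ 6 * R * g ω
  integral_control_sq_le : ∫ ω, y ω ^ 2 ∂P ≤ C
  integral_remainder_sq_le : ∫ ω, g ω ^ 2 ∂P ≤ C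
  integral_sub_sq_le : ∫ ω, ‖w ω - F ω‖ ^ 2 ∂P ≤ d ^ 2
  integral_deriv_sub_sq_le : ∫ ω, ‖Dw ω - DF ω‖ ^ 2 ∂P ≤ d ^ 2
  integral_deriv2_sub_sq_le : ∫ ω, ‖D2w ω - D2F ω‖ ^ 2 ∂P ≤ d ^ 2
  duality : ∀ {θ ζ : ℝ → ℝ} {K R M₀ M₁ M₂ : ℝ}, BoundedSmooth θ → 1 ≤ R → 0 ≤ K →
    IsCutoff K R ζ → (∀ t, |θ t| ≤ M₀) → (∀ t, |deriv θ t| ≤ M₁) →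
    (∀ t, |deriv (deriv θ) t| ≤ M₂) →
    |∫ ω, θ (w ω) * ζ (y ω) * F ω ∂P -
      ∫ ω, ζ (y ω) * deriv θ (w ω) * inner ℝ (D2w ω) (v ω) ∂P| ≤
      M₂ * ∫ ω, ζ (y ω) * |inner ℝ (hilbertTmul (Dw ω) (Dw ω)) (v ω)| ∂P +
        K * (6 * M₀ + 12 * M₁) * ∫ ω, min 1 ((y ω / R) ^ 2) * g ω * ‖v ω‖ ∂P

variable {P : Measure Ω} {W : H → Ω → ℝ} {v : Ω → HilbertTensorSq H} {F : Ω → ℝ} {DF : Ω → H}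
  {D2F : Ω → HilbertTensorSq H}

lemma integral_sq_parts_le (hW : IsIsonormal P W) {n : ℕ} {φ : Fin n → H} {u : (Fin n → ℝ) → ℝ}
    (hu : BoundedSmooth u) {A : ℝ} (h : ∫ ω, cylOp φ u (fun i => W (φ i) ω) ^ 2 ∂P ≤ A) :
    ∫ ω, ‖u (fun i => W (φ i) ω)‖ ^ 2 ∂P ≤ A ∧
      ∫ ω, ‖cylGrad φ u (fun i => W (φ i) ω)‖ ^ 2 ∂P ≤ A ∧
      ∫ ω, ‖cylHess φ u (fun i => W (φ i) ω)‖ ^ 2 ∂P ≤ A := by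
  rw [integral_cylOp_sq hW hu] at h
  simp only [Real.norm_eq_abs, sq_abs]
  have h0 : 0 ≤ ∫ ω, u (fun i => W (φ i) ω) ^ 2 ∂P := integral_nonneg fun ω => sq_nonneg _
  have h1 : 0 ≤ ∫ ω, ‖cylGrad φ u (fun i => W (φ i) ω)‖ ^ 2 ∂P :=
    integral_nonneg fun ω => sq_nonneg _
  have h2 : 0 ≤ ∫ ω, ‖cylHess φ u (fun i => W (φ i) ω)‖ ^ 2 ∂P :=
    integral_nonneg fun ω => sq_nonneg _
  exact ⟨by linarith, by linarith, by linarith⟩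

/-- The remainder variable attached to a pair of nonnegative cylindrical functionals. -/
noncomputable def cylRemainder {n : ℕ} (φ : Fin n → H) (α β : (Fin n → ℝ) → ℝ) (x : Fin n → ℝ) : ℝ :=
  cylRatio φ α β x + ‖cylHess φ (fun x => α x + β x) x‖

lemma integral_cylRemainder_sq_le (hW : IsIsonormal P W) {n : ℕ} {φ : Fin n → H}
    {α β : (Fin n → ℝ) → ℝ} (hα : BoundedSmooth α) (hβ : BoundedSmooth β)
    (hα0 : ∀ x, 0 ≤ α x) (hβ0 : ∀ x, 0 ≤ β x) {A : ℝ}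
    (hαA : ∫ ω, cylOp φ α (fun i => W (φ i) ω) ^ 2 ∂P ≤ A)
    (hβA : ∫ ω, cylOp φ β (fun i => W (φ i) ω) ^ 2 ∂P ≤ A) :
    MemLp (fun ω => cylRemainder φ α β fun i => W (φ i) ω) 2 P ∧
    ∫ ω, cylRemainder φ α β (fun i => W (φ i) ω) ^ 2 ∂P ≤ 88 * A := by
  have hmα := (linearGrowth_ratio (φ := φ) hα hα0).memLp hW φ (p := 2) (by simp)
  have hmβ := (linearGrowth_ratio (φ := φ) hβ hβ0).memLp hW φ (p := 2) (by simp)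
  have hhα := (hα.cylHess (φ := φ)).linearGrowth.memLp hW φ (p := 2) (by simp)
  have hhβ := (hβ.cylHess (φ := φ)).linearGrowth.memLp hW φ (p := 2) (by simp)
  have hh := ((hα.add hβ).cylHess (φ := φ)).linearGrowth.memLp hW φ (p := 2) (by simp)
  have hg : MemLp (fun ω => cylRemainder φ α β fun i => W (φ i) ω) 2 P :=
    (hmα.add hmβ).add hh.norm
  refine ⟨hg, ?_⟩
  have i1 := hmα.integrable_norm_sq
  have i2 := hmβ.integrable_norm_sq
  have i3 := hhα.integrable_norm_sq
  have i4 := hhβ.integrable_norm_sq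
  have i0 := hg.integrable_norm_sq
  simp only [Real.norm_eq_abs, sq_abs] at i0 i1 i2
  have e1 := integral_energy_div_sq_le (φ := φ) hW hα hα0
  have e2 := integral_energy_div_sq_le (φ := φ) hW hβ hβ0
  have e3 := (integral_sq_parts_le hW hα hαA).2.2
  have e4 := (integral_sq_parts_le hW hβ hβA).2.2
  have hint := integral_mono i0 ((((i1.add i2).add i3).add i4).const_mul 4) fun ω => ?_
  · rw [integral_const_mul, integral_add' ((i1.add i2).add i3) i4, integral_add' (i1.add i2) i3,
      integral_add' i1 i2] at hint
    linarith
  · simp only [Pi.add_apply, cylRemainder, cylRatio]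
    rw [cylHess_add hα hβ]
    set x : Fin n → ℝ := fun i => W (φ i) ω
    set a := ‖cylGrad φ α x‖ ^ 2 * (1 + α x)⁻¹
    set b := ‖cylGrad φ β x‖ ^ 2 * (1 + β x)⁻¹
    have h1 := norm_add_le (cylHess φ α x) (cylHess φ β x)
    have h2 := norm_nonneg (cylHess φ α x + cylHess φ β x)
    have ha : 0 ≤ a := by have := hα0 x; positivity
    have hb : 0 ≤ b := by have := hβ0 x; positivity
    set c := ‖cylHess φ α x‖
    set e := ‖cylHess φ β x‖
    have h3 : (a + b + ‖cylHess φ α x + cylHess φ β x‖) ^ 2 ≤ (a + b + (c + e)) ^ 2 := by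
      gcongr
    nlinarith [sq_nonneg (a - b), sq_nonneg (a - c), sq_nonneg (a - e), sq_nonneg (b - c),
      sq_nonneg (b - e), sq_nonneg (c - e)]

theorem exists_isLocalApprox (hW : IsIsonormal P W) (hv : MemLp v 2 P)
    (hFv : IsDivergence2 P W v F) (hF : HasMalliavinDeriv2 P W F DF D2F) :
    ∃ C : ℝ, 0 ≤ C ∧ ∀ d : ℝ, 0 < d → ∃ w y g Dw D2w,
      IsLocalApprox P v F DF D2F C d w y g Dw D2w := by
  set c₀ := ∫ ω, ‖F ω‖ ^ 2 ∂P
  set c₁ := ∫ ω, ‖DF ω‖ ^ 2 ∂P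
  set c₂ := ∫ ω, ‖D2F ω‖ ^ 2 ∂P
  have hc₀ : 0 ≤ c₀ := integral_nonneg fun ω => sq_nonneg _
  have hc₁ : 0 ≤ c₁ := integral_nonneg fun ω => sq_nonneg _
  have hc₂ : 0 ≤ c₂ := integral_nonneg fun ω => sq_nonneg _
  set A := 4 * (c₀ + 3 * c₁ + c₂) + 23 with hA
  refine ⟨88 * A, by positivity, fun d hd => ?_⟩
  set η := min d 1 / 2 with hη
  have hη0 : 0 < η := by positivity
  have hη1 : η ≤ 1 := by have := min_le_right d 1; linarith
  have hηd : 4 * η ^ 2 ≤ d ^ 2 := by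
    have h1 : 2 * η ≤ d := by have := min_le_left d 1; linarith
    nlinarith
  obtain ⟨S, hS0, hS1, hS2⟩ := hF.exists_approx
  have hSb : ∀ k, BoundedSmooth (S k).f := fun k => ⟨(S k).smooth, (S k).bounded⟩
  have m0 : ∀ k, MemLp ((S k).eval W) 2 P := fun k =>
    (hSb k).linearGrowth.memLp hW (S k).φ (by simp)
  have m1 : ∀ k, MemLp ((S k).deriv W) 2 P := fun k =>
    (hSb k).cylGrad.linearGrowth.memLp hW (S k).φ (by simp)
  have m2 : ∀ k, MemLp ((S k).deriv2 W) 2 P := fun k =>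
    (hSb k).cylHess.linearGrowth.memLp hW (S k).φ (by simp)
  have hη2 : 0 < η ^ 2 := by positivity
  obtain ⟨k, hk0, hk1, hk2⟩ :=
    (((tendsto_integral_norm_sub_sq m0 hF.memLp hS0).eventually_le_const hη2).and
    (((tendsto_integral_norm_sub_sq m1 hF.memLp_deriv hS1).eventually_le_const hη2).and
    ((tendsto_integral_norm_sub_sq m2 hF.memLp_deriv2 hS2).eventually_le_const hη2))).exists
  have b0 := integral_norm_sq_le_of_sub (m0 k) hF.memLp
  have b1 := integral_norm_sq_le_of_sub (m1 k) hF.memLp_deriv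
  have b2 := integral_norm_sq_le_of_sub (m2 k) hF.memLp_deriv2
  replace m0 := m0 k
  replace m1 := m1 k
  replace m2 := m2 k
  generalize S k = T at *
  obtain ⟨n, φ, f, hfs, hfb⟩ := T
  have hf : BoundedSmooth f := ⟨hfs, hfb⟩
  have hcf : ∫ ω, cylOp φ f (fun i => W (φ i) ω) ^ 2 ∂P ≤
      2 * (c₀ + 3 * c₁ + c₂) + 10 * η ^ 2 := by
    rw [integral_cylOp_sq hW hf]
    have e0 : ∫ ω, f (fun i => W (φ i) ω) ^ 2 ∂P ≤ 2 * η ^ 2 + 2 * c₀ := by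
      simp only [Real.norm_eq_abs, sq_abs] at b0 hk0
      refine b0.trans ?_
      simp only [c₀, Real.norm_eq_abs, sq_abs]
      linarith
    have e1 : ∫ ω, ‖cylGrad φ f (fun i => W (φ i) ω)‖ ^ 2 ∂P ≤ 2 * η ^ 2 + 2 * c₁ :=
      b1.trans (by linarith)
    have e2 : ∫ ω, ‖cylHess φ f (fun i => W (φ i) ω)‖ ^ 2 ∂P ≤ 2 * η ^ 2 + 2 * c₂ :=
      b2.trans (by linarith)
    linarith
  obtain ⟨α, β, hα, hβ, hα0, hβ0, hsub, hαA, hβA⟩ := exists_nonneg_sub_approx (φ := φ) hW hf hη0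
  have hη3 : η ^ 2 ≤ 1 := by nlinarith
  replace hαA : ∫ ω, cylOp φ α (fun i => W (φ i) ω) ^ 2 ∂P ≤ A := hαA.trans (by linarith)
  replace hβA : ∫ ω, cylOp φ β (fun i => W (φ i) ω) ^ 2 ∂P ≤ A := hβA.trans (by linarith)
  have hw := hα.sub hβ
  have hy := hα.add hβ
  have mw : MemLp (fun ω => α (fun i => W (φ i) ω) - β (fun i => W (φ i) ω)) 2 P :=
    hw.linearGrowth.memLp hW φ (by simp)
  have mDw : MemLp (fun ω => cylGrad φ (fun x => α x - β x) (fun i => W (φ i) ω)) 2 P :=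
    hw.cylGrad.linearGrowth.memLp hW φ (by simp)
  have mD2w : MemLp (fun ω => cylHess φ (fun x => α x - β x) (fun i => W (φ i) ω)) 2 P :=
    hw.cylHess.linearGrowth.memLp hW φ (by simp)
  have my : MemLp (fun ω => α (fun i => W (φ i) ω) + β (fun i => W (φ i) ω)) 2 P :=
    hy.linearGrowth.memLp hW φ (by simp)
  have mα : MemLp (fun ω => α (fun i => W (φ i) ω)) 2 P := hα.linearGrowth.memLp hW φ (by simp)
  have mβ : MemLp (fun ω => β (fun i => W (φ i) ω)) 2 P := hβ.linearGrowth.memLp hW φ (by simp)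
  obtain ⟨mg, hg⟩ := integral_cylRemainder_sq_le hW hα hβ hα0 hβ0 hαA hβA
  obtain ⟨s0, s1, s2⟩ := integral_sq_parts_le hW (hf.sub hw) hsub
  simp only [cylGrad_sub hf.differentiable hw.differentiable, cylHess_sub hf hw] at s1 s2
  refine ⟨fun ω => α (fun i => W (φ i) ω) - β (fun i => W (φ i) ω),
    fun ω => α (fun i => W (φ i) ω) + β (fun i => W (φ i) ω),
    fun ω => cylRemainder φ α β fun i => W (φ i) ω,
    fun ω => cylGrad φ (fun x => α x - β x) fun i => W (φ i) ω,
    fun ω => cylHess φ (fun x => α x - β x) fun i => W (φ i) ω,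
    mw, mDw, mD2w, my, mg, fun ω => add_nonneg (hα0 _) (hβ0 _),
    fun ω => add_nonneg (cylRatio_nonneg hα0 hβ0 _) (norm_nonneg _), fun R hR ω h => ?_, ?_, hg,
    ?_, ?_, ?_, ?_⟩
  · have h1 := norm_add_sq_le_cylRatio (φ := φ) hα0 hβ0 hR h
    rw [cylGrad_sub hα.differentiable hβ.differentiable]
    have h2 := norm_sub_le (cylGrad φ α fun i => W (φ i) ω) (cylGrad φ β fun i => W (φ i) ω)
    calc _ ≤ (‖cylGrad φ α fun i => W (φ i) ω‖ + ‖cylGrad φ β fun i => W (φ i) ω‖) ^ 2 := by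
          gcongr
      _ ≤ _ := h1
      _ ≤ _ := by
          have : 0 ≤ 6 * R := by linarith
          exact mul_le_mul_of_nonneg_left (le_add_of_nonneg_right (norm_nonneg _)) this
  · have h1 := integral_norm_sq_le_of_sub my mα
    simp only [add_sub_cancel_left] at h1
    have h2 := (integral_sq_parts_le hW hα hαA).1
    have h3 := (integral_sq_parts_le hW hβ hβA).1
    simp only [Real.norm_eq_abs, sq_abs] at h1 h2 h3
    refine h1.trans ?_
    linarith
  · exact (integral_norm_sub_sq_le mw m0 hF.memLp).trans (by
      refine le_trans ?_ hηd
      have : ∫ ω, ‖f (fun i => W (φ i) ω) - (α (fun i => W (φ i) ω) -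
        β (fun i => W (φ i) ω))‖ ^ 2 ∂P ≤ η ^ 2 := s0
      change 2 * ∫ ω, ‖f (fun i => W (φ i) ω) - (α (fun i => W (φ i) ω) -
        β (fun i => W (φ i) ω))‖ ^ 2 ∂P + _ ≤ _
      linarith)
  · exact (integral_norm_sub_sq_le mDw m1 hF.memLp_deriv).trans
      (le_trans (add_le_add (mul_le_mul_of_nonneg_left s1 zero_le_two)
        (mul_le_mul_of_nonneg_left hk1 zero_le_two)) (by linarith))
  · exact (integral_norm_sub_sq_le mD2w m2 hF.memLp_deriv2).trans
      (le_trans (add_le_add (mul_le_mul_of_nonneg_left s2 zero_le_two)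
        (mul_le_mul_of_nonneg_left hk2 zero_le_two)) (by linarith))
  · intro θ ζ K R M₀ M₁ M₂ hθ hR hK hζ hM₀ hM₁ hM₂
    exact abs_integral_localized_le hW hv hFv hθ hR hK hζ hM₀ hM₁ hM₂ hα hβ hα0 hβ0
      rfl rfl rfl rfl rfl rfl rfl

end LocalApprox

section Tails

variable {Ω : Type*} [MeasurableSpace Ω] {P : Measure Ω}

lemma integrable_max_sub_zero [IsFiniteMeasure P] {G : Ω → ℝ} (hG : Integrable G P) (L : ℝ) :
    Integrable (fun ω => max (G ω - L) 0) P :=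
  (hG.sub (integrable_const L)).pos_part

lemma abs_max_sub_zero_le {t L : ℝ} (hL : 0 ≤ L) : |max (t - L) 0| ≤ |t| := by
  rw [abs_of_nonneg (le_max_right _ _)]
  exact max_le (by linarith [le_abs_self t]) (abs_nonneg t)

lemma tendsto_max_sub_zero (t : ℝ) : Tendsto (fun L : ℝ => max (t - L) 0) atTop (𝓝 0) := by
  refine tendsto_const_nhds.congr' ?_
  filter_upwards [eventually_ge_atTop t] with L hL
  rw [max_eq_right (by linarith)]

lemma tendsto_integral_max_sub_zero [IsFiniteMeasure P] {G : Ω → ℝ} (hG : Integrable G P) :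
    Tendsto (fun L : ℝ => ∫ ω, max (G ω - L) 0 ∂P) atTop (𝓝 0) := by
  have := tendsto_integral_filter_of_dominated_convergence (μ := P) (l := atTop)
    (F := fun (L : ℝ) ω => max (G ω - L) 0) (f := fun _ => 0) (fun ω => |G ω|)
    (Eventually.of_forall fun L => (integrable_max_sub_zero hG L).aestronglyMeasurable)
    (by
      filter_upwards [eventually_ge_atTop (0 : ℝ)] with L hL
      exact Eventually.of_forall fun ω => abs_max_sub_zero_le hL) hG.abs
    (Eventually.of_forall fun ω => tendsto_max_sub_zero _)
  simpa using this

lemma memLp_max_sub_zero [IsFiniteMeasure P] {G : Ω → ℝ} (hG : MemLp G 2 P) (L : ℝ) :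
    MemLp (fun ω => max (G ω - L) 0) 2 P :=
  (hG.sub (memLp_const L)).pos_part

lemma tendsto_integral_max_sub_zero_sq [IsFiniteMeasure P] {G : Ω → ℝ} (hG : MemLp G 2 P) :
    Tendsto (fun L : ℝ => ∫ ω, max (G ω - L) 0 ^ 2 ∂P) atTop (𝓝 0) := by
  have := tendsto_integral_filter_of_dominated_convergence (μ := P) (l := atTop)
    (F := fun (L : ℝ) ω => max (G ω - L) 0 ^ 2) (f := fun _ => 0) (fun ω => ‖G ω‖ ^ 2)
    (Eventually.of_forall fun L => (memLp_max_sub_zero hG L).aestronglyMeasurable.pow 2)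
    (by
      filter_upwards [eventually_ge_atTop (0 : ℝ)] with L hL
      refine Eventually.of_forall fun ω => ?_
      rw [norm_pow]
      gcongr
      exact abs_max_sub_zero_le hL) hG.integrable_norm_sq
    (Eventually.of_forall fun ω => by simpa using (tendsto_max_sub_zero (G ω)).pow 2)
  simpa using this

/-- A bound for the integral of `G` against a cutoff at scale `R`. -/
noncomputable def cutoffError (P : Measure Ω) (C : ℝ) (G : Ω → ℝ) (R : ℝ) : ℝ :=
  C / R + ∫ ω, max (G ω - R) 0 ∂P

lemma tendsto_cutoffError [IsFiniteMeasure P] (C : ℝ) {G : Ω → ℝ} (hG : Integrable G P) :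
    Tendsto (cutoffError P C G) atTop (𝓝 0) := by
  have h := ((tendsto_const_nhds (x := C)).div_atTop tendsto_id).add
    (tendsto_integral_max_sub_zero hG)
  rw [add_zero] at h
  exact h

lemma integral_cutoff_mul_le [IsFiniteMeasure P] {y G : Ω → ℝ} {C R : ℝ} (hR : 1 ≤ R)
    (hy : MemLp y 2 P) (hyC : ∫ ω, y ω ^ 2 ∂P ≤ C) (hG : Integrable G P) (hG0 : ∀ ω, 0 ≤ G ω) :
    ∫ ω, min 1 ((y ω / R) ^ 2) * G ω ∂P ≤ cutoffError P C G R := by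
  have hR0 : 0 < R := by linarith
  have hy2 : Integrable (fun ω => y ω ^ 2) P := by simpa using hy.integrable_norm_sq
  have hm := integrable_max_sub_zero hG R
  have h1 : ∫ ω, min 1 ((y ω / R) ^ 2) * G ω ∂P ≤ ∫ ω, (y ω ^ 2 / R + max (G ω - R) 0) ∂P := by
    refine integral_mono_of_nonneg (Eventually.of_forall fun ω => ?_) ((hy2.div_const R).add hm)
      (Eventually.of_forall fun ω => ?_)
    · exact mul_nonneg (le_min zero_le_one (sq_nonneg _)) (hG0 ω)
    · have h2 : G ω ≤ R + max (G ω - R) 0 := by linarith [le_max_left (G ω - R) 0]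
      have h3 := min_le_left 1 ((y ω / R) ^ 2)
      have h4 := min_le_right 1 ((y ω / R) ^ 2)
      have h5 : 0 ≤ min 1 ((y ω / R) ^ 2) := le_min zero_le_one (sq_nonneg _)
      have h6 : (y ω / R) ^ 2 * R = y ω ^ 2 / R := by field_simp
      have h7 := le_max_right (G ω - R) 0
      calc _ ≤ min 1 ((y ω / R) ^ 2) * (R + max (G ω - R) 0) := mul_le_mul_of_nonneg_left h2 h5
        _ = min 1 ((y ω / R) ^ 2) * R + min 1 ((y ω / R) ^ 2) * max (G ω - R) 0 := mul_add _ _ _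
        _ ≤ (y ω / R) ^ 2 * R + 1 * max (G ω - R) 0 := by gcongr
        _ = _ := by rw [h6, one_mul]
  rw [integral_add (hy2.div_const R) hm, integral_div] at h1
  refine h1.trans (add_le_add_left ?_ _)
  gcongr

lemma abs_integral_sub_le_of_abs_sub_le {f g h : Ω → ℝ} (hf : Integrable f P)
    (hg : Integrable g P) (hh : Integrable h P) (hfg : ∀ ω, |f ω - g ω| ≤ h ω) :
    |∫ ω, f ω ∂P - ∫ ω, g ω ∂P| ≤ ∫ ω, h ω ∂P := by
  rw [← integral_sub hf hg]
  exact abs_integral_le_integral_abs.trans (integral_mono (hf.sub hg).abs hh hfg)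

lemma abs_sub_le_of_abs_deriv_le {θ : ℝ → ℝ} (hθ : Differentiable ℝ θ) {M : ℝ}
    (hM : ∀ t, |deriv θ t| ≤ M) (s t : ℝ) : |θ s - θ t| ≤ M * |s - t| :=
  Convex.norm_image_sub_le_of_norm_deriv_le (fun x _ => hθ x) (fun x _ => hM x) convex_univ
    (Set.mem_univ t) (Set.mem_univ s)

end Tails

namespace IsLocalApprox

variable {H Ω : Type*} [NormedAddCommGroup H] [InnerProductSpace ℝ H] [MeasurableSpace Ω]
  {P : Measure Ω} {v : Ω → HilbertTensorSq H} {F : Ω → ℝ} {DF : Ω → H}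
  {D2F : Ω → HilbertTensorSq H} {C d : ℝ} {w y g : Ω → ℝ} {Dw : Ω → H}
  {D2w : Ω → HilbertTensorSq H} {θ ζ : ℝ → ℝ} {K R L M₀ M₁ M₂ : ℝ}

lemma integrable_cutoff_mul (h : IsLocalApprox P v F DF D2F C d w y g Dw D2w)
    {G : Ω → ℝ} (hG : Integrable G P) :
    Integrable (fun ω => min 1 ((y ω / R) ^ 2) * G ω) P := by
  refine hG.bdd_mul (c := 1) ?_ (Eventually.of_forall fun ω => ?_)
  · exact (aestronglyMeasurable_const.inf
      ((h.memLp_control.aestronglyMeasurable.div₀ aestronglyMeasurable_const).pow 2))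
  · rw [Real.norm_of_nonneg (le_min zero_le_one (sq_nonneg _))]
    exact min_le_left _ _

lemma one_sub_cutoff_le (h : IsLocalApprox P v F DF D2F C d w y g Dw D2w) (hζ : IsCutoff K R ζ)
    (ω : Ω) : |1 - ζ (y ω)| ≤ min 1 ((y ω / R) ^ 2) := by
  rw [abs_of_nonneg (by linarith [hζ.le_one (y ω)])]
  exact hζ.one_sub_le _ (h.control_nonneg ω)

variable [IsProbabilityMeasure P]

lemma abs_integral_mul_sub_le (h : IsLocalApprox P v F DF D2F C d w y g Dw D2w) (hd : 0 ≤ d)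
    (hF : MemLp F 2 P) (hR : 1 ≤ R) (hζ : IsCutoff K R ζ) (hθ : BoundedSmooth θ)
    (hM₀ : ∀ t, |θ t| ≤ M₀) (hM₁ : ∀ t, |deriv θ t| ≤ M₁) :
    |∫ ω, θ (F ω) * F ω ∂P - ∫ ω, θ (w ω) * ζ (y ω) * F ω ∂P| ≤
      M₁ * (d * Real.sqrt (∫ ω, ‖F ω‖ ^ 2 ∂P)) + M₀ * cutoffError P C (fun ω => ‖F ω‖) R := by
  have hM₀0 : 0 ≤ M₀ := (abs_nonneg _).trans (hM₀ 0)
  have hM₁0 : 0 ≤ M₁ := (abs_nonneg _).trans (hM₁ 0)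
  have hFi : Integrable F P := hF.integrable one_le_two
  have hwF : MemLp (fun ω => w ω - F ω) 2 P := h.memLp.sub hF
  have i1 := hwF.integrable_norm_mul_norm hF
  have i2 := h.integrable_cutoff_mul (R := R) hFi.norm
  have hcw := hθ.continuous.comp_aestronglyMeasurable h.memLp.aestronglyMeasurable
  have hcy := hζ.smooth.continuous.comp_aestronglyMeasurable h.memLp_control.aestronglyMeasurable
  have hcF := hθ.continuous.comp_aestronglyMeasurable hF.aestronglyMeasurable
  refine (abs_integral_sub_le_of_abs_sub_le
    (hFi.bdd_mul (c := M₀) hcF (Eventually.of_forall fun ω => hM₀ _))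
    (hFi.bdd_mul (c := M₀ * 1) (hcw.mul hcy) (Eventually.of_forall fun ω => ?_))
    ((i1.const_mul M₁).add (i2.const_mul M₀)) fun ω => ?_).trans ?_
  · rw [Pi.mul_apply, norm_mul]
    refine mul_le_mul (hM₀ _) ?_ (norm_nonneg _) hM₀0
    rw [Real.norm_of_nonneg (hζ.nonneg _)]
    exact hζ.le_one _
  · have e : θ (F ω) * F ω - θ (w ω) * ζ (y ω) * F ω =
      (θ (F ω) - θ (w ω)) * F ω + θ (w ω) * (1 - ζ (y ω)) * F ω := by ring
    simp only [Pi.mul_apply, Pi.add_apply]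
    rw [e]
    refine (abs_add_le _ _).trans (add_le_add ?_ ?_)
    · rw [abs_mul, Real.norm_eq_abs, Real.norm_eq_abs, ← mul_assoc, abs_sub_comm (w ω)]
      gcongr
      exact abs_sub_le_of_abs_deriv_le hθ.differentiable hM₁ _ _
    · rw [abs_mul, abs_mul, Real.norm_eq_abs, ← mul_assoc]
      gcongr
      · exact hM₀ _
      · exact h.one_sub_cutoff_le hζ ω
  · rw [integral_add' (i1.const_mul M₁) (i2.const_mul M₀), integral_const_mul, integral_const_mul]
    gcongr
    · refine (hwF.integral_norm_mul_norm_le hF).trans ?_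
      gcongr
      exact Real.sqrt_le_iff.2 ⟨hd, h.integral_sub_sq_le⟩
    · exact integral_cutoff_mul_le hR h.memLp_control h.integral_control_sq_le hFi.norm
        fun ω => norm_nonneg _

lemma abs_integral_deriv_mul_inner_sub_le (h : IsLocalApprox P v F DF D2F C d w y g Dw D2w)
    (hd : 0 ≤ d) (hv : MemLp v 2 P) (hF : MemLp F 2 P) (hD2F : MemLp D2F 2 P) (hR : 1 ≤ R)
    (hL : 0 ≤ L) (hζ : IsCutoff K R ζ) (hθ : BoundedSmooth θ)
    (hM₁ : ∀ t, |deriv θ t| ≤ M₁) (hM₂ : ∀ t, |deriv (deriv θ) t| ≤ M₂) :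
    |∫ ω, deriv θ (F ω) * inner ℝ (D2F ω) (v ω) ∂P -
      ∫ ω, ζ (y ω) * deriv θ (w ω) * inner ℝ (D2w ω) (v ω) ∂P| ≤
      M₂ * L * d + 2 * M₁ * ∫ ω, max (‖inner ℝ (D2F ω) (v ω)‖ - L) 0 ∂P +
        M₁ * cutoffError P C (fun ω => ‖inner ℝ (D2F ω) (v ω)‖) R +
        M₁ * (d * Real.sqrt (∫ ω, ‖v ω‖ ^ 2 ∂P)) := by
  have hM₁0 : 0 ≤ M₁ := (abs_nonneg _).trans (hM₁ 0)
  have hM₂0 : 0 ≤ M₂ := (abs_nonneg _).trans (hM₂ 0)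
  have hX : Integrable (fun ω => inner ℝ (D2F ω) (v ω)) P := hD2F.integrable_inner_of_two hv
  have hXw : Integrable (fun ω => inner ℝ (D2w ω) (v ω)) P :=
    h.memLp_deriv2.integrable_inner_of_two hv
  have hwF : MemLp (fun ω => w ω - F ω) 2 P := h.memLp.sub hF
  have hD : MemLp (fun ω => D2w ω - D2F ω) 2 P := h.memLp_deriv2.sub hD2F
  have i0 : Integrable (fun ω => ‖w ω - F ω‖) P := (hwF.integrable one_le_two).norm
  have i1 := integrable_max_sub_zero hX.norm L
  have i2 := h.integrable_cutoff_mul (R := R) hX.norm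
  have i3 := hD.integrable_norm_mul_norm hv
  have hcw := hθ.deriv.continuous.comp_aestronglyMeasurable h.memLp.aestronglyMeasurable
  have hcy := hζ.smooth.continuous.comp_aestronglyMeasurable h.memLp_control.aestronglyMeasurable
  have hcF := hθ.deriv.continuous.comp_aestronglyMeasurable hF.aestronglyMeasurable
  have hζ1 : ∀ t, |ζ t| ≤ 1 := fun t => by rw [abs_of_nonneg (hζ.nonneg _)]; exact hζ.le_one _
  refine (abs_integral_sub_le_of_abs_sub_le
    (hX.bdd_mul (c := M₁) hcF (Eventually.of_forall fun ω => hM₁ _))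
    (hXw.bdd_mul (c := 1 * M₁) (hcy.mul hcw) (Eventually.of_forall fun ω => ?_))
    ((((i0.const_mul (M₂ * L)).add (i1.const_mul (2 * M₁))).add (i2.const_mul M₁)).add
      (i3.const_mul M₁)) fun ω => ?_).trans ?_
  · rw [Pi.mul_apply, norm_mul]
    exact mul_le_mul (hζ1 _) (hM₁ _) (norm_nonneg _) zero_le_one
  · have e : deriv θ (F ω) * inner ℝ (D2F ω) (v ω) -
        ζ (y ω) * deriv θ (w ω) * inner ℝ (D2w ω) (v ω) =
      (deriv θ (F ω) - deriv θ (w ω)) * inner ℝ (D2F ω) (v ω) +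
      deriv θ (w ω) * (1 - ζ (y ω)) * inner ℝ (D2F ω) (v ω) -
      deriv θ (w ω) * (ζ (y ω) * inner ℝ (D2w ω - D2F ω) (v ω)) := by
      rw [inner_sub_left]; ring
    simp only [Pi.mul_apply, Pi.add_apply]
    rw [e]
    refine (abs_sub _ _).trans (add_le_add ((abs_add_le _ _).trans (add_le_add ?_ ?_)) ?_)
    · rw [abs_mul]
      set X := inner ℝ (D2F ω) (v ω)
      have a1 : |deriv θ (F ω) - deriv θ (w ω)| ≤ M₂ * ‖w ω - F ω‖ := by
        rw [Real.norm_eq_abs, abs_sub_comm (w ω)]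
        exact abs_sub_le_of_abs_deriv_le hθ.deriv.differentiable hM₂ _ _
      have a2 : |deriv θ (F ω) - deriv θ (w ω)| ≤ 2 * M₁ := by
        have := abs_sub (deriv θ (F ω)) (deriv θ (w ω))
        linarith [hM₁ (F ω), hM₁ (w ω)]
      have a3 : |X| ≤ L + max (‖X‖ - L) 0 := by
        have := le_max_left (‖X‖ - L) 0
        rw [Real.norm_eq_abs] at this ⊢
        linarith
      calc _ ≤ |deriv θ (F ω) - deriv θ (w ω)| * (L + max (‖X‖ - L) 0) := by gcongr
        _ = |deriv θ (F ω) - deriv θ (w ω)| * L +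
            |deriv θ (F ω) - deriv θ (w ω)| * max (‖X‖ - L) 0 := mul_add _ _ _
        _ ≤ (M₂ * ‖w ω - F ω‖) * L + 2 * M₁ * max (‖X‖ - L) 0 := by
            have := le_max_right (‖X‖ - L) 0
            gcongr
        _ = _ := by ring
    · rw [abs_mul, abs_mul, mul_assoc, Real.norm_eq_abs]
      gcongr
      · exact hM₁ _
      · exact h.one_sub_cutoff_le hζ ω
    · rw [abs_mul]
      gcongr
      · exact hM₁ _
      · rw [abs_mul]
        refine (mul_le_mul (hζ1 _) (abs_real_inner_le_norm _ _) (abs_nonneg _) zero_le_one).trans ?_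
        rw [one_mul]
  · rw [integral_add' (((i0.const_mul (M₂ * L)).add (i1.const_mul (2 * M₁))).add
        (i2.const_mul M₁)) (i3.const_mul M₁),
      integral_add' ((i0.const_mul (M₂ * L)).add (i1.const_mul (2 * M₁))) (i2.const_mul M₁),
      integral_add' (i0.const_mul (M₂ * L)) (i1.const_mul (2 * M₁)), integral_const_mul,
      integral_const_mul, integral_const_mul, integral_const_mul]
    gcongr
    · have h1 := hwF.integral_norm_mul_norm_le (memLp_const (μ := P) (1 : ℝ))
      simp only [norm_one, mul_one, one_pow, integral_const, probReal_univ, smul_eq_mul,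
        Real.sqrt_one] at h1
      exact h1.trans (Real.sqrt_le_iff.2 ⟨hd, h.integral_sub_sq_le⟩)
    · exact integral_cutoff_mul_le hR h.memLp_control h.integral_control_sq_le hX.norm
        fun ω => norm_nonneg _
    · refine (hD.integral_norm_mul_norm_le hv).trans ?_
      gcongr
      exact Real.sqrt_le_iff.2 ⟨hd, h.integral_deriv2_sub_sq_le⟩

lemma _root_.abs_inner_le_truncation {E : Type*} [NormedAddCommGroup E] [InnerProductSpace ℝ E]
    (S T u : E) (hL : 0 ≤ L) :
    |inner ℝ S u| ≤ |inner ℝ T u| + L * ‖S - T‖ + ‖S‖ * max (‖u‖ - L) 0 := by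
  have e : inner ℝ S u = inner ℝ T u + inner ℝ (S - T) u := by rw [inner_sub_left]; ring
  rcases le_or_gt ‖u‖ L with hu | hu
  · rw [max_eq_right (by linarith), mul_zero, add_zero, e]
    refine (abs_add_le _ _).trans (add_le_add_right ((abs_real_inner_le_norm _ _).trans ?_) _)
    rw [mul_comm]
    gcongr
  · rw [max_eq_left (by linarith)]
    have hu0 : 0 < ‖u‖ := by linarith
    set c := L / ‖u‖ with hc
    have hcu : c * ‖u‖ = L := by rw [hc]; field_simp
    have hc0 : 0 ≤ c := by positivity
    have hc1 : c ≤ 1 := by rw [hc, div_le_one hu0]; exact hu.le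
    have h1 := abs_real_inner_le_norm S u
    have h2 : |inner ℝ S u| ≤ |inner ℝ T u| + ‖S - T‖ * ‖u‖ := by
      rw [e]
      exact (abs_add_le _ _).trans (add_le_add_right (abs_real_inner_le_norm _ _) _)
    have h3 := mul_le_mul_of_nonneg_left h2 hc0
    have h4 := mul_le_mul_of_nonneg_left h1 (sub_nonneg.2 hc1)
    have h5 := mul_le_mul_of_nonneg_right hc1 (abs_nonneg (inner ℝ T u))
    rw [← hcu]
    linarith

lemma integral_cutoff_mul_abs_inner_le (h : IsLocalApprox P v F DF D2F C d w y g Dw D2w)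
    (hd : 0 ≤ d) (hv : MemLp v 2 P) (hDF : MemLp DF 2 P)
    (hJ : Integrable (fun ω => inner ℝ (hilbertTmul (DF ω) (DF ω)) (v ω)) P) (hR : 1 ≤ R)
    (hL : 0 ≤ L) (hζ : IsCutoff K R ζ) :
    ∫ ω, ζ (y ω) * |inner ℝ (hilbertTmul (Dw ω) (Dw ω)) (v ω)| ∂P ≤
      ∫ ω, |inner ℝ (hilbertTmul (DF ω) (DF ω)) (v ω)| ∂P +
        L * (d ^ 2 + 2 * (d * Real.sqrt (∫ ω, ‖DF ω‖ ^ 2 ∂P))) +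
        6 * R * (Real.sqrt C * Real.sqrt (∫ ω, max (‖v ω‖ - L) 0 ^ 2 ∂P)) := by
  have hD : MemLp (fun ω => Dw ω - DF ω) 2 P := h.memLp_deriv.sub hDF
  have hvL : MemLp (fun ω => max (‖v ω‖ - L) 0) 2 P := memLp_max_sub_zero hv.norm L
  have i1 := hD.integrable_norm_sq
  have i2 := hD.integrable_norm_mul_norm hDF
  have i3 := h.memLp_remainder.integrable_norm_mul_norm hvL
  have i4 := (i1.add (i2.const_mul 2)).const_mul L
  refine (integral_mono_of_nonneg (Eventually.of_forall fun ω => ?_)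
    ((hJ.abs.add i4).add (i3.const_mul (6 * R))) (Eventually.of_forall fun ω => ?_)).trans ?_
  · exact mul_nonneg (hζ.nonneg _) (abs_nonneg _)
  · simp only [Pi.add_apply]
    have h0 : 0 ≤ max (‖v ω‖ - L) 0 := le_max_right _ _
    have hg := h.remainder_nonneg ω
    rw [Real.norm_of_nonneg hg, Real.norm_of_nonneg h0]
    rcases lt_or_ge (2 * R) (y ω) with hy | hy
    · rw [(hζ.eq_zero _ hy).1, zero_mul]
      positivity
    have h1 := abs_inner_le_truncation (hilbertTmul (Dw ω) (Dw ω)) (hilbertTmul (DF ω) (DF ω))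
      (v ω) hL
    have h2 := norm_hilbertTmul_self_sub_le (Dw ω) (DF ω)
    have h3 : ‖Dw ω‖ ≤ ‖Dw ω - DF ω‖ + ‖DF ω‖ := by
      simpa using norm_add_le (Dw ω - DF ω) (DF ω)
    have h4 : ‖hilbertTmul (Dw ω) (Dw ω) - hilbertTmul (DF ω) (DF ω)‖ ≤
        ‖Dw ω - DF ω‖ ^ 2 + 2 * (‖Dw ω - DF ω‖ * ‖DF ω‖) := by
      nlinarith [mul_le_mul_of_nonneg_left h3 (norm_nonneg (Dw ω - DF ω))]
    have h5 : ‖hilbertTmul (Dw ω) (Dw ω)‖ ≤ 6 * R * g ω := by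
      rw [norm_hilbertTmul, ← sq]
      exact h.norm_deriv_sq_le R hR ω hy
    calc _ ≤ 1 * |inner ℝ (hilbertTmul (Dw ω) (Dw ω)) (v ω)| := by
          gcongr
          exact hζ.le_one _
      _ ≤ _ := by
          rw [one_mul]
          refine h1.trans (add_le_add (add_le_add_right (mul_le_mul_of_nonneg_left h4 hL) _) ?_)
          rw [← mul_assoc]
          exact mul_le_mul_of_nonneg_right h5 h0
  · rw [integral_add' (hJ.abs.add i4) (i3.const_mul (6 * R)), integral_add' hJ.abs i4,
      integral_const_mul, integral_const_mul, integral_add' i1 (i2.const_mul 2),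
      integral_const_mul]
    have hR0 : 0 ≤ 6 * R := by linarith
    refine add_le_add (add_le_add_right (mul_le_mul_of_nonneg_left (add_le_add
      h.integral_deriv_sub_sq_le (mul_le_mul_of_nonneg_left
        ((hD.integral_norm_mul_norm_le hDF).trans ?_) zero_le_two)) hL) _)
      (mul_le_mul_of_nonneg_left
        ((h.memLp_remainder.integral_norm_mul_norm_le hvL).trans ?_) hR0)
    · gcongr
      exact Real.sqrt_le_iff.2 ⟨hd, h.integral_deriv_sub_sq_le⟩
    · simp only [Real.norm_eq_abs, sq_abs]
      gcongr
      exact h.integral_remainder_sq_le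

lemma integral_cutoff_mul_remainder_le (h : IsLocalApprox P v F DF D2F C d w y g Dw D2w)
    (hv : MemLp v 2 P) (hR : 1 ≤ R) :
    ∫ ω, min 1 ((y ω / R) ^ 2) * g ω * ‖v ω‖ ∂P ≤
      Real.sqrt C * Real.sqrt (cutoffError P C (fun ω => ‖v ω‖ ^ 2) R) := by
  have hm : MemLp (fun ω => min 1 ((y ω / R) ^ 2) * ‖v ω‖) 2 P := by
    refine hv.norm.of_le_mul (c := 1) ?_ (Eventually.of_forall fun ω => ?_)
    · exact (aestronglyMeasurable_const.inf
        ((h.memLp_control.aestronglyMeasurable.div₀ aestronglyMeasurable_const).pow 2)).mul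
        hv.aestronglyMeasurable.norm
    · rw [norm_mul, Real.norm_of_nonneg (le_min zero_le_one (sq_nonneg _))]
      gcongr
      exact min_le_left _ _
  have h1 := h.memLp_remainder.integral_norm_mul_norm_le hm
  have e : ∀ ω, ‖g ω‖ * ‖min 1 ((y ω / R) ^ 2) * ‖v ω‖‖ =
      min 1 ((y ω / R) ^ 2) * g ω * ‖v ω‖ := fun ω => by
    rw [norm_mul, Real.norm_of_nonneg (le_min zero_le_one (sq_nonneg _)), norm_norm,
      Real.norm_of_nonneg (h.remainder_nonneg ω)]
    ring
  simp only [e] at h1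
  refine h1.trans ?_
  gcongr
  · simp only [Real.norm_eq_abs, sq_abs]
    exact h.integral_remainder_sq_le
  · refine (integral_mono hm.integrable_norm_sq (h.integrable_cutoff_mul hv.integrable_norm_sq)
      fun ω => ?_).trans (integral_cutoff_mul_le hR h.memLp_control h.integral_control_sq_le
        hv.integrable_norm_sq fun ω => sq_nonneg _)
    have h0 : 0 ≤ min 1 ((y ω / R) ^ 2) := le_min zero_le_one (sq_nonneg _)
    have h2 := min_le_left 1 ((y ω / R) ^ 2)
    beta_reduce
    rw [norm_mul, norm_norm, Real.norm_of_nonneg h0, mul_pow]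
    gcongr
    nlinarith

end IsLocalApprox

section Limit

variable {H Ω : Type*} [NormedAddCommGroup H] [InnerProductSpace ℝ H] [MeasurableSpace Ω]
  {P : Measure Ω} {W : H → Ω → ℝ} {v : Ω → HilbertTensorSq H} {F : Ω → ℝ} {DF : Ω → H}
  {D2F : Ω → HilbertTensorSq H}

/-- The approximate integration by parts formula for a smooth function of `F`. -/
theorem abs_integral_mul_sub_integral_deriv_le (hW : IsIsonormal P W) (hv : MemLp v 2 P)
    (hFv : IsDivergence2 P W v F) (hF : HasMalliavinDeriv2 P W F DF D2F)
    (hJ : Integrable (fun ω => inner ℝ (hilbertTmul (DF ω) (DF ω)) (v ω)) P)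
    {θ : ℝ → ℝ} (hθ : BoundedSmooth θ) {M₂ : ℝ} (hM₂ : ∀ t, |deriv (deriv θ) t| ≤ M₂) :
    |∫ ω, θ (F ω) * F ω ∂P - ∫ ω, deriv θ (F ω) * inner ℝ (D2F ω) (v ω) ∂P| ≤
      M₂ * ∫ ω, |inner ℝ (hilbertTmul (DF ω) (DF ω)) (v ω)| ∂P := by
  have := hW.isProbabilityMeasure
  obtain ⟨M₀, hM₀⟩ := hθ.exists_bound
  obtain ⟨M₁, hM₁⟩ := hθ.deriv.exists_bound
  have hM₂0 : 0 ≤ M₂ := (abs_nonneg _).trans (hM₂ 0)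
  obtain ⟨K, hK, hcut⟩ := exists_isCutoff
  obtain ⟨C, hC, happ⟩ := exists_isLocalApprox hW hv hFv hF
  have hX : Integrable (fun ω => inner ℝ (D2F ω) (v ω)) P :=
    hF.memLp_deriv2.integrable_inner_of_two hv
  have hFi : Integrable F P := hF.memLp.integrable one_le_two
  set J := ∫ ω, |inner ℝ (hilbertTmul (DF ω) (DF ω)) (v ω)| ∂P
  set A := |∫ ω, θ (F ω) * F ω ∂P - ∫ ω, deriv θ (F ω) * inner ℝ (D2F ω) (v ω) ∂P|
  set T : ℝ → ℝ := fun R => M₀ * cutoffError P C (fun ω => ‖F ω‖) R +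
    M₁ * cutoffError P C (fun ω => ‖inner ℝ (D2F ω) (v ω)‖) R +
    K * (6 * M₀ + 12 * M₁) * (Real.sqrt C * Real.sqrt (cutoffError P C (fun ω => ‖v ω‖ ^ 2) R))
    with hT
  set f := Real.sqrt (∫ ω, ‖F ω‖ ^ 2 ∂P)
  set f₁ := Real.sqrt (∫ ω, ‖DF ω‖ ^ 2 ∂P)
  set q := Real.sqrt (∫ ω, ‖v ω‖ ^ 2 ∂P)
  set τ : ℝ → ℝ := fun L => ∫ ω, max (‖inner ℝ (D2F ω) (v ω)‖ - L) 0 ∂P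
  set s : ℝ → ℝ := fun L => Real.sqrt (∫ ω, max (‖v ω‖ - L) 0 ^ 2 ∂P)
  have hd : ∀ R, 1 ≤ R → ∀ L, 0 ≤ L → ∀ d, 0 < d →
      A ≤ M₁ * (d * f) + M₂ * L * d + 2 * M₁ * τ L + M₁ * (d * q) +
        M₂ * (J + L * (d ^ 2 + 2 * (d * f₁)) + 6 * R * (Real.sqrt C * s L)) + T R := by
    intro R hR L hL d hd
    obtain ⟨ζ, hζ⟩ := hcut R hR
    obtain ⟨w, y, g, Dw, D2w, h⟩ := happ d hd
    have h1 := h.abs_integral_mul_sub_le hd.le hF.memLp hR hζ hθ hM₀ hM₁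
    have h2 := h.abs_integral_deriv_mul_inner_sub_le hd.le hv hF.memLp hF.memLp_deriv2 hR hL hζ hθ
      hM₁ hM₂
    have h3 := h.integral_cutoff_mul_abs_inner_le hd.le hv hF.memLp_deriv hJ hR hL hζ
    have h4 := h.integral_cutoff_mul_remainder_le hv hR
    have h5 := h.duality hθ hR hK hζ hM₀ hM₁ hM₂
    have h6 := mul_le_mul_of_nonneg_left h3 hM₂0
    have hM₀0 : 0 ≤ M₀ := (abs_nonneg _).trans (hM₀ 0)
    have hM₁0 : 0 ≤ M₁ := (abs_nonneg _).trans (hM₁ 0)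
    have h7 := mul_le_mul_of_nonneg_left h4
      (by positivity : 0 ≤ K * (6 * M₀ + 12 * M₁))
    have h8 := abs_sub_le (∫ ω, θ (F ω) * F ω ∂P) (∫ ω, θ (w ω) * ζ (y ω) * F ω ∂P)
      (∫ ω, deriv θ (F ω) * inner ℝ (D2F ω) (v ω) ∂P)
    have h9 := abs_sub_le (∫ ω, θ (w ω) * ζ (y ω) * F ω ∂P)
      (∫ ω, ζ (y ω) * deriv θ (w ω) * inner ℝ (D2w ω) (v ω) ∂P)
      (∫ ω, deriv θ (F ω) * inner ℝ (D2F ω) (v ω) ∂P)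
    rw [abs_sub_comm (∫ ω, ζ (y ω) * deriv θ (w ω) * inner ℝ (D2w ω) (v ω) ∂P)] at h9
    simp only [hT]
    linarith
  have hL : ∀ R, 1 ≤ R → ∀ L, 0 ≤ L →
      A ≤ 2 * M₁ * τ L + M₂ * (J + 6 * R * (Real.sqrt C * s L)) + T R := by
    intro R hR L hL
    have hc : Continuous fun d : ℝ => M₁ * (d * f) + M₂ * L * d + 2 * M₁ * τ L + M₁ * (d * q) +
        M₂ * (J + L * (d ^ 2 + 2 * (d * f₁)) + 6 * R * (Real.sqrt C * s L)) + T R := by fun_prop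
    have ht := (hc.tendsto 0).mono_left (nhdsWithin_le_nhds (s := Set.Ioi 0))
    have := ge_of_tendsto ht (by filter_upwards [self_mem_nhdsWithin] with d hd' using hd R hR L hL d hd')
    simpa using this
  have hτ : Tendsto τ atTop (𝓝 0) := tendsto_integral_max_sub_zero hX.norm
  have hs : Tendsto s atTop (𝓝 0) := by
    have := (tendsto_integral_max_sub_zero_sq hv.norm).sqrt
    rwa [Real.sqrt_zero] at this
  have hR : ∀ R, 1 ≤ R → A ≤ M₂ * J + T R := by
    intro R hR
    have ht : Tendsto (fun L => 2 * M₁ * τ L + M₂ * (J + 6 * R * (Real.sqrt C * s L)) + T R) atTop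
        (𝓝 (2 * M₁ * 0 + M₂ * (J + 6 * R * (Real.sqrt C * 0)) + T R)) :=
      (((hτ.const_mul _).add ((((hs.const_mul _).const_mul _).const_add _).const_mul _)).add_const _)
    have := ge_of_tendsto ht (by
      filter_upwards [eventually_ge_atTop 0] with L hL' using hL R hR L hL')
    simpa using this
  have hTt : Tendsto T atTop (𝓝 0) := by
    have h1 := (tendsto_cutoffError C hFi.norm).const_mul M₀
    have h2 := (tendsto_cutoffError C hX.norm).const_mul M₁
    have h3 := ((tendsto_cutoffError C hv.integrable_norm_sq).sqrt.const_mul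
      (Real.sqrt C)).const_mul (K * (6 * M₀ + 12 * M₁))
    have h4 := (h1.add h2).add h3
    simp only [Real.sqrt_zero, mul_zero, add_zero] at h4
    exact h4
  have := ge_of_tendsto (hTt.const_add (M₂ * J)) (by
      filter_upwards [eventually_ge_atTop 1] with R hR' using hR R hR')
  simpa using this

end Limit

section Comparison

lemma add_mul_deriv_nonneg_of_nonneg {p p' : ℝ → ℝ} (hp : ∀ x, HasDerivAt p (p' x) x) (hp0 : ∀ x, 0 ≤ p x)
    {M : ℝ} (hM : ∀ x, p x ≤ M) (hq : Antitone fun x => p' x - x * p x) {x : ℝ} (hx : 0 ≤ x) :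
    0 ≤ p x + x * p' x := by
  set q : ℝ → ℝ := fun x => p' x - x * p x with hqd
  have hpq : p' x = q x + x * p x := by simp [hqd]
  rcases le_or_gt 0 (q x) with h | h
  · rw [hpq]
    have := hp0 x
    positivity
  let r : ℝ → ℝ := fun t => (p t + q x * (t / (1 + t ^ 2))) * Real.exp (-(t ^ 2 / 2))
  have hr : ∀ t, HasDerivAt r ((q t + q x * (2 / (1 + t ^ 2) ^ 2 - 1)) *
      Real.exp (-(t ^ 2 / 2))) t := fun t => by
    have h1 : (1 + t ^ 2) ≠ 0 := by positivity
    have h2 := (hasDerivAt_id t).div (((hasDerivAt_id t).pow 2).const_add 1) h1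
    have h3 := (((hasDerivAt_id t).pow 2).div_const 2).neg.exp
    refine (((hp t).add (h2.const_mul (q x))).mul h3).congr_deriv ?_
    simp only [hqd, id, Pi.pow_apply, Pi.add_apply, Pi.div_apply, Pi.neg_apply]
    field_simp
    ring
  have hanti : AntitoneOn r (Set.Ici x) := by
    refine antitoneOn_of_deriv_nonpos (convex_Ici x)
      (fun t _ => (hr t).continuousAt.continuousWithinAt)
      (fun t _ => (hr t).differentiableAt.differentiableWithinAt) fun t ht => ?_
    rw [interior_Ici, Set.mem_Ioi] at ht
    rw [(hr t).deriv]
    refine mul_nonpos_of_nonpos_of_nonneg ?_ (Real.exp_pos _).le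
    have h1 : q t ≤ q x := hq ht.le
    have h2 : 0 ≤ 2 / (1 + t ^ 2) ^ 2 := by positivity
    nlinarith
  have hlim : Tendsto r atTop (𝓝 0) := by
    have he : Tendsto (fun t : ℝ => Real.exp (-(t ^ 2 / 2))) atTop (𝓝 0) :=
      Real.tendsto_exp_neg_atTop_nhds_zero.comp
        ((tendsto_pow_atTop two_ne_zero).atTop_div_const two_pos)
    refine squeeze_zero_norm (a := fun t => (M + |q x|) * Real.exp (-(t ^ 2 / 2))) (fun t => ?_)
      (by simpa using he.const_mul (M + |q x|))
    rw [norm_mul, Real.norm_of_nonneg (Real.exp_pos _).le]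
    gcongr
    refine (norm_add_le _ _).trans (add_le_add ?_ ?_)
    · rw [Real.norm_of_nonneg (hp0 t)]; exact hM t
    · rw [norm_mul, Real.norm_eq_abs, Real.norm_eq_abs]
      refine mul_le_of_le_one_right (abs_nonneg _) ?_
      rw [abs_div, abs_of_pos (by positivity : (0 : ℝ) < 1 + t ^ 2), div_le_one (by positivity)]
      nlinarith [sq_nonneg (|t| - 1), sq_abs t]
  have hrx : 0 ≤ r x := le_of_tendsto hlim (by
    filter_upwards [eventually_ge_atTop x] with t ht using hanti (Set.mem_Ici.2 le_rfl) ht ht)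
  have h1 : 0 ≤ p x + q x * (x / (1 + x ^ 2)) := by
    by_contra! h2
    exact absurd hrx (not_le.2 (mul_neg_of_neg_of_pos h2 (Real.exp_pos _)))
  have h2 : p x + x * p' x = (1 + x ^ 2) * (p x + q x * (x / (1 + x ^ 2))) := by
    rw [hpq]; field_simp; ring
  rw [h2]
  positivity

/-- A nonnegative bounded function `p` such that `p' - x p` is antitone satisfies
`(x p)' ≥ 0`. -/
lemma add_mul_deriv_nonneg {p p' : ℝ → ℝ} (hp : ∀ x, HasDerivAt p (p' x) x) (hp0 : ∀ x, 0 ≤ p x)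
    {M : ℝ} (hM : ∀ x, p x ≤ M) (hq : Antitone fun x => p' x - x * p x) (x : ℝ) :
    0 ≤ p x + x * p' x := by
  rcases le_total 0 x with hx | hx
  · exact add_mul_deriv_nonneg_of_nonneg hp hp0 hM hq hx
  · have := add_mul_deriv_nonneg_of_nonneg (p := fun t => p (-t)) (p' := fun t => -p' (-t)) (x := -x)
      (fun t => by
        have := (hp (-t)).comp t (hasDerivAt_neg t)
        rw [mul_neg_one] at this
        exact this) (fun t => hp0 _) (M := M)
      (fun t => hM _) (fun s t hst => by
        have := hq (neg_le_neg hst)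
        beta_reduce at this ⊢
        linarith) (by linarith)
    simpa using this

lemma abs_add_mul_deriv_le_one {p p' k : ℝ → ℝ} (hp : ∀ x, HasDerivAt p (p' x) x)
    (hp1 : ∀ x, |p x| ≤ 1) (hk : ∀ x, |k x| ≤ 1)
    (hq : ∀ x, HasDerivAt (fun x => p' x - x * p x) (-k x) x) (x : ℝ) :
    |p x + x * p' x| ≤ 1 := by
  have anti : ∀ {f f' : ℝ → ℝ}, (∀ x, HasDerivAt f (f' x) x) → (∀ x, f' x ≤ 0) → Antitone f :=
    fun hf hf' => antitone_of_deriv_nonpos (fun x => (hf x).differentiableAt)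
      fun x => by rw [(hf x).deriv]; exact hf' x
  have h1 := add_mul_deriv_nonneg (p := fun x => 1 + p x) (p' := p') (M := 2)
    (fun x => (hp x).const_add 1) (fun x => by linarith [neg_le_of_abs_le (hp1 x)])
    (fun x => by linarith [le_of_abs_le (hp1 x)])
    (anti (f' := fun x => -k x - 1) (fun x => by
      refine ((hq x).sub (hasDerivAt_id x)).congr_of_eventuallyEq
        (Eventually.of_forall fun t => ?_)
      simp only [Pi.sub_apply, id]
      ring) fun x => by linarith [neg_le_of_abs_le (hk x)]) x
  have h2 := add_mul_deriv_nonneg (p := fun x => 1 - p x) (p' := fun x => -p' x) (M := 2)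
    (fun x => (hp x).const_sub 1) (fun x => by linarith [le_of_abs_le (hp1 x)])
    (fun x => by linarith [neg_le_of_abs_le (hp1 x)])
    (anti (f' := fun x => k x - 1) (fun x => by
      refine (((hq x).neg.sub (hasDerivAt_id x)).congr_of_eventuallyEq
        (Eventually.of_forall fun t => ?_)).congr_deriv (by ring)
      simp only [Pi.sub_apply, Pi.neg_apply, id]
      ring) fun x => by linarith [le_of_abs_le (hk x)]) x
  exact abs_le.2 ⟨by linarith, by linarith⟩

end Comparison

section GaussianAbs

lemma integral_abs_gaussianReal : ∫ x, |x| ∂(gaussianReal 0 1) = Real.sqrt (2 / Real.pi) := by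
  rw [integral_gaussianReal_eq_integral_smul one_ne_zero]
  have h0 : ∀ x, gaussianPDFReal 0 1 x • |x| = gaussianPDFReal 0 1 |x| * |x| := fun x => by
    simp [gaussianPDFReal]
  simp only [h0]
  rw [integral_comp_abs (f := fun x => gaussianPDFReal 0 1 x * x)]
  have hlim : Tendsto (fun x => -gaussianPDFReal 0 1 x) atTop (𝓝 0) := by
    have he : Tendsto (fun t : ℝ => Real.exp (-(t ^ 2 / 2))) atTop (𝓝 0) :=
      Real.tendsto_exp_neg_atTop_nhds_zero.comp
        ((tendsto_pow_atTop two_ne_zero).atTop_div_const two_pos)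
    have := (he.const_mul (√(2 * Real.pi * 1))⁻¹).neg
    simpa [gaussianPDFReal, neg_div] using this
  have hint : IntegrableOn (fun x => gaussianPDFReal 0 1 x * x) (Set.Ioi 0) := by
    have h := (integrable_gaussianReal_iff one_ne_zero (g := fun x => x)).1
      ((memLp_id_gaussianReal (μ := 0) (v := 1) 1).integrable le_rfl)
    exact h.integrableOn
  rw [integral_Ioi_of_hasDerivAt_of_tendsto (f := fun x => -gaussianPDFReal 0 1 x) (m := 0)
    (hasDerivAt_gaussianPDFReal one_ne_zero 0).neg.continuousAt.continuousWithinAt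
    (fun x _ => (hasDerivAt_gaussianPDFReal one_ne_zero x).neg.congr_deriv (by simp; ring))
    hint hlim]
  simp only [gaussianPDFReal, NNReal.coe_one, mul_one, sub_self, ne_eq, OfNat.ofNat_ne_zero,
    not_false_eq_true, zero_pow, neg_zero, zero_div, Real.exp_zero, sub_neg_eq_add, zero_add]
  rw [Real.sqrt_mul zero_le_two, Real.sqrt_div zero_le_two]
  field_simp
  rw [Real.sq_sqrt zero_le_two]

end GaussianAbs

section Stein

/-- The solution of Stein's equation, up to sign, written with the Mehler formula. -/
noncomputable def steinSolution (k : ℝ → ℝ) (x : ℝ) : ℝ :=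
  ∫ z : ℝ × ℝ, Real.cos z.1 • k (Real.sin z.1 • x + Real.cos z.1 • z.2)
    ∂((volume.restrict (Set.Ioc 0 (Real.pi / 2))).prod (gaussianReal 0 1))

variable {k : ℝ → ℝ} (hk : BoundedSmooth k)

include hk in
lemma BoundedSmooth.steinSolution : BoundedSmooth (steinSolution k) :=
  BoundedSmooth.integral_affine (a := fun z : ℝ × ℝ => Real.sin z.1)
    (b := fun z : ℝ × ℝ => Real.cos z.1 • z.2) (c := fun z : ℝ × ℝ => Real.cos z.1)
    (by fun_prop) (by fun_prop) (by fun_prop)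
    (fun _ => Real.abs_sin_le_one _) (fun _ => Real.abs_cos_le_one _) hk

include hk in
lemma steinSolution_eq (x : ℝ) : steinSolution k x = ∫ θ in (0 : ℝ)..(Real.pi / 2),
    Real.cos θ * ∫ y, k (Real.sin θ * x + Real.cos θ * y) ∂(gaussianReal 0 1) := by
  have hi := BoundedSmooth.integrable_affine
    (ν := (volume.restrict (Set.Ioc 0 (Real.pi / 2))).prod (gaussianReal 0 1))
    (a := fun z : ℝ × ℝ => Real.sin z.1)
    (b := fun z : ℝ × ℝ => Real.cos z.1 • z.2) (c := fun z : ℝ × ℝ => Real.cos z.1)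
    (by fun_prop) (by fun_prop) (by fun_prop) (fun _ => Real.abs_cos_le_one _) hk x
  rw [steinSolution, integral_prod _ hi, intervalIntegral.integral_of_le (by positivity)]
  simp only [smul_eq_mul, integral_const_mul]

lemma integral_cos_mul_deriv_gaussianReal {k : ℝ → ℝ} (hk : BoundedSmooth k) (x θ : ℝ) :
    ∫ y, y * k (Real.sin θ * x + Real.cos θ * y) ∂(gaussianReal 0 1) =
      ∫ y, Real.cos θ * deriv k (Real.sin θ * x + Real.cos θ * y) ∂(gaussianReal 0 1) := by
  have hkc := hk.continuous
  have hdc := hk.deriv.continuous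
  obtain ⟨C, hC⟩ := hk.exists_bound
  obtain ⟨D, hD⟩ := hk.deriv.exists_bound
  have i0 : Integrable (fun y => k (Real.sin θ * x + Real.cos θ * y)) (gaussianReal 0 1) :=
    Integrable.of_bound (C := C) (Continuous.aestronglyMeasurable (by fun_prop))
      (Eventually.of_forall fun y => hC _)
  have i1 : Integrable (fun y => deriv k (Real.sin θ * x + Real.cos θ * y)) (gaussianReal 0 1) :=
    Integrable.of_bound (C := D) (Continuous.aestronglyMeasurable (by fun_prop))
      (Eventually.of_forall fun y => hD _)
  have i2 : Integrable (fun y : ℝ => y) (gaussianReal 0 1) :=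
    (memLp_id_gaussianReal (μ := 0) (v := 1) 1).integrable le_rfl
  have := integral_id_mul_gaussianReal (v := 1) one_ne_zero
    (g := fun y => k (Real.sin θ * x + Real.cos θ * y))
    (g' := fun y => Real.cos θ * deriv k (Real.sin θ * x + Real.cos θ * y)) (fun y => by
      have h1 : HasDerivAt (fun y => Real.sin θ * x + Real.cos θ * y) (Real.cos θ) y := by
        simpa using ((hasDerivAt_id y).const_mul (Real.cos θ)).const_add (Real.sin θ * x)
      have h2 := ((hk.differentiable _).hasDerivAt.comp y h1)
      rw [mul_comm (deriv k _)] at h2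
      exact h2) i0 (i1.const_mul _)
    (i2.mul_bdd (c := C) i0.aestronglyMeasurable (Eventually.of_forall fun y => hC _))
  simpa using this

include hk in
lemma deriv_steinSolution (x : ℝ) : deriv (steinSolution k) x = ∫ θ in (0 : ℝ)..(Real.pi / 2),
    Real.sin θ * ∫ y, y * k (Real.sin θ * x + Real.cos θ * y) ∂(gaussianReal 0 1) := by
  have hcs : ∀ z : ℝ × ℝ, |Real.cos z.1 * Real.sin z.1| ≤ 1 := fun z => by
    rw [abs_mul]
    exact mul_le_one₀ (Real.abs_cos_le_one _) (abs_nonneg _) (Real.abs_sin_le_one _)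
  have h := BoundedSmooth.hasFDerivAt_integral_affine
    (ν := (volume.restrict (Set.Ioc 0 (Real.pi / 2))).prod (gaussianReal 0 1))
    (a := fun z : ℝ × ℝ => Real.sin z.1)
    (b := fun z : ℝ × ℝ => Real.cos z.1 • z.2) (c := fun z : ℝ × ℝ => Real.cos z.1)
    (by fun_prop) (by fun_prop) (by fun_prop)
    (fun _ => Real.abs_sin_le_one _) (fun _ => Real.abs_cos_le_one _) hk x
  have hi := BoundedSmooth.integrable_affine
    (ν := (volume.restrict (Set.Ioc 0 (Real.pi / 2))).prod (gaussianReal 0 1))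
    (a := fun z : ℝ × ℝ => Real.sin z.1)
    (b := fun z : ℝ × ℝ => Real.cos z.1 • z.2) (c := fun z : ℝ × ℝ => Real.cos z.1 * Real.sin z.1)
    (by fun_prop) (by fun_prop) (by fun_prop) hcs hk.fderiv x
  have hi' := BoundedSmooth.integrable_affine
    (ν := (volume.restrict (Set.Ioc 0 (Real.pi / 2))).prod (gaussianReal 0 1))
    (a := fun z : ℝ × ℝ => Real.sin z.1)
    (b := fun z : ℝ × ℝ => Real.cos z.1 • z.2) (c := fun z : ℝ × ℝ => Real.cos z.1 * Real.sin z.1)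
    (by fun_prop) (by fun_prop) (by fun_prop) hcs hk.deriv x
  have e : deriv (steinSolution k) x = ∫ z : ℝ × ℝ, (Real.cos z.1 * Real.sin z.1) •
      deriv k (Real.sin z.1 • x + Real.cos z.1 • z.2)
      ∂((volume.restrict (Set.Ioc 0 (Real.pi / 2))).prod (gaussianReal 0 1)) := by
    have h2 := h.hasDerivAt
    rw [ContinuousLinearMap.integral_apply hi] at h2
    simp only [_root_.smul_apply, fderiv_apply_one_eq_deriv] at h2
    exact h2.deriv
  rw [e, integral_prod _ hi', intervalIntegral.integral_of_le (by positivity)]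
  refine integral_congr_ae (Eventually.of_forall fun θ => ?_)
  beta_reduce
  rw [integral_cos_mul_deriv_gaussianReal hk, ← integral_const_mul]
  refine integral_congr_ae (Eventually.of_forall fun y => ?_)
  simp only [smul_eq_mul]
  ring

include hk in
lemma continuous_integral_mul_rotation (x : ℝ) : Continuous fun θ =>
    ∫ y, y * k (Real.sin θ * x + Real.cos θ * y) ∂(gaussianReal 0 1) := by
  obtain ⟨C, hC⟩ := hk.exists_bound
  have hkc := hk.continuous
  refine continuous_of_dominated (bound := fun y => |y| * C)
    (fun θ => Continuous.aestronglyMeasurable (by fun_prop))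
    (fun θ => Eventually.of_forall fun y => ?_) ?_ (Eventually.of_forall fun y => by fun_prop)
  · rw [norm_mul, Real.norm_eq_abs y]
    gcongr
    exact hC _
  · exact (((memLp_id_gaussianReal (μ := 0) (v := 1) 1).integrable le_rfl).abs).mul_const C

include hk in
lemma continuous_integral_rotation_gaussianReal (x : ℝ) : Continuous fun θ =>
    ∫ y, k (Real.sin θ * x + Real.cos θ * y) ∂(gaussianReal 0 1) := by
  obtain ⟨C, hC⟩ := hk.exists_bound
  have hkc := hk.continuous
  exact continuous_of_dominated (bound := fun y => C)
    (fun θ => Continuous.aestronglyMeasurable (by fun_prop))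
    (fun θ => Eventually.of_forall fun y => hC _) (integrable_const C)
    (Eventually.of_forall fun y => by fun_prop)

lemma abs_steinSolution_le_one {k : ℝ → ℝ} (hk : BoundedSmooth k) (hk1 : ∀ x, |k x| ≤ 1) (x : ℝ) :
    |steinSolution k x| ≤ 1 := by
  rw [steinSolution_eq hk, ← Real.norm_eq_abs]
  refine (intervalIntegral.norm_integral_le_of_norm_le (μ := volume) (g := Real.cos) Real.pi_div_two_pos.le
    (Eventually.of_forall fun θ hθ => ?_) (Real.continuous_cos.intervalIntegrable _ _)).trans ?_
  · have hc : 0 ≤ Real.cos θ := Real.cos_nonneg_of_mem_Icc ⟨by linarith [hθ.1, Real.pi_pos], hθ.2⟩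
    rw [norm_mul, Real.norm_of_nonneg hc]
    refine mul_le_of_le_one_right hc ?_
    have := norm_integral_le_of_norm_le_const (μ := gaussianReal 0 1) (C := 1)
      (f := fun y => k (Real.sin θ * x + Real.cos θ * y)) (Eventually.of_forall fun y => hk1 _)
    simpa using this
  · simp

lemma abs_deriv_steinSolution_le {k : ℝ → ℝ} (hk : BoundedSmooth k) (hk1 : ∀ x, |k x| ≤ 1)
    (x : ℝ) : |deriv (steinSolution k) x| ≤ Real.sqrt (2 / Real.pi) := by
  rw [deriv_steinSolution hk, ← Real.norm_eq_abs]
  refine (intervalIntegral.norm_integral_le_of_norm_le (μ := volume)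
    (g := fun θ => Real.sin θ * Real.sqrt (2 / Real.pi)) Real.pi_div_two_pos.le
    (Eventually.of_forall fun θ hθ => ?_)
    ((Real.continuous_sin.mul continuous_const).intervalIntegrable _ _)).trans ?_
  · have hs : 0 ≤ Real.sin θ := Real.sin_nonneg_of_mem_Icc
      ⟨hθ.1.le, by linarith [hθ.2, Real.pi_pos]⟩
    rw [norm_mul, Real.norm_of_nonneg hs]
    refine mul_le_mul_of_nonneg_left ?_ hs
    rw [← integral_abs_gaussianReal]
    refine norm_integral_le_of_norm_le
      (((memLp_id_gaussianReal (μ := 0) (v := 1) 1).integrable le_rfl).abs)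
      (Eventually.of_forall fun y => ?_)
    rw [norm_mul, Real.norm_eq_abs]
    exact mul_le_of_le_one_right (abs_nonneg y) (hk1 _)
  · simp

lemma deriv_steinSolution_sub {h : ℝ → ℝ} (hh : ContDiff ℝ 1 h) (hk : BoundedSmooth (deriv h))
    (x : ℝ) : x * steinSolution (deriv h) x - deriv (steinSolution (deriv h)) x =
      h x - ∫ y, h y ∂(gaussianReal 0 1) := by
  obtain ⟨C, hC⟩ := hk.exists_bound
  have hid : Integrable (fun y : ℝ => y) (gaussianReal 0 1) :=
    (memLp_id_gaussianReal (μ := 0) (v := 1) 1).integrable le_rfl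
  have h1 := integral_fderiv_rotation (P := gaussianReal 0 1) (X := fun y : ℝ => y)
    stronglyMeasurable_id hid hh (C := C) (fun x => by
      rw [← norm_deriv_eq_norm_fderiv]; exact hC x) x
  rw [← h1, steinSolution_eq hk, deriv_steinSolution hk, ← intervalIntegral.integral_const_mul,
    ← intervalIntegral.integral_sub]
  · refine intervalIntegral.integral_congr fun θ _ => ?_
    have hkc := hk.continuous
    have i0 : Integrable (fun y => deriv h (Real.sin θ * x + Real.cos θ * y))
        (gaussianReal 0 1) := Integrable.of_bound (C := C)
      (Continuous.aestronglyMeasurable (by fun_prop)) (Eventually.of_forall fun y => hC _)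
    have i1 : Integrable (fun y => y * deriv h (Real.sin θ * x + Real.cos θ * y))
        (gaussianReal 0 1) :=
      hid.mul_bdd (c := C) i0.aestronglyMeasurable (Eventually.of_forall fun y => hC _)
    rw [← integral_const_mul, ← integral_const_mul, ← integral_const_mul, ← integral_sub
      ((i0.const_mul _).const_mul _) (i1.const_mul _)]
    refine integral_congr_ae (Eventually.of_forall fun y => ?_)
    simp only [smul_eq_mul, fderiv_eq_smul_deriv]
    ring
  · exact (continuous_const.mul (Real.continuous_cos.mul
      (continuous_integral_rotation_gaussianReal hk x))).intervalIntegrable _ _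
  · exact (Real.continuous_sin.mul (continuous_integral_mul_rotation hk x)).intervalIntegrable _ _

/-- Stein's equation for a smooth `1`-Lipschitz function. -/
theorem exists_stein_solution {h : ℝ → ℝ} (hh : ContDiff ℝ 1 h) (hk : BoundedSmooth (deriv h))
    (hk1 : ∀ x, |deriv h x| ≤ 1) :
    ∃ f : ℝ → ℝ, BoundedSmooth f ∧
      (∀ x, deriv f x - x * f x = h x - ∫ y, h y ∂(gaussianReal 0 1)) ∧
      (∀ x, |deriv f x| ≤ Real.sqrt (2 / Real.pi)) ∧ ∀ x, |deriv (deriv f) x| ≤ 2 := by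
  set p := steinSolution (deriv h) with hp
  have hpS : BoundedSmooth p := hk.steinSolution
  have hd : deriv (fun x => -p x) = fun x => -deriv p x := funext fun x => by
    rw [deriv.fun_neg]
  have hp1 : ∀ x, HasDerivAt p (deriv p x) x := fun x => (hpS.differentiable x).hasDerivAt
  have hp2 : ∀ x, HasDerivAt (deriv p) (deriv (deriv p) x) x :=
    fun x => (hpS.deriv.differentiable x).hasDerivAt
  have hq : ∀ x, HasDerivAt (fun x => deriv p x - x * p x) (-deriv h x) x := fun x => by
    have e : (fun x => deriv p x - x * p x) = fun x => ∫ y, h y ∂(gaussianReal 0 1) - h x :=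
      funext fun x => by
        have := deriv_steinSolution_sub hh hk x
        linarith
    rw [e]
    exact ((hh.differentiable (by simp)) x).hasDerivAt.const_sub _
  refine ⟨fun x => -p x, hpS.neg, fun x => ?_, fun x => ?_, fun x => ?_⟩
  · rw [hd, ← deriv_steinSolution_sub hh hk x]
    ring
  · rw [hd, abs_neg]
    exact abs_deriv_steinSolution_le hk hk1 x
  · rw [hd, deriv.fun_neg, abs_neg]
    have h1 := abs_add_mul_deriv_le_one hp1 (abs_steinSolution_le_one hk hk1) hk1 hq x
    have h2 := (hq x).unique ((hp2 x).sub ((hasDerivAt_id x).mul (hp1 x)))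
    have h3 : deriv (deriv p) x = (p x + x * deriv p x) + -deriv h x := by
      simp only [id, one_mul] at h2
      linarith
    rw [h3]
    refine (abs_add_le _ _).trans ?_
    rw [abs_neg]
    linarith [hk1 x]

end Stein

section Mollification

/-- Lipschitz functions are uniform limits of smooth Lipschitz functions with the same constant,
whose derivatives are bounded to all orders. -/
theorem exists_smooth_lipschitz_approx {h : ℝ → ℝ} (hh : LipschitzWith 1 h) {ε : ℝ} (hε : 0 < ε) :
    ∃ g : ℝ → ℝ, ContDiff ℝ 1 g ∧ BoundedSmooth (deriv g) ∧ (∀ x, |deriv g x| ≤ 1) ∧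
      ∀ x, |g x - h x| ≤ ε := by
  let χ : ContDiffBump (0 : ℝ) := ⟨ε / 2, ε, by positivity, by linarith⟩
  have hhl : LocallyIntegrable h := hh.continuous.locallyIntegrable
  let T : (ℝ → ℝ) → ℝ → ℝ := fun ρ => convolution ρ h (ContinuousLinearMap.lsmul ℝ ℝ) volume
  have hT : ∀ {ρ : ℝ → ℝ}, ContDiff ℝ 1 ρ → HasCompactSupport ρ → ∀ x,
      HasDerivAt (T ρ) (T (deriv ρ) x) x := fun hρ hc x =>
    hc.hasDerivAt_convolution_left _ hρ hhl x
  have hlip : ∀ {ρ : ℝ → ℝ}, Continuous ρ → HasCompactSupport ρ → ∀ x y,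
      |T ρ x - T ρ y| ≤ (∫ t, |ρ t|) * |x - y| := by
    intro ρ hρ hc x y
    have i : ∀ x, Integrable (fun t => ρ t • h (x - t)) := fun x =>
      hc.convolutionExists_left (μ := volume) (ContinuousLinearMap.lsmul ℝ ℝ) hρ hhl x
    have e : T ρ x - T ρ y = ∫ t, (ρ t • h (x - t) - ρ t • h (y - t)) :=
      (integral_sub (i x) (i y)).symm
    rw [e, ← integral_mul_const, ← Real.norm_eq_abs]
    refine norm_integral_le_of_norm_le
      ((hρ.integrable_of_hasCompactSupport (μ := volume) hc).abs.mul_const _) (Eventually.of_forall fun t => ?_)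
    rw [← smul_sub, norm_smul, Real.norm_eq_abs]
    gcongr
    have := hh.dist_le_mul (x - t) (y - t)
    simpa [Real.dist_eq] using this
  have hderiv : ∀ {ρ : ℝ → ℝ}, Continuous ρ → HasCompactSupport ρ → ∀ x,
      |deriv (T ρ) x| ≤ ∫ t, |ρ t| := fun {ρ} hρ hc x =>
    norm_deriv_le_of_lip' (f := T ρ) (integral_nonneg fun t => abs_nonneg _)
      (Eventually.of_forall fun y => hlip hρ hc y x)
  have hiter : ∀ n : ℕ, ∀ ρ : ℝ → ℝ, ContDiff ℝ (⊤ : ℕ∞) ρ → HasCompactSupport ρ →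
      ∃ C, ∀ x, |iteratedDeriv n (deriv (T ρ)) x| ≤ C := by
    intro n
    induction n with
    | zero => exact fun ρ hρ hc => ⟨_, fun x => by simpa using hderiv hρ.continuous hc x⟩
    | succ n ih =>
      intro ρ hρ hc
      have e : deriv (T ρ) = T (deriv ρ) :=
        funext fun x => (hT (hρ.of_le (by exact_mod_cast le_top)) hc x).deriv
      rw [iteratedDeriv_succ', e]
      exact ih _ (contDiff_infty_iff_deriv.1 hρ).2 hc.deriv
  have hρ : ContDiff ℝ (⊤ : ℕ∞) (χ.normed volume) := χ.contDiff_normed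
  have hc : HasCompactSupport (χ.normed volume) := χ.hasCompactSupport_normed
  have hsm : ContDiff ℝ (⊤ : ℕ∞) (T (χ.normed volume)) :=
    hc.contDiff_convolution_left _ hρ hhl
  refine ⟨T (χ.normed volume), hsm.of_le (by exact_mod_cast le_top),
    ⟨(contDiff_infty_iff_deriv.1 hsm).2, fun n => ?_⟩, fun x => ?_, fun x => ?_⟩
  · obtain ⟨C, hC⟩ := hiter n _ hρ hc
    exact ⟨C, fun x => by rw [norm_iteratedFDeriv_eq_norm_iteratedDeriv]; exact hC x⟩
  · refine (hderiv hρ.continuous hc x).trans (le_of_eq ?_)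
    simp only [abs_of_nonneg (χ.nonneg_normed _)]
    exact χ.integral_normed
  · refine χ.dist_normed_convolution_le hh.continuous.aestronglyMeasurable fun y hy => ?_
    have := hh.dist_le_mul y x
    rw [NNReal.coe_one, one_mul] at this
    exact this.trans (le_of_lt hy)

end Mollification

section Final

variable {H Ω : Type*} [NormedAddCommGroup H] [InnerProductSpace ℝ H] [MeasurableSpace Ω]
  {P : Measure Ω} {W : H → Ω → ℝ} {v : Ω → HilbertTensorSq H} {F : Ω → ℝ} {DF : Ω → H}
  {D2F : Ω → HilbertTensorSq H}

lemma LipschitzWith.integrable_comp [IsFiniteMeasure P] {h : ℝ → ℝ} (hh : LipschitzWith 1 h)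
    (hF : Integrable F P) : Integrable (fun ω => h (F ω)) P := by
  refine Integrable.mono' (g := fun ω => |h 0| + |F ω|) ((integrable_const _).add hF.abs)
    (hh.continuous.comp_aestronglyMeasurable hF.aestronglyMeasurable)
    (Eventually.of_forall fun ω => ?_)
  have h1 := hh.dist_le_mul (F ω) 0
  rw [Real.dist_eq, Real.dist_eq, NNReal.coe_one, one_mul, sub_zero] at h1
  have h2 := abs_sub_abs_le_abs_sub (h (F ω)) (h 0)
  rw [Real.norm_eq_abs]
  linarith

lemma abs_integral_comp_sub_le [IsProbabilityMeasure P] {h g : ℝ → ℝ} (hh : LipschitzWith 1 h)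
    (hg : LipschitzWith 1 g) {ε : ℝ} (hgh : ∀ x, |g x - h x| ≤ ε) (hF : Integrable F P) :
    |∫ ω, h (F ω) ∂P - ∫ ω, g (F ω) ∂P| ≤ ε := by
  have := abs_integral_sub_le_of_abs_sub_le (hh.integrable_comp hF) (hg.integrable_comp hF)
    (integrable_const ε) fun ω => by rw [abs_sub_comm]; exact hgh _
  simpa using this

lemma lintegral_enorm_sub_mean_le [IsProbabilityMeasure P] {X : Ω → ℝ}
    (hX : AEStronglyMeasurable X P) :
    ∫⁻ ω, ‖X ω - ∫ ω, X ω ∂P‖ₑ ∂P ≤ evariance X P ^ (1 / 2 : ℝ) := by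
  have h := eLpNorm_le_eLpNorm_of_exponent_le (μ := P) (p := 1) (q := 2)
    (f := fun ω => X ω - ∫ ω, X ω ∂P) one_le_two (hX.sub aestronglyMeasurable_const)
  rw [eLpNorm_one_eq_lintegral_enorm,
    eLpNorm_eq_lintegral_rpow_enorm_toReal (by simp) (by simp)] at h
  simpa [evariance] using h

lemma abs_integral_sub_integral_smooth_le (hW : IsIsonormal P W) (hv : MemLp v 2 P)
    (hFv : IsDivergence2 P W v F) (hF : HasMalliavinDeriv2 P W F DF D2F)
    (hJ : Integrable (fun ω => inner ℝ (hilbertTmul (DF ω) (DF ω)) (v ω)) P)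
    {g : ℝ → ℝ} (hg : ContDiff ℝ 1 g) (hg' : BoundedSmooth (deriv g))
    (hg1 : ∀ x, |deriv g x| ≤ 1) (hgF : Integrable (fun ω => g (F ω)) P) :
    |∫ ω, g (F ω) ∂P - ∫ x, g x ∂(gaussianReal 0 1)| ≤
      Real.sqrt (2 / Real.pi) * ∫ ω, |inner ℝ (D2F ω) (v ω) - 1| ∂P +
        2 * ∫ ω, |inner ℝ (hilbertTmul (DF ω) (DF ω)) (v ω)| ∂P := by
  have := hW.isProbabilityMeasure
  obtain ⟨f, hf, hfe, hf1, hf2⟩ := exists_stein_solution hg hg' hg1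
  have hX : Integrable (fun ω => inner ℝ (D2F ω) (v ω)) P :=
    hF.memLp_deriv2.integrable_inner_of_two hv
  have hFi : Integrable F P := hF.memLp.integrable one_le_two
  obtain ⟨C, hC⟩ := hf.exists_bound
  have hcf := hf.continuous.comp_aestronglyMeasurable hF.memLp.aestronglyMeasurable
  have hcf' := hf.deriv.continuous.comp_aestronglyMeasurable hF.memLp.aestronglyMeasurable
  have i1 : Integrable (fun ω => deriv f (F ω)) P :=
    Integrable.of_bound (C := Real.sqrt (2 / Real.pi)) hcf' (Eventually.of_forall fun ω => hf1 _)
  have i2 : Integrable (fun ω => f (F ω) * F ω) P :=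
    hFi.bdd_mul (c := C) hcf (Eventually.of_forall fun ω => hC _)
  have i3 : Integrable (fun ω => deriv f (F ω) * inner ℝ (D2F ω) (v ω)) P :=
    hX.bdd_mul (c := Real.sqrt (2 / Real.pi)) hcf' (Eventually.of_forall fun ω => hf1 _)
  have e1 : ∫ ω, g (F ω) ∂P - ∫ x, g x ∂(gaussianReal 0 1) =
      ∫ ω, deriv f (F ω) ∂P - ∫ ω, f (F ω) * F ω ∂P := by
    rw [← integral_sub i1 i2]
    have : ∀ ω, deriv f (F ω) - f (F ω) * F ω = g (F ω) - ∫ x, g x ∂(gaussianReal 0 1) :=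
      fun ω => by rw [mul_comm]; exact hfe _
    simp only [this]
    rw [integral_sub hgF (integrable_const _)]
    simp
  have h1 := abs_integral_mul_sub_integral_deriv_le hW hv hFv hF hJ hf hf2
  have h2 := abs_integral_sub_le_of_abs_sub_le i1 i3
    ((hX.sub (integrable_const 1)).abs.const_mul (Real.sqrt (2 / Real.pi))) fun ω => by
      rw [show deriv f (F ω) - deriv f (F ω) * inner ℝ (D2F ω) (v ω) =
        deriv f (F ω) * (1 - inner ℝ (D2F ω) (v ω)) by ring, abs_mul,
        abs_sub_comm (1 : ℝ)]
      exact mul_le_mul_of_nonneg_right (hf1 _) (abs_nonneg _)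
  rw [integral_const_mul] at h2
  rw [e1]
  have h3 := abs_sub_le (∫ ω, deriv f (F ω) ∂P)
    (∫ ω, deriv f (F ω) * inner ℝ (D2F ω) (v ω) ∂P) (∫ ω, f (F ω) * F ω ∂P)
  rw [abs_sub_comm (∫ ω, deriv f (F ω) * inner ℝ (D2F ω) (v ω) ∂P)] at h3
  exact h3.trans (add_le_add h2 h1)

theorem abs_integral_sub_integral_lipschitz_le (hW : IsIsonormal P W) (hv : MemLp v 2 P)
    (hFv : IsDivergence2 P W v F) (hF : HasMalliavinDeriv2 P W F DF D2F)
    (hJ : Integrable (fun ω => inner ℝ (hilbertTmul (DF ω) (DF ω)) (v ω)) P)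
    {h : ℝ → ℝ} (hh : LipschitzWith 1 h) :
    |∫ ω, h (F ω) ∂P - ∫ x, h x ∂(gaussianReal 0 1)| ≤
      Real.sqrt (2 / Real.pi) * ∫ ω, |inner ℝ (D2F ω) (v ω) - 1| ∂P +
        2 * ∫ ω, |inner ℝ (hilbertTmul (DF ω) (DF ω)) (v ω)| ∂P := by
  have := hW.isProbabilityMeasure
  have hFi : Integrable F P := hF.memLp.integrable one_le_two
  refine le_of_forall_pos_le_add fun ε hε => ?_
  obtain ⟨g, hg, hg', hg1, hgh⟩ := exists_smooth_lipschitz_approx hh (half_pos hε)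
  have hgL : LipschitzWith 1 g := by
    refine lipschitzWith_of_nnnorm_deriv_le (hg.differentiable (by simp)) fun x => ?_
    exact hg1 x
  have h1 := abs_integral_comp_sub_le hh hgL hgh hFi
  have h2 := abs_integral_comp_sub_le hh hgL hgh ((memLp_id_gaussianReal (μ := 0) (v := 1) 1).integrable le_rfl)
  have h3 := abs_integral_sub_integral_smooth_le hW hv hFv hF hJ hg hg' hg1
    (hgL.integrable_comp hFi)
  simp only [id] at h2
  rw [abs_le] at h1 h2 h3 ⊢
  constructor <;> linarith [h1.1, h1.2, h2.1, h2.2, h3.1, h3.2]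

end Final

theorem proposition3 {H Ω : Type*} [NormedAddCommGroup H] [InnerProductSpace ℝ H]
    [CompleteSpace H] [TopologicalSpace.SeparableSpace H]
    [MeasurableSpace Ω] (P : Measure Ω) [IsProbabilityMeasure P]
    (W : H → Ω → ℝ) (hW : IsIsonormal P W)
    (v : Ω → HilbertTensorSq H) (F : Ω → ℝ) (DF : Ω → H) (D2F : Ω → HilbertTensorSq H)
    (hv : MemDomDivergence2 P W v) (hFv : IsDivergence2 P W v F)
    (hF : HasMalliavinDeriv2 P W F DF D2F) (hF1 : ∫ ω, F ω ^ 2 ∂P = 1) :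
    wassersteinDist (P.map F) (gaussianReal 0 1) ≤
      ENNReal.ofReal (Real.sqrt (2 / Real.pi)) *
          (evariance (fun ω => inner ℝ (D2F ω) (v ω)) P) ^ (1 / 2 : ℝ) +
        2 * ∫⁻ ω, ‖inner ℝ (hilbertTmul (DF ω) (DF ω)) (v ω)‖ₑ ∂P := by
  have hvm := hv.1
  have hJm : AEStronglyMeasurable (fun ω => inner ℝ (hilbertTmul (DF ω) (DF ω)) (v ω)) P :=
    (continuous_hilbertTmul.comp_aestronglyMeasurable
      (hF.memLp_deriv.aestronglyMeasurable.prodMk hF.memLp_deriv.aestronglyMeasurable)).inner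
      hvm.aestronglyMeasurable
  rcases eq_or_ne (∫⁻ ω, ‖inner ℝ (hilbertTmul (DF ω) (DF ω)) (v ω)‖ₑ ∂P) ⊤ with hJ | hJ
  · rw [hJ]
    simp
  have hJi : Integrable (fun ω => inner ℝ (hilbertTmul (DF ω) (DF ω)) (v ω)) P :=
    ⟨hJm, lt_top_iff_ne_top.2 hJ⟩
  have hX : Integrable (fun ω => inner ℝ (D2F ω) (v ω)) P :=
    hF.memLp_deriv2.integrable_inner_of_two hvm
  have hmean : ∫ ω, inner ℝ (D2F ω) (v ω) ∂P = 1 := by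
    rw [← hFv.2 _ _ _ hF, ← hF1]
    simp only [sq]
  have hvar := lintegral_enorm_sub_mean_le hX.aestronglyMeasurable
  rw [hmean] at hvar
  refine iSup₂_le fun h hh => ?_
  rw [integral_map hF.memLp.aestronglyMeasurable.aemeasurable hh.continuous.aestronglyMeasurable]
  refine (ENNReal.ofReal_le_ofReal
    (abs_integral_sub_integral_lipschitz_le hW hvm hFv hF hJi hh)).trans ?_
  rw [ENNReal.ofReal_add (by positivity) (by positivity), ENNReal.ofReal_mul (by positivity),
    ENNReal.ofReal_mul zero_le_two]
  have e1 := ofReal_integral_norm_eq_lintegral_enorm (hX.sub (integrable_const (1 : ℝ)))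
  have e2 := ofReal_integral_norm_eq_lintegral_enorm hJi
  simp only [Pi.sub_apply, Real.norm_eq_abs] at e1 e2
  rw [e1, e2, ENNReal.ofReal_ofNat]
  gcongr
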